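/- **Setup.** Let $m,n,s,r\ge 0$ be integers and put $\varsigma(z)=e^{z/2}-e^{-z/2}$. On the semi-infinite wedge space let $E_{i,j}$ ($i,j\in\mathbb Z+\frac12$) be the normally ordered products of the fermionic operators, that is, $\psi_i\psi_j^\dagger$ if $j>0$ and $-\psi_j^\dagger\psi_i$ if $j<0$. Let $\langle\cdot\rangle$ be the vacuum expectation value, and let $$\mathcal E_a(z)=\sum_{j\in\mathbb Z+\frac12}e^{z(j-\frac a2)}E_{j-a,j}\qquad (a\in\mathbb Z),\qquad \alpha_a=\mathcal E_a(0)$$ (for $a=0$ no constant term $1/\varsigma(z)$ is added). For finite sequences $\mu,\nu$ of positive integers, $k\in\mathbb Z$ and an increasingly ordered set $K\subset[s]=\{1,\dots,s\}$, put $$H_{\mu,\nu}(z_K)=\frac1{\prod_i\mu_i\prod_j\nu_j}\Big\langle\prod_i\alpha_{\mu_i}\prod_{p\in K}\mathcal E_{-k}(z_p)\prod_j\alpha_{-\nu_j}\Big\rangle ,\qquad h^{k,r,s}_{\mu,\nu}=[z_1^{r+1}\cdots z_s^{r+1}]\,H_{\mu,\nu}(z_{[s]}) .$$ The number $h^{k,r,s}_{\mu,\nu}$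 is the (possibly disconnected) $k$-leaky $(r+1)$-completed cycles double Hurwitz number. Subscripts denote sums or subsequences: $\mu_I=\sum_{i\in I}\mu_i$ or $(\mu_i)_{i\in I}$, and $z_K=\sum_{p\in K}z_p$ inside $\varsigma$. The notations $\nu_J+\delta$ and $\mu_{I^c}+\delta$ in an index of $H$ or $h$ mean that a part $\delta$ is added. **Chambers.** Let $V$ be the set of $(x,y,k)\in\mathbb R_{>0}^m\times\mathbb R_{>0}^n\times\mathbb R$ with $\sum_i x_i=\sum_j y_j+sk$. The walls are $W_{I,J,t}=\{x_I-y_J-tk=0\}\subset V$ for all $I\subset[m]$, $J\subset[n]$, $0\le t\le s$ with $(I,J,t)\ne(\emptyset,\emptyset,0),([m],[n],s)$. The chambers are the connected components of $V$ minus all walls. **Theorem (wall crossing formula).** Let $I\subset[m]$, $J\subset[n]$, $0\le t\le s$ with $(I,J)\neq(\emptyset,\emptyset)$ and $(I,J)\ne([m],[n])$. Let $\mathfrak c_1,\mathfrak c_2$ be two chambers bordering the wall $W_{I,J,t}$, i.e. some point of $W_{I,J,t}$ that lies on no wall other than $W_{I,J,t}$ is in the closure of both, and $x_I-y_J-tk$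 is positive on $\mathfrak c_1$ and negative on $\mathfrak c_2$. Then there are polynomials $P_1,P_2\in\mathbb Q[x_1,\dots,x_m,y_1,\dots,y_n,k]$ such that $h^{k,r,s}_{\mu,\nu}=P_a(\mu,\nu,k)$ at all integer points $(\mu,\nu,k)\in\mathfrak c_a$, $a=1,2$. For all such $P_1,P_2$ the difference $WC=P_1-P_2$ satisfies, at every integer point $(\mu,\nu,k)\in\mathfrak c_1$, with $\delta=\mu_I-\nu_J-tk>0$, $$WC(\mu,\nu,k)=[z_1^{r+1}\cdots z_s^{r+1}]\sum_{K\subset[s],\,|K|=t}\delta^2\,\frac{\varsigma(z_K)\,\varsigma(z_{K^c})\,\varsigma(\delta z_{[s]})}{\varsigma(\delta z_K)\,\varsigma(\delta z_{K^c})\,\varsigma(z_{[s]})}\;H_{\mu_I,\nu_J+\delta}(z_K)\;H_{\mu_{I^c}+\delta,\nu_{J^c}}(z_{K^c}).$$ Here $\varsigma(az)/\varsigma(bz)$ denotes its power series expansion, with constant term $a/b$. Moreover, let $r=1$ and $s=m+n-2$ (genus zero). If $t=|I|+|J|-1$, then $$WC(\mu,\nu,k)=\binom{n+m-2}{|I|+|J|-1}\,\delta\;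 h^{k,1,|I|+|J|-1}_{\mu_I,\nu_J+\delta}\;h^{k,1,|I^c|+|J^c|-1}_{\mu_{I^c}+\delta,\nu_{J^c}},$$ and if $t\neq|I|+|J|-1$, then $WC(\mu,\nu,k)=0$. -/

import Mathlib

namespace LeakyHurwitz

noncomputable section

/-! ### The semi-infinite wedge

Half-integers are encoded by integers: the integer `a` stands for the half-integer `a + 1/2`. In
particular `0 ≤ a` means that the half-integer is positive. -/

/-- The basis vectors of the semi-infinite wedge, as sets of half-integers: the vector
`k₁ ∧ k₂ ∧ ⋯` with `k₁ > k₂ > ⋯` and `k_i + i - 1/2` eventually constant is recorded by the set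
`{k₁, k₂, …}`, which has finitely many positive elements and misses finitely many negative ones. -/
@[ext]
structure Maya where
  occ : Set ℤ
  finite_particles : {a | a ∈ occ ∧ 0 ≤ a}.Finite
  finite_holes : {a | a ∉ occ ∧ a < 0}.Finite

/-- The vacuum `-1/2 ∧ -3/2 ∧ -5/2 ∧ ⋯`. -/
def Maya.vacuum : Maya where
  occ := {a | a < 0}
  finite_particles := by
    convert Set.finite_empty (α := ℤ)
    ext a
    simp
  finite_holes := by
    convert Set.finite_empty (α := ℤ)
    ext a
    simp

def Maya.insert (S : Maya) (a : ℤ) : Maya where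
  occ := {b | b = a ∨ b ∈ S.occ}
  finite_particles := by
    refine (S.finite_particles.union (Set.finite_singleton a)).subset ?_
    rintro b ⟨hb | hb, h0⟩
    · exact Or.inr hb
    · exact Or.inl ⟨hb, h0⟩
  finite_holes := S.finite_holes.subset fun _ hb => ⟨fun h => hb.1 (Or.inr h), hb.2⟩

def Maya.erase (S : Maya) (a : ℤ) : Maya where
  occ := {b | b ≠ a ∧ b ∈ S.occ}
  finite_particles := S.finite_particles.subset fun _ hb => ⟨hb.1.2, hb.2⟩
  finite_holes := by
    refine (S.finite_holes.union (Set.finite_singleton a)).subset ?_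
    rintro b ⟨hb, h0⟩
    by_cases h : b = a
    · exact Or.inr h
    · exact Or.inl ⟨fun hS => hb ⟨h, hS⟩, h0⟩

/-- The sign that sorts `a` into its place in `S`: minus one to the (finite) number of elements of
`S` larger than `a`. -/
def Maya.sign (S : Maya) (a : ℤ) : ℤ := (-1) ^ {b | b ∈ S.occ ∧ a < b}.ncard

/-- The semi-infinite wedge space over `R` (all charges). -/
abbrev Fock (R : Type*) [CommRing R] : Type _ := Maya →₀ R

section Operators

variable (R : Type*) [CommRing R]

open Classical in
/-- The operator `ψ_a : v ↦ a ∧ v`. -/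
def psi (a : ℤ) : Module.End R (Fock R) :=
  Finsupp.linearCombination R fun S : Maya =>
    if a ∈ S.occ then 0 else Finsupp.single (S.insert a) ((S.sign a : ℤ) : R)

open Classical in
/-- The adjoint of `ψ_a` for the inner product in which the basis vectors are orthonormal. -/
def psiDag (a : ℤ) : Module.End R (Fock R) :=
  Finsupp.linearCombination R fun S : Maya =>
    if a ∈ S.occ then Finsupp.single (S.erase a) ((S.sign a : ℤ) : R) else 0

/-- The normally ordered products `E_{i,j}`. -/
def normalE (i j : ℤ) : Module.End R (Fock R) :=
  if 0 ≤ j then psi R i * psiDag R j else -(psiDag R j * psi R i)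

/-- The vacuum expectation value `⟨A⟩`. -/
def vev (A : Module.End R (Fock R)) : R :=
  A (Finsupp.single Maya.vacuum 1) Maya.vacuum

end Operators

section Series

variable {σ : Type*}

/-- The exponential of a power series `f` without constant term. -/
def expS (f : MvPowerSeries σ ℚ) : MvPowerSeries σ ℚ := (PowerSeries.exp ℚ).subst f

/-- The operator `∑_{k ∈ ℤ + 1/2} e^{z (k - n/2)} E_{k-n,k}`. On a basis vector only finitely many
terms of the sum are nonzero. For `n ≠ 0` this is `𝓔_n(z)`; for `n = 0` it is `𝓔̃_0(z)`, that is
`𝓔_0(z)` without its constant term `1/ς(z)`, which is the operator used for leaky parameter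
zero. -/
def calE (n : ℤ) (z : MvPowerSeries σ ℚ) :
    Module.End (MvPowerSeries σ ℚ) (Fock (MvPowerSeries σ ℚ)) :=
  Finsupp.linearCombination (MvPowerSeries σ ℚ) fun S : Maya =>
    ∑ᶠ a : ℤ, expS (((a : ℚ) + 1 / 2 - (n : ℚ) / 2) • z) •
      normalE (MvPowerSeries σ ℚ) (a - n) a (Finsupp.single S 1)

/-- The bosonic operator `α_n = 𝓔_n(0)`. -/
def alpha (n : ℤ) : Module.End (MvPowerSeries σ ℚ) (Fock (MvPowerSeries σ ℚ)) := calE n 0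

/-- The series `H_{μ,ν,k}` in the variables `z_p`, `p ∈ K`, where `K` is an ordered list:
`(∏ μ_i ∏ ν_j)⁻¹ ⟨∏_i α_{μ_i} ∏_{p ∈ K} 𝓔_{-k}(z_p) ∏_j α_{-ν_j}⟩`. -/
def hurwitzSeries (μ ν : List ℤ) (k : ℤ) (K : List σ) : MvPowerSeries σ ℚ :=
  ((μ.prod : ℚ) * (ν.prod : ℚ))⁻¹ • vev (MvPowerSeries σ ℚ)
    ((μ.map fun a => alpha a).prod *
      (K.map fun p => calE (-k) (MvPowerSeries.X p)).prod *
      (ν.map fun b => alpha (-b)).prod)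

end Series

/-- The exponent of the monomial `z_1^{r+1} ⋯ z_s^{r+1}`. -/
def fullExponent (s r : ℕ) : Fin s →₀ ℕ := Finsupp.equivFunOnFinite.symm fun _ => r + 1

/-- The possibly disconnected `k`-leaky `(r+1)`-completed cycles double Hurwitz number
`h_{μ,ν}^{≀,k,r,s}`. -/
def hurwitzNumber (μ ν : List ℤ) (k : ℤ) (r s : ℕ) : ℚ :=
  MvPowerSeries.coeff (fullExponent s r) (hurwitzSeries μ ν k (List.finRange s))

/-! ### The functions `ς` -/

/-- `ς(x) = e^{x/2} - e^{-x/2}`. -/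
def sigma : PowerSeries ℚ :=
  PowerSeries.rescale (1 / 2 : ℚ) (PowerSeries.exp ℚ) -
    PowerSeries.rescale (-1 / 2 : ℚ) (PowerSeries.exp ℚ)

/-- `𝓢(x) = ς(x) / x`. -/
def sinhc : PowerSeries ℚ := PowerSeries.mk fun i => PowerSeries.coeff (i + 1) sigma

/-- The power series expansion of `ς(a x) / ς(b x)`, for `b ≠ 0`. -/
def sigmaRatio (a b : ℚ) : PowerSeries ℚ :=
  (a / b) • (PowerSeries.rescale a sinhc * (PowerSeries.rescale b sinhc)⁻¹)

/-- `z_K = ∑_{p ∈ K} z_p`. -/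
def zSum {s : ℕ} (K : Finset (Fin s)) : MvPowerSeries (Fin s) ℚ :=
  ∑ p ∈ K, MvPowerSeries.X p

/-- The expansion of
`ς(z_K) ς(z_{K^c}) ς(δ z_{[s]}) / (ς(δ z_K) ς(δ z_{K^c}) ς(z_{[s]}))`. -/
def sigmaFactor {s : ℕ} (δ : ℚ) (K : Finset (Fin s)) : MvPowerSeries (Fin s) ℚ :=
  (sigmaRatio 1 δ).subst (zSum K) * (sigmaRatio 1 δ).subst (zSum Kᶜ) *
    (sigmaRatio δ 1).subst (zSum (Finset.univ : Finset (Fin s)))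

/-- The sublist of the sequence `μ` indexed by `I`. -/
def parts {m : ℕ} (μ : Fin m → ℤ) (I : Finset (Fin m)) : List ℤ :=
  (I.sort (· ≤ ·)).map μ

/-! ### Walls and chambers -/

/-- The ambient space of the points `(x, y, k)`. -/
abbrev Ambient (m n : ℕ) : Type := (Fin m → ℝ) × (Fin n → ℝ) × ℝ

/-- The parameter space: positive `x_i`, `y_j`, real `k`, with `∑ x_i = ∑ y_j + s k`. -/
def paramSpace (m n s : ℕ) : Set (Ambient m n) :=
  {p | (∀ i, 0 < p.1 i) ∧ (∀ j, 0 < p.2.1 j) ∧ ∑ i, p.1 i = ∑ j, p.2.1 j + (s : ℝ) * p.2.2}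

/-- The linear function `x_I - y_J - t k`. -/
def wallForm {m n : ℕ} (I : Finset (Fin m)) (J : Finset (Fin n)) (t : ℕ) (p : Ambient m n) : ℝ :=
  ∑ i ∈ I, p.1 i - ∑ j ∈ J, p.2.1 j - (t : ℝ) * p.2.2

/-- The wall `W_{I,J,t} : x_I - y_J - t k = 0` in the parameter space. -/
def wall {m n : ℕ} (s : ℕ) (I : Finset (Fin m)) (J : Finset (Fin n)) (t : ℕ) :
    Set (Ambient m n) :=
  {p | p ∈ paramSpace m n s ∧ wallForm I J t p = 0}

/-- The triples `(I, J, t)`, `0 ≤ t ≤ s`, for which `x_I - y_J - t k = 0` is a wall of the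
arrangement: all of them except `(∅, ∅, 0)` and `([m], [n], s)`, for which this equation holds
on the whole parameter space. -/
def IsWallIndex {m n : ℕ} (s : ℕ) (I : Finset (Fin m)) (J : Finset (Fin n)) (t : ℕ) : Prop :=
  t ≤ s ∧ ¬(I = ∅ ∧ J = ∅ ∧ t = 0) ∧ ¬(I = Finset.univ ∧ J = Finset.univ ∧ t = s)

/-- The complement of all walls in the parameter space. -/
def wallComplement (m n s : ℕ) : Set (Ambient m n) :=
  {p | p ∈ paramSpace m n s ∧ ∀ (I : Finset (Fin m)) (J : Finset (Fin n)) (t : ℕ),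
    IsWallIndex s I J t → p ∉ wall s I J t}

/-- Chambers: the connected components of the complement of the walls. -/
def IsChamber {m n : ℕ} (s : ℕ) (c : Set (Ambient m n)) : Prop :=
  ∃ p ∈ wallComplement m n s, c = connectedComponentIn (wallComplement m n s) p

/-- `c₁` and `c₂` are the two chambers on the two sides of the wall `W_{I,J,t}` (at some point of
the wall that lies on no other wall), where `x_I - y_J - t k` is positive on `c₁` and negative
on `c₂`. -/
structure BorderWall {m n : ℕ} (s : ℕ) (I : Finset (Fin m)) (J : Finset (Fin n)) (t : ℕ)
    (c₁ c₂ : Set (Ambient m n)) : Prop where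
  chamber₁ : IsChamber s c₁
  chamber₂ : IsChamber s c₂
  pos : ∀ p ∈ c₁, 0 < wallForm I J t p
  neg : ∀ p ∈ c₂, wallForm I J t p < 0
  common_face : ∃ p ∈ wall s I J t, p ∈ closure c₁ ∧ p ∈ closure c₂ ∧
    ∀ (I' : Finset (Fin m)) (J' : Finset (Fin n)) (t' : ℕ),
      IsWallIndex s I' J' t' → p ∈ wall s I' J' t' → wall s I' J' t' = wall s I J t

/-- The triple `(μ, ν, k)` of integers as a point of the ambient space. -/
def latticePoint {m n : ℕ} (μ : Fin m → ℤ) (ν : Fin n → ℤ) (k : ℤ) : Ambient m n :=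
  (fun i => (μ i : ℝ), fun j => (ν j : ℝ), (k : ℝ))

/-- Polynomials in the variables `x_i`, `y_j`, `k`, and their values at integer points. -/
abbrev ParamPoly (m n : ℕ) : Type := MvPolynomial (Fin m ⊕ Fin n ⊕ Unit) ℚ

def ParamPoly.value {m n : ℕ} (P : ParamPoly m n) (μ : Fin m → ℤ) (ν : Fin n → ℤ) (k : ℤ) : ℚ :=
  MvPolynomial.eval
    (Sum.elim (fun i => (μ i : ℚ)) (Sum.elim (fun j => (ν j : ℚ)) fun _ => (k : ℚ))) P

/-- `P` is the polynomial that gives the leaky Hurwitz numbers at all integer points of `c`. -/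
def IsChamberPolynomial {m n : ℕ} (s r : ℕ) (c : Set (Ambient m n)) (P : ParamPoly m n) : Prop :=
  ∀ (μ : Fin m → ℤ) (ν : Fin n → ℤ) (k : ℤ), latticePoint μ ν k ∈ c →
    hurwitzNumber (List.ofFn μ) (List.ofFn ν) k r s = P.value μ ν k

/-- `δ = μ_I - ν_J - t k`. -/
def delta {m n : ℕ} (I : Finset (Fin m)) (J : Finset (Fin n)) (t : ℕ)
    (μ : Fin m → ℤ) (ν : Fin n → ℤ) (k : ℤ) : ℤ :=
  ∑ i ∈ I, μ i - ∑ j ∈ J, ν j - (t : ℤ) * k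

/-- The series whose coefficient of `z_1^{r+1} ⋯ z_s^{r+1}` is the wall crossing term. -/
def wallCrossingSeries {m n : ℕ} (s : ℕ) (I : Finset (Fin m)) (J : Finset (Fin n)) (t : ℕ)
    (μ : Fin m → ℤ) (ν : Fin n → ℤ) (k : ℤ) : MvPowerSeries (Fin s) ℚ :=
  ∑ K : Finset (Fin s) with K.card = t,
    ((delta I J t μ ν k : ℚ) ^ 2) • (sigmaFactor (delta I J t μ ν k : ℚ) K *
      hurwitzSeries (parts μ I) (parts ν J ++ [delta I J t μ ν k]) k (K.sort (· ≤ ·)) *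
      hurwitzSeries (delta I J t μ ν k :: parts μ Iᶜ) (parts ν Jᶜ) k (Kᶜ.sort (· ≤ ·)))

end

end LeakyHurwitz

namespace LeakyHurwitz

noncomputable section

/-! ### Power series -/

section SeriesLemmas

variable {σ : Type*}

/-! To a set `B` of the `m + s + n` indices attach the block operator `𝓔_{e_B}(z_B)`, where the
energies `e` are `μ_i`, `-k`, `-ν_j` and the variables `z` vanish on the bosonic indices. The
commutator of two disjoint blocks `R`, `N` is `ς(e_R z_N - e_N z_R)` times the block `R ∪ N`,
provided that neither energy nor their sum is zero (`calE_mul_calE`). Inside a chamber no proper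
nonempty set of indices has energy zero, so this relation always applies while a third block is
present.

Fix a point `p` of the wall that lies on no other wall. As long as three blocks remain, one of them
has positive energy at `p` (`exists_pos_block`), hence positive energy in both chambers. It is moved
to the right until it annihilates the vacuum, and every commutator on the way shortens the list. The
procedure depends on `p` only, so it is the same in both chambers. It ends with pairs `[B, Bᶜ]`,
whose expectation value is `ς(e_B z)/ς(z)` if `e_B > 0` and zero if `e_B < 0` (`calE_calE_vac`).
Only pairs with energy zero at `p` distinguish the chambers. This gives `Resolves`: up to a common
weight the correlator is `Q + ∑_T A_T · pair(T)`, with the same polynomial `Q` and `A_T` on both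
sides of the wall, and with `T` running over the sets of zero energy at `p`. These are the sets with
components `I`, `K`, `J`, `|K| = t`, and their complements (`IsFacePoint.eq_opSet_or`).

On the first side `T` has energy `δ > 0` and contributes; on the second side `Tᶜ` does, through the
same ratio at `-δ`. As the ratio is odd in `δ`, the difference is `∑_K (A_T + A_{Tᶜ}) ς(δ z)/ς(z)`.
To identify `A_T + A_{Tᶜ}`, the same procedure is run on the product of the two correlators obtained
by cutting along `T`: blocks on opposite sides then commute, a union across the cut counts as zero
(`cutVev_swap`), and the terminal value is `cutFactor` for the pair `T`, `Tᶜ` and zero for every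
other pair. Dividing by that factor produces the quotient of `ς`-functions in the theorem.

Polynomiality after division by `∏ μ_i ∏ ν_j` holds because a bosonic block has no variable, so its
commutator with a block outside the bosons is divisible by its energy (`exists_blockComm_eq`), while
two bosonic blocks have commutator zero.

In genus zero every operator beyond the second adds at least one to the order of a correlator
(`le_order_vev_blockProd`). The orders of the two factors add up to the degree `2s` of the monomial
that is extracted, so only the constant term of the `ς`-quotient matters, and one factor vanishes
unless `t = |I| + |J| - 1`. -/

open PowerSeries in
theorem expS_X_zero_add_X_one :
    expS (MvPowerSeries.X 0 + MvPowerSeries.X 1 : MvPowerSeries (Fin 2) ℚ) =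
      expS (MvPowerSeries.X 0) * expS (MvPowerSeries.X 1) := by
  ext d
  unfold expS
  rw [coeff_subst_X_zero_add_X_one, coeff_subst_X_zero_subst_mul_X_one]
  simp only [coeff_exp, Algebra.algebraMap_self, RingHom.id_apply]
  rw [Nat.cast_add_choose]
  have h0 : ((d 0).factorial : ℚ) ≠ 0 := by positivity
  have h1 : ((d 1).factorial : ℚ) ≠ 0 := by positivity
  have h2 : ((d 0 + d 1).factorial : ℚ) ≠ 0 := by positivity
  field_simp

theorem hasSubst_of {f : MvPowerSeries σ ℚ} (hf : MvPowerSeries.constantCoeff f = 0) :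
    PowerSeries.HasSubst f := PowerSeries.HasSubst.of_constantCoeff_zero hf

theorem mv_subst_comp_powerSeries {τ υ : Type*} {a : MvPowerSeries τ ℚ} (ha : PowerSeries.HasSubst a)
    {b : τ → MvPowerSeries υ ℚ} (hb : MvPowerSeries.HasSubst b) (f : PowerSeries ℚ) :
    MvPowerSeries.subst b (f.subst a) = f.subst (MvPowerSeries.subst b a) := by
  unfold PowerSeries.subst
  rw [MvPowerSeries.subst_comp_subst_apply ha.const hb]

/-- The identity for two independent variables is universal: substituting `f` and `g` for them gives
the general one. -/
theorem expS_add {f g : MvPowerSeries σ ℚ} (hf : MvPowerSeries.constantCoeff f = 0)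
    (hg : MvPowerSeries.constantCoeff g = 0) : expS (f + g) = expS f * expS g := by
  have hb : MvPowerSeries.HasSubst (![f, g] : Fin 2 → MvPowerSeries σ ℚ) :=
    MvPowerSeries.hasSubst_of_constantCoeff_zero fun i => by fin_cases i <;> simp [hf, hg]
  have h := congrArg (MvPowerSeries.subst (![f, g] : Fin 2 → MvPowerSeries σ ℚ))
    expS_X_zero_add_X_one
  rw [MvPowerSeries.subst_mul hb] at h
  unfold expS at h ⊢
  rw [mv_subst_comp_powerSeries (hasSubst_of (by simp)) hb,
    mv_subst_comp_powerSeries (hasSubst_of (by simp)) hb,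
    mv_subst_comp_powerSeries (hasSubst_of (by simp)) hb, MvPowerSeries.subst_add hb,
    MvPowerSeries.subst_X hb, MvPowerSeries.subst_X hb] at h
  simpa using h

theorem subst_rescale {z : MvPowerSeries σ ℚ} (hz : MvPowerSeries.constantCoeff z = 0) (a : ℚ)
    (f : PowerSeries ℚ) : (PowerSeries.rescale a f).subst z = f.subst (a • z) := by
  rw [PowerSeries.rescale_eq_subst, PowerSeries.subst_comp_subst_apply
    (PowerSeries.HasSubst.smul_X' a) (hasSubst_of hz), PowerSeries.subst_smul (hasSubst_of hz),
    PowerSeries.subst_X (hasSubst_of hz)]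

theorem constantCoeff_smul_eq_zero {z : MvPowerSeries σ ℚ} (hz : MvPowerSeries.constantCoeff z = 0)
    (a : ℚ) : MvPowerSeries.constantCoeff (a • z) = 0 := by
  rw [MvPowerSeries.smul_eq_C_mul, map_mul, hz, mul_zero]

theorem sigma_subst {u : MvPowerSeries σ ℚ} (hu : MvPowerSeries.constantCoeff u = 0) :
    sigma.subst u = expS ((1 / 2 : ℚ) • u) - expS ((-1 / 2 : ℚ) • u) := by
  unfold sigma expS
  rw [PowerSeries.subst_sub (hasSubst_of hu), subst_rescale hu, subst_rescale hu]

theorem constantCoeff_sigma : PowerSeries.constantCoeff sigma = 0 := by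
  unfold sigma
  rw [← PowerSeries.coeff_zero_eq_constantCoeff_apply, map_sub, PowerSeries.coeff_rescale,
    PowerSeries.coeff_rescale]
  simp

theorem sigma_eq : sigma = PowerSeries.X * sinhc := by
  have h := PowerSeries.eq_X_mul_shift_add_const sigma
  rw [constantCoeff_sigma] at h
  simpa [sinhc] using h

theorem constantCoeff_sinhc : PowerSeries.constantCoeff sinhc = 1 := by
  rw [← PowerSeries.coeff_zero_eq_constantCoeff_apply]
  simp [sinhc, sigma, PowerSeries.coeff_rescale, PowerSeries.coeff_exp]
  norm_num

theorem sigma_subst_eq_mul {u : MvPowerSeries σ ℚ} (hu : MvPowerSeries.constantCoeff u = 0) :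
    sigma.subst u = u * sinhc.subst u := by
  rw [sigma_eq, PowerSeries.subst_mul (hasSubst_of hu), PowerSeries.subst_X (hasSubst_of hu)]

theorem sigmaRatio_subst {z : MvPowerSeries σ ℚ} (hz : MvPowerSeries.constantCoeff z = 0) (a : ℚ) :
    (sigmaRatio a 1).subst z = a • (sinhc.subst (a • z) * (sinhc⁻¹).subst z) := by
  unfold sigmaRatio
  rw [PowerSeries.subst_smul (hasSubst_of hz), PowerSeries.subst_mul (hasSubst_of hz),
    subst_rescale hz]
  simp

/-- `ς` is odd, hence `𝓢` is even and only the prefactor `a` changes sign. This sign makes the two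
sides of the wall contribute a sum `A_T + A_{Tᶜ}` instead of a difference. -/
theorem sigmaRatio_neg (a : ℚ) : sigmaRatio (-a) 1 = -sigmaRatio a 1 := by
  have hX : PowerSeries.rescale (-1 : ℚ) sigma = -sigma := by
    unfold sigma
    rw [map_sub, PowerSeries.rescale_rescale, PowerSeries.rescale_rescale]
    norm_num
  have h1 : PowerSeries.rescale (-1 : ℚ) sinhc = sinhc := by
    rw [sigma_eq, map_mul, PowerSeries.rescale_X] at hX
    apply mul_left_cancel₀ PowerSeries.X_ne_zero
    simpa using hX
  unfold sigmaRatio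
  have h2 : PowerSeries.rescale (-a) sinhc = PowerSeries.rescale a sinhc := by
    conv_rhs => rw [← h1, PowerSeries.rescale_rescale]
    simp
  rw [h2, neg_div, neg_smul]

theorem constantCoeff_rescale_sinhc (a : ℚ) :
    PowerSeries.constantCoeff (PowerSeries.rescale a sinhc) = 1 := by
  rw [← PowerSeries.coeff_zero_eq_constantCoeff_apply, PowerSeries.coeff_rescale]
  simp [constantCoeff_sinhc]

theorem sigmaRatio_mul_inv {a b : ℚ} (ha : a ≠ 0) (hb : b ≠ 0) :
    sigmaRatio a b * sigmaRatio b a = 1 := by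
  unfold sigmaRatio
  have h : ∀ c : ℚ, PowerSeries.rescale c sinhc * (PowerSeries.rescale c sinhc)⁻¹ = 1 := fun c =>
    PowerSeries.mul_inv_cancel _ (by rw [constantCoeff_rescale_sinhc]; exact one_ne_zero)
  rw [smul_mul_smul_comm, div_mul_div_cancel₀ hb, div_self ha, one_smul]
  calc _ = (PowerSeries.rescale a sinhc * (PowerSeries.rescale a sinhc)⁻¹) *
      (PowerSeries.rescale b sinhc * (PowerSeries.rescale b sinhc)⁻¹) := by ring
    _ = 1 := by rw [h, h, one_mul]

theorem sigmaRatio_mul_sigma (a : ℚ) : sigmaRatio a 1 * sigma = PowerSeries.rescale a sigma := by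
  unfold sigmaRatio
  rw [sigma_eq, map_mul, PowerSeries.rescale_X, PowerSeries.rescale_one]
  have h : (sinhc⁻¹ : PowerSeries ℚ) * sinhc = 1 :=
    PowerSeries.inv_mul_cancel _ (by rw [constantCoeff_sinhc]; exact one_ne_zero)
  simp only [RingHom.id_apply, div_one, PowerSeries.smul_eq_C_mul]
  linear_combination (PowerSeries.C a * PowerSeries.X * PowerSeries.rescale a sinhc) * h

theorem sigma_ne_zero : sigma ≠ 0 := by
  rw [sigma_eq]
  refine mul_ne_zero PowerSeries.X_ne_zero fun h => ?_
  have := constantCoeff_sinhc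
  simp [h] at this

/-- A geometric sum with exponents symmetric about zero: after multiplication by `ς` it telescopes.
-/
theorem sum_rescale_exp (a : ℕ) :
    ∑ i ∈ Finset.range a, PowerSeries.rescale ((i : ℚ) + (1 - a) / 2) (PowerSeries.exp ℚ) =
      sigmaRatio a 1 := by
  apply mul_right_cancel₀ sigma_ne_zero
  rw [sigmaRatio_mul_sigma]
  have : ∀ i ∈ Finset.range a,
      PowerSeries.rescale ((i : ℚ) + (1 - a) / 2) (PowerSeries.exp ℚ) * sigma =
      PowerSeries.rescale (((i + 1 : ℕ) : ℚ) - a / 2) (PowerSeries.exp ℚ) -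
        PowerSeries.rescale ((i : ℚ) - a / 2) (PowerSeries.exp ℚ) := by
    intro i _
    unfold sigma
    rw [mul_sub, PowerSeries.exp_mul_exp_eq_exp_add, PowerSeries.exp_mul_exp_eq_exp_add]
    congr 3 <;> push_cast <;> ring
  rw [Finset.sum_mul, Finset.sum_congr rfl this,
    Finset.sum_range_sub (fun i : ℕ => PowerSeries.rescale ((i : ℚ) - a / 2) (PowerSeries.exp ℚ))]
  unfold sigma
  rw [map_sub, PowerSeries.rescale_rescale, PowerSeries.rescale_rescale]
  congr 3 <;> push_cast <;> ring

theorem sum_expS (a : ℕ) {u : MvPowerSeries σ ℚ} (hu : MvPowerSeries.constantCoeff u = 0) :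
    ∑ i ∈ Finset.range a, expS (((i : ℚ) + (1 - a) / 2) • u) = (sigmaRatio a 1).subst u := by
  rw [← sum_rescale_exp, ← PowerSeries.coe_substAlgHom (hasSubst_of hu), map_sum]
  refine Finset.sum_congr rfl fun i _ => ?_
  rw [PowerSeries.coe_substAlgHom, subst_rescale hu, expS]

end SeriesLemmas

/-! ### Fermions -/

section Fermions

variable {R : Type*} [CommRing R]

open Classical in
theorem psi_single (a : ℤ) (S : Maya) : psi R a (Finsupp.single S 1) =
    if a ∈ S.occ then 0 else Finsupp.single (S.insert a) ((S.sign a : ℤ) : R) := by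
  simp [psi]

open Classical in
theorem psiDag_single (a : ℤ) (S : Maya) : psiDag R a (Finsupp.single S 1) =
    if a ∈ S.occ then Finsupp.single (S.erase a) ((S.sign a : ℤ) : R) else 0 := by
  simp [psiDag]

theorem Maya.finite_gt (S : Maya) (a : ℤ) : {b | b ∈ S.occ ∧ a < b}.Finite := by
  refine (S.finite_particles.union (Set.finite_Icc a 0)).subset ?_
  rintro b ⟨hb, hab⟩
  by_cases h : 0 ≤ b
  · exact Or.inl ⟨hb, h⟩
  · exact Or.inr ⟨hab.le, by omega⟩

theorem Maya.sign_mul_self (S : Maya) (a : ℤ) : S.sign a * S.sign a = 1 := by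
  unfold Maya.sign
  rw [← mul_pow]
  simp

theorem Maya.sign_insert_of_lt (S : Maya) {a b : ℤ} (hb : b ∉ S.occ) (h : a < b) :
    (S.insert b).sign a = -S.sign a := by
  unfold Maya.sign Maya.insert
  have : {c | c ∈ {c | c = b ∨ c ∈ S.occ} ∧ a < c} = Insert.insert b {c | c ∈ S.occ ∧ a < c} := by
    ext c
    simp only [Set.mem_ofPred_eq, Set.mem_insert_iff]
    constructor
    · rintro ⟨rfl | h1, h2⟩
      · exact Or.inl rfl
      · exact Or.inr ⟨h1, h2⟩
    · rintro (rfl | ⟨h1, h2⟩)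
      · exact ⟨Or.inl rfl, h⟩
      · exact ⟨Or.inr h1, h2⟩
  simp only [this]
  rw [Set.ncard_insert_of_notMem (fun hc => hb hc.1) (S.finite_gt a), pow_succ]
  ring

theorem Maya.sign_insert_of_le (S : Maya) {a b : ℤ} (h : b ≤ a) :
    (S.insert b).sign a = S.sign a := by
  unfold Maya.sign Maya.insert
  have : {c | c ∈ {c | c = b ∨ c ∈ S.occ} ∧ a < c} = {c | c ∈ S.occ ∧ a < c} := by
    ext c
    simp only [Set.mem_ofPred_eq]
    constructor
    · rintro ⟨rfl | h1, h2⟩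
      · omega
      · exact ⟨h1, h2⟩
    · rintro ⟨h1, h2⟩
      exact ⟨Or.inr h1, h2⟩
  simp only [this]

theorem Maya.insert_erase {S : Maya} {b : ℤ} (hb : b ∈ S.occ) : (S.erase b).insert b = S := by
  ext c
  simp only [Maya.insert, Maya.erase, Set.mem_ofPred_eq]
  constructor
  · rintro (rfl | h)
    · exact hb
    · exact h.2
  · intro h
    by_cases hc : c = b
    · exact Or.inl hc
    · exact Or.inr ⟨hc, h⟩

theorem Maya.erase_insert {S : Maya} {b : ℤ} (hb : b ∉ S.occ) : (S.insert b).erase b = S := by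
  ext c
  simp only [Maya.insert, Maya.erase, Set.mem_ofPred_eq]
  constructor
  · rintro ⟨h, rfl | h'⟩
    · exact absurd rfl h
    · exact h'
  · intro h
    exact ⟨fun hc => hb (hc ▸ h), Or.inr h⟩

theorem Maya.notMem_erase (S : Maya) (b : ℤ) : b ∉ (S.erase b).occ := fun h => h.1 rfl

theorem Maya.mem_insert (S : Maya) (b : ℤ) : b ∈ (S.insert b).occ := Or.inl rfl

theorem Maya.sign_erase_of_lt (S : Maya) {a b : ℤ} (hb : b ∈ S.occ) (h : a < b) :
    (S.erase b).sign a = -S.sign a := by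
  have := (S.erase b).sign_insert_of_lt (S.notMem_erase b) h
  rw [Maya.insert_erase hb] at this
  rw [this, neg_neg]

theorem Maya.sign_erase_of_le (S : Maya) {a b : ℤ} (hb : b ∈ S.occ) (h : b ≤ a) :
    (S.erase b).sign a = S.sign a := by
  have := (S.erase b).sign_insert_of_le h
  rw [Maya.insert_erase hb] at this
  rw [this]

theorem end_fock_ext {A B : Module.End R (Fock R)}
    (h : ∀ S : Maya, A (Finsupp.single S 1) = B (Finsupp.single S 1)) : A = B := by
  apply Finsupp.lhom_ext'
  intro S
  apply LinearMap.ext_ring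
  simpa using h S

theorem single_eq_smul (S : Maya) (r : R) :
    (Finsupp.single S r : Fock R) = r • Finsupp.single S 1 := by simp

theorem psi_single' (a : ℤ) (S : Maya) (r : R) : psi R a (Finsupp.single S r) =
    r • psi R a (Finsupp.single S 1) := by
  rw [single_eq_smul, map_smul]

theorem psiDag_single' (a : ℤ) (S : Maya) (r : R) : psiDag R a (Finsupp.single S r) =
    r • psiDag R a (Finsupp.single S 1) := by
  rw [single_eq_smul, map_smul]

theorem Maya.sign_unit_cast (S : Maya) (a : ℤ) : ((S.sign a : ℤ) : R) * ((S.sign a : ℤ) : R) = 1 := by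
  rw [← Int.cast_mul, S.sign_mul_self, Int.cast_one]

theorem psi_psiDag_self (a : ℤ) : psi R a * psiDag R a + psiDag R a * psi R a = 1 := by
  classical
  apply end_fock_ext
  intro S
  simp only [LinearMap.add_apply, Module.End.mul_apply, Module.End.one_apply]
  by_cases h : a ∈ S.occ
  · rw [psi_single, psiDag_single, if_pos h, if_pos h, psi_single', psi_single,
      if_neg (S.notMem_erase a), Maya.insert_erase h, S.sign_erase_of_le h le_rfl]
    simp [S.sign_unit_cast]
  · rw [psi_single, psiDag_single, if_neg h, if_neg h, psiDag_single', psiDag_single,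
      if_pos (S.mem_insert a), Maya.erase_insert h, S.sign_insert_of_le le_rfl]
    simp [S.sign_unit_cast]

theorem Maya.insert_comm (S : Maya) (a b : ℤ) : (S.insert a).insert b = (S.insert b).insert a := by
  ext c
  simp only [Maya.insert, Set.mem_ofPred_eq]
  tauto

theorem Maya.erase_comm (S : Maya) (a b : ℤ) : (S.erase a).erase b = (S.erase b).erase a := by
  ext c
  simp only [Maya.erase, Set.mem_ofPred_eq]
  tauto

theorem Maya.insert_erase_comm (S : Maya) {a b : ℤ} (h : a ≠ b) :
    (S.erase b).insert a = (S.insert a).erase b := by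
  ext c
  simp only [Maya.erase, Maya.insert, Set.mem_ofPred_eq]
  constructor
  · rintro (rfl | h')
    · exact ⟨h, Or.inl rfl⟩
    · exact ⟨h'.1, Or.inr h'.2⟩
  · rintro ⟨h1, h2⟩
    tauto

theorem Maya.mem_insert_iff (S : Maya) {a b : ℤ} (h : a ≠ b) : a ∈ (S.insert b).occ ↔ a ∈ S.occ :=
  ⟨fun h' => h'.resolve_left h, Or.inr⟩

theorem Maya.mem_erase_iff (S : Maya) {a b : ℤ} (h : a ≠ b) : a ∈ (S.erase b).occ ↔ a ∈ S.occ :=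
  ⟨fun h' => h'.2, fun h' => ⟨h, h'⟩⟩

theorem psi_anticomm {a b : ℤ} (hab : a < b) : psi R a * psi R b + psi R b * psi R a = 0 := by
  classical
  apply end_fock_ext
  intro S
  simp only [LinearMap.add_apply, Module.End.mul_apply, LinearMap.zero_apply]
  rw [psi_single, psi_single]
  by_cases ha : a ∈ S.occ
  · by_cases hb : b ∈ S.occ
    · simp [ha, hb]
    · rw [if_neg hb, if_pos ha, psi_single', psi_single,
        if_pos (by rwa [S.mem_insert_iff hab.ne])]
      simp
  · by_cases hb : b ∈ S.occ
    · rw [if_pos hb, if_neg ha, psi_single', psi_single,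
        if_pos (by rwa [S.mem_insert_iff hab.ne'])]
      simp
    · rw [if_neg hb, if_neg ha, psi_single', psi_single, psi_single', psi_single,
        if_neg (by rwa [S.mem_insert_iff hab.ne]), if_neg (by rwa [S.mem_insert_iff hab.ne']),
        S.sign_insert_of_lt hb hab, S.sign_insert_of_le hab.le, S.insert_comm b a]
      simp only [Finsupp.smul_single, smul_eq_mul, ← Finsupp.single_add]
      push_cast
      rw [show (((S.sign b : ℤ) : R) * -((S.sign a : ℤ) : R) +
        ((S.sign a : ℤ) : R) * ((S.sign b : ℤ) : R)) = 0 by ring, Finsupp.single_zero]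

theorem psiDag_anticomm {a b : ℤ} (hab : a < b) :
    psiDag R a * psiDag R b + psiDag R b * psiDag R a = 0 := by
  classical
  apply end_fock_ext
  intro S
  simp only [LinearMap.add_apply, Module.End.mul_apply, LinearMap.zero_apply]
  rw [psiDag_single, psiDag_single]
  by_cases ha : a ∈ S.occ
  · by_cases hb : b ∈ S.occ
    · rw [if_pos hb, if_pos ha, psiDag_single', psiDag_single, psiDag_single', psiDag_single,
        if_pos (by rwa [S.mem_erase_iff hab.ne]), if_pos (by rwa [S.mem_erase_iff hab.ne']),
        S.sign_erase_of_lt hb hab, S.sign_erase_of_le ha hab.le, S.erase_comm b a]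
      simp only [Finsupp.smul_single, smul_eq_mul, ← Finsupp.single_add]
      push_cast
      rw [show (((S.sign b : ℤ) : R) * -((S.sign a : ℤ) : R) +
        ((S.sign a : ℤ) : R) * ((S.sign b : ℤ) : R)) = 0 by ring, Finsupp.single_zero]
    · rw [if_neg hb, if_pos ha, psiDag_single', psiDag_single,
        if_neg (by rwa [S.mem_erase_iff hab.ne'])]
      simp
  · by_cases hb : b ∈ S.occ
    · rw [if_pos hb, if_neg ha, psiDag_single', psiDag_single,
        if_neg (by rwa [S.mem_erase_iff hab.ne])]
      simp
    · simp [ha, hb]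

theorem psi_psiDag_anticomm {a b : ℤ} (hab : a ≠ b) :
    psi R a * psiDag R b + psiDag R b * psi R a = 0 := by
  classical
  apply end_fock_ext
  intro S
  simp only [LinearMap.add_apply, Module.End.mul_apply, LinearMap.zero_apply]
  rw [psi_single, psiDag_single]
  by_cases hb : b ∈ S.occ
  · by_cases ha : a ∈ S.occ
    · rw [if_pos hb, if_pos ha, psi_single', psi_single,
        if_pos (by rwa [S.mem_erase_iff hab])]
      simp
    · rw [if_pos hb, if_neg ha, psi_single', psi_single, psiDag_single', psiDag_single,
        if_neg (by rwa [S.mem_erase_iff hab]), if_pos (by rwa [S.mem_insert_iff hab.symm]),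
        S.insert_erase_comm hab]
      simp only [Finsupp.smul_single, smul_eq_mul, ← Finsupp.single_add]
      rcases lt_or_gt_of_ne hab with h | h
      · rw [S.sign_erase_of_lt hb h, S.sign_insert_of_le h.le]
        push_cast
        rw [show (((S.sign b : ℤ) : R) * -((S.sign a : ℤ) : R) +
          ((S.sign a : ℤ) : R) * ((S.sign b : ℤ) : R)) = 0 by ring, Finsupp.single_zero]
      · rw [S.sign_erase_of_le hb h.le, S.sign_insert_of_lt ha h]
        push_cast
        rw [show (((S.sign b : ℤ) : R) * ((S.sign a : ℤ) : R) +
          ((S.sign a : ℤ) : R) * -((S.sign b : ℤ) : R)) = 0 by ring, Finsupp.single_zero]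
  · by_cases ha : a ∈ S.occ
    · simp [ha, hb]
    · rw [if_neg hb, if_neg ha, psiDag_single', psiDag_single,
        if_neg (by rwa [S.mem_insert_iff hab.symm])]
      simp

theorem psi_anticomm_all (a b : ℤ) : psi R a * psi R b + psi R b * psi R a = 0 := by
  rcases lt_trichotomy a b with h | rfl | h
  · exact psi_anticomm h
  · have : psi R a * psi R a = 0 := by
      classical
      apply end_fock_ext
      intro S
      simp only [Module.End.mul_apply, LinearMap.zero_apply]
      rw [psi_single]
      by_cases ha : a ∈ S.occ
      · simp [ha]
      · rw [if_neg ha, psi_single', psi_single, if_pos (S.mem_insert a), smul_zero]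
    rw [this, add_zero]
  · rw [add_comm]
    exact psi_anticomm h

theorem psiDag_anticomm_all (a b : ℤ) : psiDag R a * psiDag R b + psiDag R b * psiDag R a = 0 := by
  rcases lt_trichotomy a b with h | rfl | h
  · exact psiDag_anticomm h
  · have : psiDag R a * psiDag R a = 0 := by
      classical
      apply end_fock_ext
      intro S
      simp only [Module.End.mul_apply, LinearMap.zero_apply]
      rw [psiDag_single]
      by_cases ha : a ∈ S.occ
      · rw [if_pos ha, psiDag_single', psiDag_single, if_neg (S.notMem_erase a), smul_zero]
      · simp [ha]
    rw [this, add_zero]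
  · rw [add_comm]
    exact psiDag_anticomm h

theorem psi_psiDag_all (a b : ℤ) :
    psi R a * psiDag R b + psiDag R b * psi R a = if b = a then 1 else 0 := by
  split_ifs with h
  · subst h
    exact psi_psiDag_self b
  · exact psi_psiDag_anticomm (Ne.symm h)

/-- The commutator of two bilinears in a ring with canonical anticommutation relations. -/
theorem bilin_comm_of_car {A : Type*} [Ring A] {ψi ψk φj φl : A} {x y : A}
    (h1 : ψi * ψk + ψk * ψi = 0) (h2 : φj * φl + φl * φj = 0)
    (h3 : ψk * φj + φj * ψk = x) (h4 : ψi * φl + φl * ψi = y) :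
    ψi * φj * (ψk * φl) + ψk * y * φj = ψk * φl * (ψi * φj) + ψi * x * φl := by
  subst h3 h4
  have e1 : ψi * ψk = -(ψk * ψi) := eq_neg_of_add_eq_zero_left h1
  have e2 : φj * φl = -(φl * φj) := eq_neg_of_add_eq_zero_left h2
  have e3 : ψi * (ψk * φj) * φl = ψk * ψi * (φl * φj) := by
    calc _ = (ψi * ψk) * (φj * φl) := by noncomm_ring
      _ = _ := by rw [e1, e2, neg_mul_neg]
  calc ψi * φj * (ψk * φl) + ψk * (ψi * φl + φl * ψi) * φj
      = ψk * φl * (ψi * φj) + ψi * (φj * ψk) * φl + ψk * ψi * (φl * φj) := by noncomm_ring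
    _ = ψk * φl * (ψi * φj) + ψi * (φj * ψk) * φl + ψi * (ψk * φj) * φl := by rw [e3]
    _ = _ := by noncomm_ring

theorem neg_eq_of_add_eq_zero_end {M : Type*} [AddCommGroup M] [Module R M]
    {A B : Module.End R M} (h : A + B = 0) : -B = A := (eq_neg_of_add_eq_zero_left h).symm

/-- The fermion bilinear `ψ_i ψ_j^†`, without normal ordering. -/
def bilin (R : Type*) [CommRing R] (i j : ℤ) : Module.End R (Fock R) := psi R i * psiDag R j

theorem bilin_comm (i j k l : ℤ) :
    bilin R i j * bilin R k l + (if l = i then bilin R k j else 0) =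
      bilin R k l * bilin R i j + (if j = k then bilin R i l else 0) := by
  have h := bilin_comm_of_car (A := Module.End R (Fock R)) (psi_anticomm_all i k)
    (psiDag_anticomm_all j l) (psi_psiDag_all k j) (psi_psiDag_all i l)
  convert h using 2 <;> (try split_ifs) <;> simp [bilin]

/-- Normal ordering matters only on the diagonal, so it can be dropped in every operator of nonzero
energy. -/
theorem normalE_eq_bilin {i j : ℤ} (h : i ≠ j) : normalE R i j = bilin R i j := by
  unfold normalE bilin
  split_ifs with h0
  · rfl
  · exact neg_eq_of_add_eq_zero_end (M := Fock R) (psi_psiDag_anticomm h)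

end Fermions

/-! ### The operators `𝓔_n(z)`: finiteness, commutators, action on the vacuum -/

section EnergyOperators

section Window

variable {R : Type*} [CommRing R]

theorem bilin_single_eq_zero {i j : ℤ} (S : Maya) (hij : i ≠ j) (h : j ∉ S.occ ∨ i ∈ S.occ) :
    bilin R i j (Finsupp.single S 1) = 0 := by
  classical
  unfold bilin
  rw [Module.End.mul_apply, psiDag_single]
  split_ifs with hj
  · rcases h with h | h
    · exact absurd hj h
    · rw [psi_single', psi_single, if_pos (by rwa [S.mem_erase_iff hij]), smul_zero]
  · rw [map_zero]

theorem bilin_single_mem {i j : ℤ} (S : Maya) :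
    ∃ r : R, bilin R i j (Finsupp.single S 1) = Finsupp.single ((S.erase j).insert i) r := by
  classical
  unfold bilin
  rw [Module.End.mul_apply, psiDag_single]
  split_ifs with hj
  · rw [psi_single', psi_single]
    split_ifs
    · exact ⟨0, by simp⟩
    · exact ⟨_, by rw [Finsupp.smul_single]⟩
  · exact ⟨0, by simp⟩

open Classical in
theorem bilin_self_single (j : ℤ) (S : Maya) :
    bilin R j j (Finsupp.single S 1) = if j ∈ S.occ then Finsupp.single S 1 else 0 := by
  unfold bilin
  rw [Module.End.mul_apply, psiDag_single]
  split_ifs with hj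
  · rw [psi_single', psi_single, if_neg (S.notMem_erase j), Maya.insert_erase hj,
      S.sign_erase_of_le hj le_rfl, Finsupp.smul_single, smul_eq_mul, S.sign_unit_cast]
  · rw [map_zero]

/-- The span of the basis vectors that agree with the vacuum outside `[-M, M)`. -/
def window (R : Type*) [CommRing R] (M : ℤ) : Submodule R (Fock R) :=
  Finsupp.supported R R {S : Maya | (∀ b ∈ S.occ, b < M) ∧ ∀ b, b < -M → b ∈ S.occ}

theorem single_mem_window {M : ℤ} {S : Maya} (h1 : ∀ b ∈ S.occ, b < M)
    (h2 : ∀ b, b < -M → b ∈ S.occ) (r : R) : Finsupp.single S r ∈ window R M :=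
  Finsupp.single_mem_supported R r ⟨h1, h2⟩

theorem Maya.exists_window (S : Maya) :
    ∃ M : ℤ, 0 ≤ M ∧ (∀ b ∈ S.occ, b < M) ∧ ∀ b, b < -M → b ∈ S.occ := by
  obtain ⟨A, hA⟩ := S.finite_particles.bddAbove
  obtain ⟨B, hB⟩ := S.finite_holes.bddBelow
  refine ⟨max 0 (max (A + 1) (-B)), le_max_left _ _, fun b hb => ?_, fun b hb => ?_⟩
  · by_cases h : 0 ≤ b
    · have := hA ⟨hb, h⟩
      simp only [lt_sup_iff]
      omega
    · simp only [lt_sup_iff]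
      omega
  · by_contra h
    have := hB ⟨h, by omega⟩
    omega

theorem window_induction {M : ℤ} {p : Fock R → Prop} (h0 : p 0) (hadd : ∀ v w, p v → p w → p (v + w))
    (hsmul : ∀ (r : R) v, p v → p (r • v))
    (hs : ∀ S : Maya, (∀ b ∈ S.occ, b < M) → (∀ b, b < -M → b ∈ S.occ) → p (Finsupp.single S 1))
    {v : Fock R} (hv : v ∈ window R M) : p v := by
  unfold window at hv
  rw [Finsupp.supported_eq_span_single] at hv
  induction hv using Submodule.span_induction with
  | mem x hx =>
    obtain ⟨S, hS, rfl⟩ := hx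
    exact hs S hS.1 hS.2
  | zero => exact h0
  | add x y _ _ hx hy => exact hadd x y hx hy
  | smul a x _ hx => exact hsmul a x hx

/-- On a basis vector the result is nonzero only if `a` is occupied and `a - n` is empty, which
forces `a < M` and `a - n ≥ -M`; one particle then moves by `n`. -/
theorem bilin_mem_window {M : ℤ} {n a : ℤ} {v : Fock R} (hn : n ≠ 0) (hv : v ∈ window R M) :
    bilin R (a - n) a v ∈ window R (M + |n|) := by
  refine window_induction (p := fun v => bilin R (a - n) a v ∈ window R (M + |n|)) ?_ ?_ ?_ ?_ hv
  · rw [map_zero]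
    exact Submodule.zero_mem _
  · intro v w hv hw
    rw [map_add]
    exact Submodule.add_mem _ hv hw
  · intro r v hv
    rw [map_smul]
    exact Submodule.smul_mem _ _ hv
  · intro S h1 h2
    by_cases h : a ∉ S.occ ∨ a - n ∈ S.occ
    · rw [bilin_single_eq_zero S (by omega) h]
      exact Submodule.zero_mem _
    · rw [not_or, not_not] at h
      obtain ⟨r, hr⟩ := bilin_single_mem (R := R) (i := a - n) (j := a) S
      rw [hr]
      have ha := h1 a h.1
      have hb : -M ≤ a - n := by
        by_contra hc
        exact h.2 (h2 _ (by omega))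
      have hn1 := le_abs_self n
      have hn2 := neg_le_abs n
      refine single_mem_window ?_ ?_ r
      · rintro b (rfl | hb)
        · omega
        · have := h1 b hb.2
          have := abs_nonneg n
          omega
      · intro b hb
        exact Or.inr ⟨by omega, h2 b (by omega)⟩

theorem bilin_eq_zero_of_window {M : ℤ} {n a : ℤ} {v : Fock R} (hn : n ≠ 0) (hv : v ∈ window R M)
    (ha : a ∉ Finset.Icc (-M - |n|) (M + |n|)) : bilin R (a - n) a v = 0 := by
  refine window_induction (p := fun v => bilin R (a - n) a v = 0) ?_ ?_ ?_ ?_ hv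
  · rw [map_zero]
  · intro v w hv hw
    rw [map_add, hv, hw, add_zero]
  · intro r v hv
    rw [map_smul, hv, smul_zero]
  · intro S h1 h2
    apply bilin_single_eq_zero S (by omega)
    by_contra h
    rw [not_or, not_not] at h
    have ha' := h1 a h.1
    have hb : -M ≤ a - n := by
      by_contra hc
      exact h.2 (h2 _ (by omega))
    have hn1 := le_abs_self n
    have hn2 := neg_le_abs n
    rw [Finset.mem_Icc] at ha
    omega

end Window

variable {σ : Type*}

/-- The coefficient of `E_{a-n,a}` in `𝓔_n(z)`. -/
def energyCoeff (n : ℤ) (z : MvPowerSeries σ ℚ) (a : ℤ) : MvPowerSeries σ ℚ :=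
  expS (((a : ℚ) + 1 / 2 - (n : ℚ) / 2) • z)

/-- The range `W` may be any sufficiently large finite set, so that the two factors of a product, in
either order, can share one range of summation. -/
theorem calE_eq_sum {n : ℤ} (hn : n ≠ 0) (z : MvPowerSeries σ ℚ) {M : ℤ}
    {W : Finset ℤ} (hW : Finset.Icc (-M - |n|) (M + |n|) ⊆ W) {v : Fock (MvPowerSeries σ ℚ)}
    (hv : v ∈ window (MvPowerSeries σ ℚ) M) :
    calE n z v = ∑ a ∈ W, energyCoeff n z a • bilin (MvPowerSeries σ ℚ) (a - n) a v := by
  refine window_induction (p := fun v => calE n z v =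
    ∑ a ∈ W, energyCoeff n z a • bilin (MvPowerSeries σ ℚ) (a - n) a v) ?_ ?_ ?_ ?_ hv
  · simp
  · intro v w hv hw
    simp only [map_add, hv, hw, smul_add, Finset.sum_add_distrib]
  · intro r v hv
    simp only [map_smul, hv, Finset.smul_sum]
    exact Finset.sum_congr rfl fun a _ => smul_comm _ _ _
  · intro S h1 h2
    unfold calE
    rw [Finsupp.linearCombination_single, one_smul]
    rw [finsum_eq_sum_of_support_subset (s := W)]
    · exact Finset.sum_congr rfl fun a _ => by rw [normalE_eq_bilin (by omega)]; rfl
    · intro a ha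
      by_contra haW
      apply ha
      change _ • _ = _
      rw [normalE_eq_bilin (by omega), bilin_eq_zero_of_window hn (single_mem_window h1 h2 1)
        (fun h => haW (Finset.mem_coe.2 (hW h))), smul_zero]

theorem calE_mem_window {n : ℤ} (hn : n ≠ 0) (z : MvPowerSeries σ ℚ) {M : ℤ}
    {v : Fock (MvPowerSeries σ ℚ)} (hv : v ∈ window (MvPowerSeries σ ℚ) M) :
    calE n z v ∈ window (MvPowerSeries σ ℚ) (M + |n|) := by
  rw [calE_eq_sum hn z subset_rfl hv]
  exact Submodule.sum_mem _ fun a _ => Submodule.smul_mem _ _ (bilin_mem_window hn hv)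

theorem calE_mul_eq_sum {a b : ℤ} (ha : a ≠ 0) (hb : b ≠ 0) (z w : MvPowerSeries σ ℚ) {M : ℤ}
    {W : Finset ℤ} (hW : Finset.Icc (-(M + |a| + |b|)) (M + |a| + |b|) ⊆ W)
    {v : Fock (MvPowerSeries σ ℚ)} (hv : v ∈ window (MvPowerSeries σ ℚ) M) :
    (calE a z * calE b w) v = ∑ j ∈ W, ∑ i ∈ W, (energyCoeff a z i * energyCoeff b w j) •
      (bilin (MvPowerSeries σ ℚ) (i - a) i * bilin (MvPowerSeries σ ℚ) (j - b) j) v := by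
  have h0a := abs_nonneg a
  have h0b := abs_nonneg b
  rw [Module.End.mul_apply, calE_eq_sum ha z (W := W) (M := M + |b|) _ (calE_mem_window hb w hv),
    Finset.sum_comm]
  · refine Finset.sum_congr rfl fun i _ => ?_
    rw [calE_eq_sum hb w (W := W) (M := M) _ hv, map_sum, Finset.smul_sum]
    · refine Finset.sum_congr rfl fun j _ => ?_
      rw [map_smul, smul_smul, Module.End.mul_apply]
    · refine subset_trans (Finset.Icc_subset_Icc ?_ ?_) hW <;> omega
  · refine subset_trans (Finset.Icc_subset_Icc ?_ ?_) hW <;> omega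

theorem bilin_comm_apply {R : Type*} [CommRing R] (i j k l : ℤ) (v : Fock R) :
    (bilin R i j * bilin R k l) v = (bilin R k l * bilin R i j) v +
      (if k = j then bilin R i l v else 0) - (if l = i then bilin R k j v else 0) := by
  have h := congrArg (fun A : Module.End R (Fock R) => A v) (bilin_comm (R := R) i j k l)
  simp only [LinearMap.add_apply] at h
  rw [eq_sub_iff_add_eq]
  convert h using 2
  · split_ifs <;> rfl
  · by_cases hkj : k = j
    · rw [if_pos hkj, if_pos hkj.symm]
    · rw [if_neg hkj, if_neg (Ne.symm hkj)]
      rfl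

/-- The exponents of `z` and `w` are written as a common value plus corrections proportional to `c`.
The two contractions of a commutator correspond to `c = 1/2` and `c = -1/2`, and the difference of
the resulting factors is `ς(a w - b z)`. -/
theorem energyCoeff_mul {z w : MvPowerSeries σ ℚ} (hz : MvPowerSeries.constantCoeff z = 0)
    (hw : MvPowerSeries.constantCoeff w = 0) (a b : ℤ) (i j : ℤ) (c : ℚ) (n : ℤ) (l : ℤ)
    (h1 : (i : ℚ) + 1 / 2 - (a : ℚ) / 2 = l + 1 / 2 - (n : ℚ) / 2 - c * b)
    (h2 : (j : ℚ) + 1 / 2 - (b : ℚ) / 2 = l + 1 / 2 - (n : ℚ) / 2 + c * a) :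
    energyCoeff a z i * energyCoeff b w j =
      energyCoeff n (z + w) l * expS (c • ((a : ℚ) • w - (b : ℚ) • z)) := by
  unfold energyCoeff
  have hz' := fun c : ℚ => constantCoeff_smul_eq_zero hz c
  have hw' := fun c : ℚ => constantCoeff_smul_eq_zero hw c
  rw [← expS_add (hz' _) (hw' _), ← expS_add, h1, h2]
  · congr 1
    module
  · exact constantCoeff_smul_eq_zero (by rw [map_add, hz, hw, add_zero]) _
  · exact constantCoeff_smul_eq_zero (by rw [map_sub, hz', hw', sub_zero]) _

theorem exists_mem_window {R : Type*} [CommRing R] (S : Maya) :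
    ∃ M : ℤ, 0 ≤ M ∧ Finsupp.single S (1 : R) ∈ window R M := by
  obtain ⟨M, h0, h1, h2⟩ := S.exists_window
  exact ⟨M, h0, single_mem_window h1 h2 1⟩

/-- Each Kronecker delta in the commutator of bilinears removes one summation. The conditions `j - b
∈ W` and `i - a ∈ W` are artefacts of truncating to `W`. -/
theorem sum_bilin_comm {R : Type*} [CommRing R] (A B : ℤ → R) (a b : ℤ) (W : Finset ℤ)
    (v : Fock R) :
    ∑ j ∈ W, ∑ i ∈ W, (A i * B j) • (bilin R (i - a) i * bilin R (j - b) j) v =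
      ∑ i ∈ W, ∑ j ∈ W, (B j * A i) • (bilin R (j - b) j * bilin R (i - a) i) v +
        (∑ j ∈ W, (if j - b ∈ W then (A (j - b) * B j) • bilin R (j - b - a) j v else 0) -
          ∑ i ∈ W, (if i - a ∈ W then (A i * B (i - a)) • bilin R (i - a - b) i v else 0)) := by
  have h1 : ∀ i j, (A i * B j) • (bilin R (i - a) i * bilin R (j - b) j) v =
      (B j * A i) • (bilin R (j - b) j * bilin R (i - a) i) v +
        ((if j - b = i then (A i * B j) • bilin R (i - a) j v else 0) -
          (if j = i - a then (A i * B j) • bilin R (j - b) i v else 0)) := by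
    intro i j
    rw [bilin_comm_apply, add_sub_assoc, smul_add, smul_sub, smul_ite, smul_ite, smul_zero,
      mul_comm (A i)]
  rw [Finset.sum_congr rfl fun j _ => Finset.sum_congr rfl fun i _ => h1 i j]
  simp only [Finset.sum_add_distrib, Finset.sum_sub_distrib, Finset.sum_ite_eq]
  rw [Finset.sum_comm (s := W) (t := W) (f := fun j i => (B j * A i) •
    (bilin R (j - b) j * bilin R (i - a) i) v), Finset.sum_comm (s := W) (t := W)
    (f := fun j i => if j = i - a then (A i * B j) • bilin R (j - b) i v else 0)]
  simp only [Finset.sum_ite_eq']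

theorem sum_bilin_shift {a b : ℤ} (hab : a + b ≠ 0) {z w : MvPowerSeries σ ℚ}
    (hz : MvPowerSeries.constantCoeff z = 0) (hw : MvPowerSeries.constantCoeff w = 0) {M : ℤ}
    {v : Fock (MvPowerSeries σ ℚ)} (hv : v ∈ window (MvPowerSeries σ ℚ) M) {W : Finset ℤ}
    (hW : Finset.Icc (-(M + 2 * (|a| + |b|))) (M + 2 * (|a| + |b|)) ⊆ W) :
    ∑ j ∈ W, (if j - b ∈ W then (energyCoeff a z (j - b) * energyCoeff b w j) •
        bilin (MvPowerSeries σ ℚ) (j - b - a) j v else 0) =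
      expS ((1 / 2 : ℚ) • ((a : ℚ) • w - (b : ℚ) • z)) • calE (a + b) (z + w) v := by
  have habs := abs_add_le a b
  have h0a := abs_nonneg a
  have h0b := abs_nonneg b
  have hlb := le_abs_self b
  have hnb := neg_le_abs b
  rw [calE_eq_sum hab (z + w) (W := W)
    (subset_trans (Finset.Icc_subset_Icc (by omega) (by omega)) hW) hv, Finset.smul_sum]
  refine Finset.sum_congr rfl fun j _ => ?_
  rw [show j - b - a = j - (a + b) by ring, smul_smul]
  split_ifs with hj
  · rw [energyCoeff_mul hz hw a b (j - b) j (1 / 2) (a + b) j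
      (by push_cast; ring) (by push_cast; ring), mul_comm]
  -- An index dropped by the truncation is so far from the window that its bilinear kills `v`
  -- anyway.
  · rw [bilin_eq_zero_of_window hab hv, smul_zero]
    refine fun h => hj (hW ?_)
    rw [Finset.mem_Icc] at h ⊢
    omega

/-- The commutation relation of the operators `𝓔_a(z)`, away from energy zero. -/
theorem calE_mul_calE {a b : ℤ} (ha : a ≠ 0) (hb : b ≠ 0) (hab : a + b ≠ 0)
    {z w : MvPowerSeries σ ℚ} (hz : MvPowerSeries.constantCoeff z = 0)
    (hw : MvPowerSeries.constantCoeff w = 0) :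
    calE a z * calE b w = calE b w * calE a z +
      sigma.subst ((a : ℚ) • w - (b : ℚ) • z) • calE (a + b) (z + w) := by
  have hz' := fun c : ℚ => constantCoeff_smul_eq_zero hz c
  have hw' := fun c : ℚ => constantCoeff_smul_eq_zero hw c
  rw [sigma_subst (by rw [map_sub, hz', hw', sub_zero])]
  apply end_fock_ext
  intro S
  obtain ⟨M, hM, hv⟩ := exists_mem_window (R := MvPowerSeries σ ℚ) S
  generalize Finsupp.single S (1 : MvPowerSeries σ ℚ) = v at hv
  have h0a := abs_nonneg a
  have h0b := abs_nonneg b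
  obtain ⟨W, hW⟩ : ∃ W, W = Finset.Icc (-(M + 2 * (|a| + |b|))) (M + 2 * (|a| + |b|)) := ⟨_, rfl⟩
  have h1 : Finset.Icc (-(M + |a| + |b|)) (M + |a| + |b|) ⊆ W :=
    hW ▸ Finset.Icc_subset_Icc (by omega) (by omega)
  have h2 : Finset.Icc (-(M + |b| + |a|)) (M + |b| + |a|) ⊆ W :=
    hW ▸ Finset.Icc_subset_Icc (by omega) (by omega)
  rw [LinearMap.add_apply, LinearMap.smul_apply, calE_mul_eq_sum ha hb z w h1 hv,
    calE_mul_eq_sum hb ha w z h2 hv, sum_bilin_comm, sub_smul,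
    sum_bilin_shift hab hz hw hv hW.ge]
  -- The second contraction is the first one with `(a, z)` and `(b, w)` exchanged, which reverses
  -- the sign of the exponent.
  have h3 := sum_bilin_shift (by rwa [add_comm]) hw hz hv (a := b) (b := a) (W := W)
    (by rw [hW, add_comm |b|])
  rw [show ((1 : ℚ) / 2) • ((b : ℚ) • z - (a : ℚ) • w) =
    ((-1 : ℚ) / 2) • ((a : ℚ) • w - (b : ℚ) • z) by module, add_comm b a, add_comm w z] at h3
  rw [← h3]
  simp only [mul_comm (energyCoeff a z _)]

/-- The vacuum vector. -/
def vac (R : Type*) [CommRing R] : Fock R := Finsupp.single Maya.vacuum 1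

theorem vac_mem_window (R : Type*) [CommRing R] {M : ℤ} (hM : 0 ≤ M) : vac R ∈ window R M :=
  single_mem_window (S := Maya.vacuum) (fun b (hb : b < 0) => by omega)
    (fun b hb => show b < 0 by omega) 1

theorem bilin_vac {R : Type*} [CommRing R] {n : ℤ} (hn : 0 < n) (a : ℤ) :
    bilin R (a - n) a (vac R) = 0 := by
  refine bilin_single_eq_zero _ (by omega) ?_
  by_cases h : a < 0
  · exact Or.inr (show a - n < 0 by omega)
  · exact Or.inl h

theorem calE_vac {n : ℤ} (hn : 0 < n) (z : MvPowerSeries σ ℚ) : calE n z (vac _) = 0 := by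
  rw [calE_eq_sum hn.ne' z subset_rfl (vac_mem_window _ le_rfl)]
  exact Finset.sum_eq_zero fun a _ => by rw [bilin_vac hn, smul_zero]

/-- The first operator lifts a particle by `a` and the second must put it back. This is possible
exactly from the `a` occupied places in `[-a, 0)`, and the exponentials form a geometric sum. This
replaces the commutation relation in the excluded case of total energy zero. -/
theorem calE_calE_vac {a : ℤ} (ha : 0 < a) {z w : MvPowerSeries σ ℚ}
    (hz : MvPowerSeries.constantCoeff z = 0) (hw : MvPowerSeries.constantCoeff w = 0) :
    (calE a z * calE (-a) w) (vac _) = (sigmaRatio a 1).subst (z + w) • vac _ := by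
  classical
  have hzw : MvPowerSeries.constantCoeff (z + w) = 0 := by rw [map_add, hz, hw, add_zero]
  set W := Finset.Icc (-(2 * a)) (2 * a) with hW
  rw [calE_mul_eq_sum ha.ne' (neg_ne_zero.2 ha.ne') z w (W := W) (M := 0)
    (Finset.Icc_subset_Icc (by rw [abs_neg, abs_of_pos ha]; omega)
      (by rw [abs_neg, abs_of_pos ha]; omega)) (vac_mem_window _ le_rfl)]
  have key : ∀ j ∈ W, ∑ i ∈ W, (energyCoeff a z i * energyCoeff (-a) w j) •
      (bilin (MvPowerSeries σ ℚ) (i - a) i * bilin (MvPowerSeries σ ℚ) (j - -a) j) (vac _) =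
      if j ∈ Finset.Ico (-a) 0 then
        expS (((j : ℚ) + 1 / 2 + (a : ℚ) / 2) • (z + w)) • vac (MvPowerSeries σ ℚ) else 0 := by
    intro j _
    have : ∀ i, (bilin (MvPowerSeries σ ℚ) (i - a) i *
        bilin (MvPowerSeries σ ℚ) (j - -a) j) (vac _) =
        if j - -a = i then (if j ∈ Finset.Ico (-a) 0 then vac (MvPowerSeries σ ℚ) else 0) else 0 := by
      intro i
      -- After commuting, the lowering bilinear meets the vacuum and only the diagonal terms at `j`
      -- and `j + a` survive. Their difference is one exactly if `j` is occupied and `j + a` is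
      -- empty.
      rw [bilin_comm_apply, Module.End.mul_apply, bilin_vac ha, map_zero, zero_add]
      by_cases h : j - -a = i
      · subst h
        rw [if_pos rfl, if_pos rfl, if_pos (by omega), show j - -a - a = j by ring]
        unfold vac
        rw [bilin_self_single, bilin_self_single]
        have hocc : ∀ b, b ∈ Maya.vacuum.occ ↔ b < 0 := fun _ => Iff.rfl
        simp only [Finset.mem_Ico, hocc]
        split_ifs <;> first | omega | simp
      · rw [if_neg h, if_neg h, if_neg (by omega), sub_zero]
    simp only [this, smul_ite, smul_zero]
    rw [Finset.sum_ite_eq]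
    by_cases hj : j ∈ Finset.Ico (-a) 0
    · have hj' := Finset.mem_Ico.1 hj
      rw [if_pos (by rw [hW, Finset.mem_Icc]; omega), if_pos hj, if_pos hj]
      congr 1
      unfold energyCoeff
      rw [← expS_add (constantCoeff_smul_eq_zero hz _) (constantCoeff_smul_eq_zero hw _)]
      congr 1
      rw [smul_add]
      congr 2 <;> push_cast <;> ring
    · simp [hj]
  rw [Finset.sum_congr rfl key, ← Finset.sum_filter, ← Finset.sum_smul]
  congr 1
  lift a to ℕ using ha.le
  rw [show ((a : ℤ) : ℚ) = (a : ℚ) by simp, ← sum_expS a hzw]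
  refine Finset.sum_bij' (fun j _ => (j + a).toNat) (fun i _ => (i : ℤ) - a) ?_ ?_ ?_ ?_ ?_
  · intro j hj
    simp only [Finset.mem_filter, Finset.mem_Ico] at hj
    rw [Finset.mem_range]
    omega
  · intro i hi
    rw [Finset.mem_range] at hi
    simp only [Finset.mem_filter, Finset.mem_Ico, hW, Finset.mem_Icc]
    omega
  · intro j hj
    simp only [Finset.mem_filter, Finset.mem_Ico] at hj
    omega
  · intro i hi
    omega
  · intro j hj
    simp only [Finset.mem_filter, Finset.mem_Ico] at hj
    have h : (((j + a).toNat : ℕ) : ℚ) = (j : ℚ) + a := by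
      have : (((j + a).toNat : ℕ) : ℤ) = j + a := by omega
      exact_mod_cast this
    rw [h]
    congr 2
    ring

end EnergyOperators

/-! ### Families of power series with polynomial coefficients -/

section PolynomialFamilies

variable {ι σ : Type*}

/-- `f` is a polynomial function of `v`. -/
def IsPolyFun (f : (ι → ℚ) → ℚ) : Prop := ∃ P : MvPolynomial ι ℚ, ∀ v, f v = MvPolynomial.eval v P

/-- The coefficients of `F v` are polynomial functions of `v`. -/
def IsPolyFam (F : (ι → ℚ) → MvPowerSeries σ ℚ) : Prop :=
  ∀ d, IsPolyFun fun v => MvPowerSeries.coeff d (F v)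

theorem IsPolyFun.const (c : ℚ) : IsPolyFun fun _ : ι → ℚ => c := ⟨MvPolynomial.C c, by simp⟩

theorem IsPolyFun.add {f g : (ι → ℚ) → ℚ} (hf : IsPolyFun f) (hg : IsPolyFun g) :
    IsPolyFun fun v => f v + g v := by
  obtain ⟨P, hP⟩ := hf
  obtain ⟨Q, hQ⟩ := hg
  exact ⟨P + Q, fun v => by simp [hP, hQ]⟩

theorem IsPolyFun.mul {f g : (ι → ℚ) → ℚ} (hf : IsPolyFun f) (hg : IsPolyFun g) :
    IsPolyFun fun v => f v * g v := by
  obtain ⟨P, hP⟩ := hf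
  obtain ⟨Q, hQ⟩ := hg
  exact ⟨P * Q, fun v => by simp [hP, hQ]⟩

theorem IsPolyFun.sum {α : Type*} (s : Finset α) {f : α → (ι → ℚ) → ℚ}
    (hf : ∀ a ∈ s, IsPolyFun (f a)) : IsPolyFun fun v => ∑ a ∈ s, f a v := by
  classical
  induction s using Finset.induction_on with
  | empty => simpa using IsPolyFun.const 0
  | insert a s ha ih =>
    simp only [Finset.sum_insert ha]
    exact (hf a (Finset.mem_insert_self a s)).add
      (ih fun b hb => hf b (Finset.mem_insert_of_mem hb))

theorem IsPolyFun.coord (x : ι) : IsPolyFun fun v => v x := ⟨MvPolynomial.X x, by simp⟩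

theorem IsPolyFun.blockSum (B : Finset ι) : IsPolyFun fun v => ∑ x ∈ B, v x :=
  IsPolyFun.sum B fun x _ => IsPolyFun.coord x

theorem IsPolyFam.const (f : MvPowerSeries σ ℚ) : IsPolyFam fun _ : ι → ℚ => f :=
  fun _ => IsPolyFun.const _

theorem IsPolyFam.add {F G : (ι → ℚ) → MvPowerSeries σ ℚ} (hF : IsPolyFam F) (hG : IsPolyFam G) :
    IsPolyFam fun v => F v + G v := fun d => by
  simpa using (hF d).add (hG d)

theorem IsPolyFam.smul {f : (ι → ℚ) → ℚ} {F : (ι → ℚ) → MvPowerSeries σ ℚ} (hf : IsPolyFun f)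
    (hF : IsPolyFam F) : IsPolyFam fun v => f v • F v := fun d => by
  simpa using hf.mul (hF d)

theorem IsPolyFam.neg {F : (ι → ℚ) → MvPowerSeries σ ℚ} (hF : IsPolyFam F) :
    IsPolyFam fun v => -F v := by
  simpa using IsPolyFam.smul (IsPolyFun.const (-1)) hF

theorem IsPolyFam.sub {F G : (ι → ℚ) → MvPowerSeries σ ℚ} (hF : IsPolyFam F) (hG : IsPolyFam G) :
    IsPolyFam fun v => F v - G v := by
  simpa only [sub_eq_add_neg] using hF.add hG.neg

theorem IsPolyFam.mul {F G : (ι → ℚ) → MvPowerSeries σ ℚ} (hF : IsPolyFam F) (hG : IsPolyFam G) :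
    IsPolyFam fun v => F v * G v := fun d => by
  classical
  simp only [MvPowerSeries.coeff_mul]
  exact IsPolyFun.sum _ fun a _ => (hF a.1).mul (hG a.2)

theorem IsPolyFam.pow {F : (ι → ℚ) → MvPowerSeries σ ℚ} (hF : IsPolyFam F) (n : ℕ) :
    IsPolyFam fun v => F v ^ n := by
  induction n with
  | zero => simpa using IsPolyFam.const 1
  | succ n ih => simpa only [pow_succ] using ih.mul hF

theorem IsPolyFam.sum {α : Type*} (s : Finset α) {F : α → (ι → ℚ) → MvPowerSeries σ ℚ}
    (hF : ∀ a ∈ s, IsPolyFam (F a)) : IsPolyFam fun v => ∑ a ∈ s, F a v := fun d => by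
  simp only [map_sum]
  exact IsPolyFun.sum s fun a ha => hF a ha d

/-- Since `g ^ n` has order at least `n`, the range of summation depends on `d` alone and not on
`g`. This is what makes the coefficients of a substituted family polynomial. -/
theorem coeff_powerSeries_subst {g : MvPowerSeries σ ℚ} (hg : MvPowerSeries.constantCoeff g = 0)
    (f : PowerSeries ℚ) (d : σ →₀ ℕ) : MvPowerSeries.coeff d (f.subst g) =
      ∑ n ∈ Finset.range (d.degree + 1), PowerSeries.coeff n f * MvPowerSeries.coeff d (g ^ n) := by
  rw [PowerSeries.coeff_subst (hasSubst_of hg)]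
  simp only [smul_eq_mul]
  refine finsum_eq_sum_of_support_subset _ fun n hn => ?_
  by_contra h
  apply hn
  have hlt : d.degree < n := by
    simpa [Nat.lt_succ_iff] using h
  have h1 : (n : ℕ∞) ≤ (g ^ n).order := MvPowerSeries.le_order_pow_of_constantCoeff_eq_zero n hg
  change _ * _ = _
  rw [MvPowerSeries.coeff_of_lt_order (lt_of_lt_of_le (by exact_mod_cast hlt) h1), mul_zero]

theorem IsPolyFam.subst (f : PowerSeries ℚ) {G : (ι → ℚ) → MvPowerSeries σ ℚ} (hG : IsPolyFam G)
    (h0 : ∀ v, MvPowerSeries.constantCoeff (G v) = 0) : IsPolyFam fun v => f.subst (G v) :=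
  fun d => by
    simp only [fun v => coeff_powerSeries_subst (h0 v) f d]
    exact IsPolyFun.sum _ fun n _ => (IsPolyFun.const _).mul (hG.pow n d)

/-- The factor `f v` is split off because it has to cancel the weight when one block of a final pair
is bosonic. -/
theorem IsPolyFam.exists_sigmaRatio {f : (ι → ℚ) → ℚ} (hf : IsPolyFun f) {z : MvPowerSeries σ ℚ}
    (hz : MvPowerSeries.constantCoeff z = 0) : ∃ κ : (ι → ℚ) → MvPowerSeries σ ℚ,
      IsPolyFam κ ∧ ∀ v, (sigmaRatio (f v) 1).subst z = f v • κ v :=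
  ⟨fun v => sinhc.subst (f v • z) * (sinhc⁻¹).subst z,
    (IsPolyFam.subst sinhc (IsPolyFam.smul hf (IsPolyFam.const z)) fun _ =>
      constantCoeff_smul_eq_zero hz _).mul (IsPolyFam.const _),
    fun _ => sigmaRatio_subst hz _⟩

theorem IsPolyFam.sigmaRatio {f : (ι → ℚ) → ℚ} (hf : IsPolyFun f) {z : MvPowerSeries σ ℚ}
    (hz : MvPowerSeries.constantCoeff z = 0) :
    IsPolyFam fun v => (LeakyHurwitz.sigmaRatio (f v) 1).subst z := by
  obtain ⟨κ, hκ, h⟩ := IsPolyFam.exists_sigmaRatio hf hz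
  simp only [h]
  exact IsPolyFam.smul hf hκ

end PolynomialFamilies

/-! ### Blocks -/

section Blocks

variable {ι σ : Type*}

/-- The operator `𝓔_{e_B}(z_B)` attached to a block `B`. -/
def blockOp (z : ι → MvPowerSeries σ ℚ) (e : ι → ℤ) (B : Finset ι) :
    Module.End (MvPowerSeries σ ℚ) (Fock (MvPowerSeries σ ℚ)) :=
  calE (∑ x ∈ B, e x) (∑ x ∈ B, z x)

/-- The product of the operators attached to a list of blocks. -/
def blockProd (z : ι → MvPowerSeries σ ℚ) (e : ι → ℤ) (L : List (Finset ι)) :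
    Module.End (MvPowerSeries σ ℚ) (Fock (MvPowerSeries σ ℚ)) := (L.map (blockOp z e)).prod

/-- The structure constant in the commutator of the operators of two blocks. -/
def blockComm (z : ι → MvPowerSeries σ ℚ) (v : ι → ℚ) (R N : Finset ι) : MvPowerSeries σ ℚ :=
  sigma.subst ((∑ x ∈ R, v x) • (∑ x ∈ N, z x) - (∑ x ∈ N, v x) • (∑ x ∈ R, z x))

theorem constantCoeff_blockSum {z : ι → MvPowerSeries σ ℚ}
    (hz : ∀ x, MvPowerSeries.constantCoeff (z x) = 0) (B : Finset ι) :
    MvPowerSeries.constantCoeff (∑ x ∈ B, z x) = 0 := by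
  rw [map_sum]
  exact Finset.sum_eq_zero fun x _ => hz x

theorem constantCoeff_blockComm_arg {z : ι → MvPowerSeries σ ℚ}
    (hz : ∀ x, MvPowerSeries.constantCoeff (z x) = 0) (a b : ℚ) (R N : Finset ι) :
    MvPowerSeries.constantCoeff (a • (∑ x ∈ N, z x) - b • (∑ x ∈ R, z x)) = 0 := by
  rw [map_sub, constantCoeff_smul_eq_zero (constantCoeff_blockSum hz N),
    constantCoeff_smul_eq_zero (constantCoeff_blockSum hz R), sub_zero]

/-- The rational energies of integral energies. -/
def castE (e : ι → ℤ) (x : ι) : ℚ := e x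

theorem sum_castE (e : ι → ℤ) (B : Finset ι) : ∑ x ∈ B, castE e x = ((∑ x ∈ B, e x : ℤ) : ℚ) := by
  simp [castE]

theorem blockProd_append (z : ι → MvPowerSeries σ ℚ) (e : ι → ℤ) (L L' : List (Finset ι)) :
    blockProd z e (L ++ L') = blockProd z e L * blockProd z e L' := by
  simp [blockProd]

theorem blockProd_cons (z : ι → MvPowerSeries σ ℚ) (e : ι → ℤ) (B : Finset ι)
    (L : List (Finset ι)) : blockProd z e (B :: L) = blockOp z e B * blockProd z e L := by
  simp [blockProd]

theorem blockProd_nil (z : ι → MvPowerSeries σ ℚ) (e : ι → ℤ) : blockProd z e [] = 1 := rfl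

theorem blockOp_mul [DecidableEq ι] {z : ι → MvPowerSeries σ ℚ} (hz : ∀ x, MvPowerSeries.constantCoeff (z x) = 0)
    {e : ι → ℤ} {R N : Finset ι} (hRN : Disjoint R N) (hR : ∑ x ∈ R, e x ≠ 0)
    (hN : ∑ x ∈ N, e x ≠ 0) (hU : ∑ x ∈ R ∪ N, e x ≠ 0) :
    blockOp z e R * blockOp z e N = blockOp z e N * blockOp z e R +
      blockComm z (castE e) R N • blockOp z e (R ∪ N) := by
  unfold blockOp blockComm
  rw [Finset.sum_union hRN] at hU
  rw [calE_mul_calE hR hN hU (constantCoeff_blockSum hz R) (constantCoeff_blockSum hz N),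
    Finset.sum_union hRN, Finset.sum_union hRN, sum_castE, sum_castE]

/-- Moving a block one step to the right in a product. -/
theorem blockProd_swap [DecidableEq ι] {z : ι → MvPowerSeries σ ℚ}
    (hz : ∀ x, MvPowerSeries.constantCoeff (z x) = 0) {e : ι → ℤ} {R N : Finset ι}
    (hRN : Disjoint R N) (hR : ∑ x ∈ R, e x ≠ 0) (hN : ∑ x ∈ N, e x ≠ 0)
    (hU : ∑ x ∈ R ∪ N, e x ≠ 0) (pre post : List (Finset ι)) :
    blockProd z e (pre ++ R :: N :: post) = blockProd z e (pre ++ N :: R :: post) +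
      blockComm z (castE e) R N • blockProd z e (pre ++ (R ∪ N) :: post) := by
  simp only [blockProd_append, blockProd_cons]
  rw [← mul_assoc (blockOp z e R), blockOp_mul hz hRN hR hN hU, add_mul, mul_add, mul_assoc,
    smul_mul_assoc, mul_smul_comm]

section Vev

variable {R : Type*} [CommRing R]

theorem vev_add (A B : Module.End R (Fock R)) : vev R (A + B) = vev R A + vev R B := rfl

theorem vev_smul (c : R) (A : Module.End R (Fock R)) : vev R (c • A) = c * vev R A := rfl

theorem vev_eq_of_vac {A : Module.End R (Fock R)} {c : R} (h : A (vac R) = c • vac R) :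
    vev R A = c := by
  unfold vev
  unfold vac at h
  rw [h]
  simp

theorem vev_mul_eq_zero {A B : Module.End R (Fock R)} (h : B (vac R) = 0) :
    vev R (A * B) = 0 := by
  unfold vev
  unfold vac at h
  rw [Module.End.mul_apply, h, map_zero]
  rfl

end Vev

/-- The weight of a block: its energy for a block in `P`, and one otherwise. -/
def weight [DecidableEq ι] (P : Finset ι) (v : ι → ℚ) (B : Finset ι) : ℚ := if B ⊆ P then ∑ x ∈ B, v x else 1

def listWeight [DecidableEq ι] (P : Finset ι) (v : ι → ℚ) (L : List (Finset ι)) : ℚ := (L.map (weight P v)).prod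

theorem weight_union_of_not [DecidableEq ι] {P : Finset ι} {v : ι → ℚ} {R N : Finset ι} (h : ¬(R ⊆ P ∧ N ⊆ P)) :
    weight P v (R ∪ N) = 1 := by
  unfold weight
  rw [if_neg]
  rwa [Finset.union_subset_iff]

/-- Consequently bosonic blocks never need to be merged with each other in the algorithm. -/
theorem blockComm_eq_zero {z : ι → MvPowerSeries σ ℚ} {P : Finset ι} (hP : ∀ x ∈ P, z x = 0)
    (v : ι → ℚ) {R N : Finset ι} (hR : R ⊆ P) (hN : N ⊆ P) : blockComm z v R N = 0 := by
  unfold blockComm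
  rw [Finset.sum_eq_zero fun x hx => hP x (hR hx), Finset.sum_eq_zero fun x hx => hP x (hN hx),
    smul_zero, smul_zero, sub_zero,
    PowerSeries.subst_zero_of_constantCoeff_zero constantCoeff_sigma]

/-- If `R` is bosonic then `z_R = 0` and the argument of `ς` is `e_R z_N`; as `ς(u) = u 𝓢(u)`, the
energy `e_R` factors out. The case of bosonic `N` is symmetric up to sign. This is the source of the
divisibility by `∏ μ_i ∏ ν_j`. -/
theorem exists_blockComm_eq [DecidableEq ι] {z : ι → MvPowerSeries σ ℚ}
    (hz : ∀ x, MvPowerSeries.constantCoeff (z x) = 0) {P : Finset ι} (hP : ∀ x ∈ P, z x = 0)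
    {R N : Finset ι} (hRN : ¬(R ⊆ P ∧ N ⊆ P)) :
    ∃ κ : (ι → ℚ) → MvPowerSeries σ ℚ, IsPolyFam κ ∧
      ∀ v, blockComm z v R N = (weight P v R * weight P v N) • κ v := by
  have h0 : ∀ B : Finset ι, B ⊆ P → ∑ x ∈ B, z x = 0 := fun B hB =>
    Finset.sum_eq_zero fun x hx => hP x (hB hx)
  have harg : IsPolyFam fun v : ι → ℚ =>
      (∑ x ∈ R, v x) • (∑ x ∈ N, z x) - (∑ x ∈ N, v x) • (∑ x ∈ R, z x) :=
    (IsPolyFam.smul (IsPolyFun.blockSum R) (IsPolyFam.const _)).sub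
      (IsPolyFam.smul (IsPolyFun.blockSum N) (IsPolyFam.const _))
  have hs := harg.subst sinhc fun v => constantCoeff_blockComm_arg hz _ _ R N
  have hform := fun v : ι → ℚ => sigma_subst_eq_mul
    (constantCoeff_blockComm_arg hz (∑ x ∈ R, v x) (∑ x ∈ N, v x) R N)
  by_cases hR : R ⊆ P
  · have hN : ¬N ⊆ P := fun h => hRN ⟨hR, h⟩
    refine ⟨_, (IsPolyFam.const (∑ x ∈ N, z x)).mul hs, fun v => ?_⟩
    unfold blockComm weight
    rw [hform v, if_pos hR, if_neg hN, h0 R hR]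
    simp
  · by_cases hN : N ⊆ P
    · refine ⟨_, (IsPolyFam.const (-∑ x ∈ R, z x)).mul hs, fun v => ?_⟩
      unfold blockComm weight
      rw [hform v, if_neg hR, if_pos hN, h0 N hN]
      simp
    · refine ⟨_, harg.mul hs, fun v => ?_⟩
      unfold blockComm weight
      rw [hform v, if_neg hR, if_neg hN, one_mul, one_smul]

/-- The blocks of `L` are nonempty, and `U` is their disjoint union. -/
def IsPart (U : Finset ι) (L : List (Finset ι)) : Prop :=
  (∀ B ∈ L, B.Nonempty) ∧ (L.map Finset.val).sum = U.val

theorem IsPart.perm {U : Finset ι} {L L' : List (Finset ι)} (h : IsPart U L) (hL : L.Perm L') :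
    IsPart U L' :=
  ⟨fun B hB => h.1 B (hL.mem_iff.2 hB), by rw [← (hL.map Finset.val).sum_eq, h.2]⟩

theorem IsPart.sum_eq {U : Finset ι} {L : List (Finset ι)} (h : IsPart U L) {M : Type*}
    [AddCommMonoid M] (f : ι → M) : (L.map fun B => ∑ x ∈ B, f x).sum = ∑ x ∈ U, f x := by
  change _ = (U.val.map f).sum
  rw [← h.2]
  clear h
  induction L with
  | nil => simp
  | cons B L ih =>
    rw [List.map_cons, List.sum_cons, ih, List.map_cons, List.sum_cons, Multiset.map_add,
      Multiset.sum_add]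
    rfl

theorem IsPart.disjoint {U B C : Finset ι} {L : List (Finset ι)} (h : IsPart U (B :: C :: L)) :
    Disjoint B C := by
  have h2 := h.2
  simp only [List.map_cons, List.sum_cons] at h2
  have hn := U.nodup
  rw [← h2, ← add_assoc] at hn
  have := (Multiset.nodup_add.1 (Multiset.nodup_add.1 hn).1).2.2
  rwa [Finset.disjoint_val] at this

theorem IsPart.merge [DecidableEq ι] {U R N : Finset ι} {pre post : List (Finset ι)}
    (h : IsPart U (pre ++ R :: N :: post)) (hRN : Disjoint R N) :
    IsPart U (pre ++ (R ∪ N) :: post) := by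
  refine ⟨fun B hB => ?_, ?_⟩
  · rw [List.mem_append, List.mem_cons] at hB
    rcases hB with hB | rfl | hB
    · exact h.1 B (by simp [hB])
    · exact (h.1 R (by simp)).mono Finset.subset_union_left
    · exact h.1 B (by simp [hB])
  · rw [← h.2]
    have : (R ∪ N).val = R.val + N.val := by
      rw [← Finset.disjUnion_eq_union R N hRN]
      rfl
    simp [this, add_assoc]

theorem IsPart.subset {U B : Finset ι} {L : List (Finset ι)} (h : IsPart U L) (hB : B ∈ L) :
    B ⊆ U := by
  rw [← Finset.val_le_iff, ← h.2]
  exact List.single_le_sum (fun _ _ => Multiset.zero_le _) _ (List.mem_map_of_mem hB)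

theorem IsPart.eq_sdiff [DecidableEq ι] {U B C : Finset ι} (h : IsPart U [B, C]) : C = U \ B := by
  have hd := h.disjoint
  have h2 := h.2
  have : (B ∪ C).val = U.val := by
    rw [← h2, ← Finset.disjUnion_eq_union B C hd]
    simp [Finset.disjUnion]
  have : B ∪ C = U := Finset.val_injective this
  rw [← this, Finset.union_sdiff_cancel_left hd]

theorem filter_subset_cons_of_not [DecidableEq ι] {T B : Finset ι} (L : List (Finset ι)) (h : ¬B ⊆ T) :
    (B :: L).filter (· ⊆ T) = L.filter (· ⊆ T) := by simp [h]

theorem filter_subset_cons_of [DecidableEq ι] {T B : Finset ι} (L : List (Finset ι)) (h : B ⊆ T) :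
    (B :: L).filter (· ⊆ T) = B :: L.filter (· ⊆ T) := by simp [h]

end Blocks

/-! ### The commutation algorithm near a wall -/

section Algorithm

variable {ι σ : Type*} [Fintype ι] [DecidableEq ι]

/-- Integral energies `e` without vanishing partial sums, whose partial sums have the signs of
those of the real energies `p`, wherever the latter do not vanish. -/
structure Compatible (p : ι → ℝ) (e : ι → ℤ) : Prop where
  sum_eq : ∑ x, e x = 0
  ne_zero : ∀ B : Finset ι, B.Nonempty → B ≠ Finset.univ → ∑ x ∈ B, e x ≠ 0
  pos : ∀ B : Finset ι, 0 < ∑ x ∈ B, p x → 0 < ∑ x ∈ B, e x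

theorem sum_compl_eq_neg {M : Type*} [AddCommGroup M] {f : ι → M} (h : ∑ x, f x = 0)
    (B : Finset ι) : ∑ x ∈ Bᶜ, f x = -∑ x ∈ B, f x := by
  rw [← Finset.sum_add_sum_compl B] at h
  exact eq_neg_of_add_eq_zero_right h

open Classical in
/-- The nontrivial subsets with vanishing energy. -/
def zeroSets (p : ι → ℝ) : Finset (Finset ι) :=
  Finset.univ.filter fun T => T.Nonempty ∧ T ≠ Finset.univ ∧ ∑ x ∈ T, p x = 0

theorem mem_zeroSets {p : ι → ℝ} {T : Finset ι} :
    T ∈ zeroSets p ↔ T.Nonempty ∧ T ≠ Finset.univ ∧ ∑ x ∈ T, p x = 0 := by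
  simp [zeroSets]

/-- The vacuum expectation value of the operators of the blocks `T`, `Tᶜ`. -/
def pairVev (z : ι → MvPowerSeries σ ℚ) (e : ι → ℤ) (T : Finset ι) : MvPowerSeries σ ℚ :=
  if 0 < ∑ x ∈ T, e x then (sigmaRatio ((∑ x ∈ T, e x : ℤ) : ℚ) 1).subst (∑ x, z x) else 0

/-- The boson restores total energy zero. It plays the role of the block `Tᶜ` with its variables set
to zero; in `rightVev` the boson plays the role of `T` in the same way. -/
def leftVev (z : ι → MvPowerSeries σ ℚ) (e : ι → ℤ) (T : Finset ι) (L : List (Finset ι)) :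
    MvPowerSeries σ ℚ :=
  vev _ (blockProd z e (L.filter (· ⊆ T)) * alpha (-∑ x ∈ T, e x))

def rightVev (z : ι → MvPowerSeries σ ℚ) (e : ι → ℤ) (T : Finset ι) (L : List (Finset ι)) :
    MvPowerSeries σ ℚ :=
  vev _ (alpha (∑ x ∈ T, e x) * blockProd z e (L.filter (· ⊆ Tᶜ)))

/-- The product of the vacuum expectation values of the two sides of a cut. -/
def cutVev (z : ι → MvPowerSeries σ ℚ) (e : ι → ℤ) (T : Finset ι) (L : List (Finset ι)) :
    MvPowerSeries σ ℚ :=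
  if ∀ B ∈ L, B ⊆ T ∨ B ⊆ Tᶜ then leftVev z e T L * rightVev z e T L else 0

/-- The factor relating a correlator of one side of a cut with the corresponding operator. -/
def cutFactor (z : ι → MvPowerSeries σ ℚ) (δ : ℚ) (T : Finset ι) : MvPowerSeries σ ℚ :=
  (sigmaRatio δ 1).subst (∑ x ∈ T, z x) * (sigmaRatio δ 1).subst (∑ x ∈ Tᶜ, z x)

/-- The vacuum expectation value of `L` is given on both sides of a wall by the same polynomial
expression in the energies and in the vacuum expectation values of complementary pairs. -/
def Resolves (z : ι → MvPowerSeries σ ℚ) (P : Finset ι) (p : ι → ℝ) (L : List (Finset ι)) : Prop :=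
  ∃ (Q : (ι → ℚ) → MvPowerSeries σ ℚ) (A : Finset ι → (ι → ℚ) → MvPowerSeries σ ℚ),
    IsPolyFam Q ∧ (∀ T, IsPolyFam (A T)) ∧ ∀ e : ι → ℤ, Compatible p e →
      vev _ (blockProd z e L) = listWeight P (castE e) L •
        (Q (castE e) + ∑ T ∈ zeroSets p, A T (castE e) * pairVev z e T) ∧
      ∀ T ∈ zeroSets p, 0 < ∑ x ∈ T, e x →
        listWeight P (castE e) L • ((A T (castE e) + A Tᶜ (castE e)) *
          cutFactor z ((∑ x ∈ T, e x : ℤ) : ℚ) T) = cutVev z e T L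

variable {z : ι → MvPowerSeries σ ℚ} {P : Finset ι} {p : ι → ℝ}

theorem not_subset_of_subset_compl {T B : Finset ι} (hB : B.Nonempty) (h : B ⊆ Tᶜ) : ¬B ⊆ T := by
  obtain ⟨x, hx⟩ := hB
  exact fun h' => Finset.mem_compl.1 (h hx) (h' hx)

theorem not_subset_compl_of_subset {T B : Finset ι} (hB : B.Nonempty) (h : B ⊆ T) : ¬B ⊆ Tᶜ :=
  fun h' => not_subset_of_subset_compl hB h' h

/-- The cut correlator obeys the recursion of the correlator itself. Two blocks on the same side
produce the commutator inside one factor. For blocks on opposite sides the order is invisible, and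
their union is contained in neither side, so its term is zero. -/
theorem cutVev_swap (hz : ∀ x, MvPowerSeries.constantCoeff (z x) = 0) {e : ι → ℤ}
    {R N : Finset ι} (hRN : Disjoint R N) (hR : ∑ x ∈ R, e x ≠ 0) (hN : ∑ x ∈ N, e x ≠ 0)
    (hU : ∑ x ∈ R ∪ N, e x ≠ 0) (hR' : R.Nonempty) (hN' : N.Nonempty) (T : Finset ι)
    (pre post : List (Finset ι)) :
    cutVev z e T (pre ++ R :: N :: post) = cutVev z e T (pre ++ N :: R :: post) +
      blockComm z (castE e) R N * cutVev z e T (pre ++ (R ∪ N) :: post) := by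
  unfold cutVev
  by_cases hpre : ∀ B ∈ pre, B ⊆ T ∨ B ⊆ Tᶜ
  swap
  · rw [if_neg, if_neg, if_neg, mul_zero, add_zero] <;>
    · intro h
      exact hpre fun B hB => h B (List.mem_append_left _ hB)
  by_cases hpost : ∀ B ∈ post, B ⊆ T ∨ B ⊆ Tᶜ
  swap
  · rw [if_neg, if_neg, if_neg, mul_zero, add_zero] <;>
    · intro h
      exact hpost fun B hB => h B (by simp [hB])
  have hall : ∀ M : List (Finset ι), (∀ B ∈ pre ++ (M ++ post), B ⊆ T ∨ B ⊆ Tᶜ) ↔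
      ∀ B ∈ M, B ⊆ T ∨ B ⊆ Tᶜ := by
    intro M
    simp only [List.mem_append]
    constructor
    · intro h B hB
      exact h B (Or.inr (Or.inl hB))
    · rintro h B (hB | hB | hB)
      exacts [hpre B hB, h B hB, hpost B hB]
  have e1 := hall [R, N]
  have e2 := hall [N, R]
  have e3 := hall [R ∪ N]
  simp only [List.cons_append, List.nil_append, List.mem_cons, List.not_mem_nil, or_false,
    forall_eq_or_imp, forall_eq] at e1 e2 e3
  simp only [List.mem_append, List.mem_cons] at e1 e2 e3 ⊢
  simp only [e1, e2, e3, Finset.union_subset_iff]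
  have hsw := fun pre post => blockProd_swap hz hRN hR hN hU pre post
  unfold leftVev rightVev
  rcases em (R ⊆ T) with hRT | hRT
  · have hRT' := not_subset_compl_of_subset hR' hRT
    rcases em (N ⊆ T) with hNT | hNT
    · have hNT' := not_subset_compl_of_subset hN' hNT
      have hsub : R ∪ N ⊆ T := Finset.union_subset hRT hNT
      have hsub' : ¬R ∪ N ⊆ Tᶜ := fun h => hRT' (Finset.union_subset_left h)
      simp only [hRT, hNT, hRT', hNT', List.filter_append, filter_subset_cons_of _ hsub,
        filter_subset_cons_of _ hRT, filter_subset_cons_of _ hNT, filter_subset_cons_of_not _ hsub',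
        filter_subset_cons_of_not _ hRT', filter_subset_cons_of_not _ hNT', hsw, add_mul, vev_add,
        smul_mul_assoc, vev_smul, true_or, and_self, if_true]
      ring
    · simp only [hRT, hNT, hRT', List.filter_append, filter_subset_cons_of _ hRT,
        filter_subset_cons_of_not _ hNT, filter_subset_cons_of_not _ hRT', true_or, true_and,
        and_true, false_or, and_false, false_and, or_self, if_false, mul_zero, add_zero]
      congr 4
      by_cases hNT' : N ⊆ Tᶜ
      · simp [filter_subset_cons_of _ hNT', filter_subset_cons_of_not _ hRT']
      · simp [filter_subset_cons_of_not _ hNT', filter_subset_cons_of_not _ hRT']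
  · by_cases hRT' : R ⊆ Tᶜ
    swap
    · simp [hRT, hRT']
    by_cases hNT' : N ⊆ Tᶜ
    · have hNT := not_subset_of_subset_compl hN' hNT'
      have hsub : R ∪ N ⊆ Tᶜ := Finset.union_subset hRT' hNT'
      have hsub' : ¬R ∪ N ⊆ T := fun h => hRT (Finset.union_subset_left h)
      simp only [hRT, hNT, hRT', hNT', List.filter_append, filter_subset_cons_of _ hsub,
        filter_subset_cons_of _ hRT', filter_subset_cons_of _ hNT',
        filter_subset_cons_of_not _ hsub', filter_subset_cons_of_not _ hRT,
        filter_subset_cons_of_not _ hNT, hsw, mul_add, vev_add,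
        mul_smul_comm, vev_smul, or_true, and_self, if_true]
      ring
    · by_cases hNT : N ⊆ T
      · simp only [hRT, hNT, hRT', hNT', List.filter_append, filter_subset_cons_of _ hRT',
          filter_subset_cons_of _ hNT, filter_subset_cons_of_not _ hNT',
          filter_subset_cons_of_not _ hRT, true_or, or_true, and_self,
          and_false, false_and, or_self, if_false, if_true, mul_zero, add_zero]
      · simp [hNT, hNT']

theorem alpha_eq (n : ℤ) : (alpha n : Module.End (MvPowerSeries σ ℚ) _) = calE n 0 := rfl

/-- If `R` lies in `Tᶜ`, it is rightmost in the right factor and kills the vacuum. If `R` lies in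
`T`, only `α_{-e_T}` stands to its right; the commutator with it has energy `e_R - e_T > 0`, so both
resulting terms kill the vacuum. -/
theorem cutVev_append_pos (hz : ∀ x, MvPowerSeries.constantCoeff (z x) = 0) {e : ι → ℤ}
    {R T : Finset ι} (hR : 0 < ∑ x ∈ R, e x) (hT : 0 < ∑ x ∈ T, e x)
    (hRT : R ⊆ T → ∑ x ∈ T, e x < ∑ x ∈ R, e x) (pre : List (Finset ι)) :
    cutVev z e T (pre ++ [R]) = 0 := by
  unfold cutVev
  split_ifs with h
  · rcases h R (by simp) with h' | h'
    · rw [mul_eq_zero]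
      left
      unfold leftVev
      have hlt := hRT h'
      rw [List.filter_append, filter_subset_cons_of _ h', blockProd_append, List.filter_nil,
        blockProd_cons, blockProd_nil, mul_one, mul_assoc]
      apply vev_mul_eq_zero
      unfold blockOp
      rw [alpha_eq, calE_mul_calE hR.ne' (by omega) (by omega) (constantCoeff_blockSum hz R)
        (map_zero _), LinearMap.add_apply, LinearMap.smul_apply, Module.End.mul_apply,
        calE_vac hR, calE_vac (by omega), map_zero, smul_zero, add_zero]
    · rw [mul_eq_zero]
      right
      unfold rightVev
      rw [List.filter_append, filter_subset_cons_of _ h', blockProd_append, List.filter_nil,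
        blockProd_cons, blockProd_nil, mul_one, ← mul_assoc]
      exact vev_mul_eq_zero (calE_vac hR _)
  · rfl

theorem Compatible.neg {e : ι → ℤ} (he : Compatible p e) (hp : ∑ x, p x = 0) {B : Finset ι}
    (hB : ∑ x ∈ B, p x < 0) : ∑ x ∈ B, e x < 0 := by
  have := he.pos Bᶜ (by rw [sum_compl_eq_neg hp]; linarith)
  rw [sum_compl_eq_neg he.sum_eq] at this
  omega

theorem resolves_append_pos (hz : ∀ x, MvPowerSeries.constantCoeff (z x) = 0)
    (hp : ∑ x, p x = 0) {R : Finset ι} (hR : 0 < ∑ x ∈ R, p x) (pre : List (Finset ι)) :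
    Resolves z P p (pre ++ [R]) := by
  refine ⟨fun _ => 0, fun _ _ => 0, IsPolyFam.const 0, fun _ => IsPolyFam.const 0,
    fun e he => ⟨?_, fun T hT hpos => ?_⟩⟩
  · rw [blockProd_append, blockProd_cons, blockProd_nil, mul_one,
      vev_mul_eq_zero (B := blockOp z e R) (calE_vac (he.pos R hR) _)]
    simp
  · rw [cutVev_append_pos hz (he.pos R hR) hpos]
    · simp
    · intro hRT
      -- At `p` the set `T` has energy zero and `R` positive energy, so the rest of `T` is negative
      -- there. This sign persists for `e` and gives `e_T < e_R`.
      have h1 : ∑ x ∈ T \ R, p x < 0 := by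
        rw [Finset.sum_sdiff_eq_sub hRT, (mem_zeroSets.1 hT).2.2]
        linarith
      have h2 := he.neg hp h1
      rw [Finset.sum_sdiff_eq_sub hRT] at h2
      omega

/-- One step of the algorithm: the data for the two shorter problems are combined as `Q₁ + κ Q₂` and
`A₁ + κ A₂`, with `κ` the commutator divided by weights. The condition that another block exists
makes `R ∪ N` proper, hence of nonzero energy. -/
theorem resolves_swap (hz : ∀ x, MvPowerSeries.constantCoeff (z x) = 0) (hP : ∀ x ∈ P, z x = 0)
    {R N : Finset ι} {pre post : List (Finset ι)}
    (hpart : IsPart Finset.univ (pre ++ R :: N :: post)) (hlen : pre ++ post ≠ [])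
    (hmerge : ¬(R ⊆ P ∧ N ⊆ P) → Resolves z P p (pre ++ (R ∪ N) :: post))
    (hswap : Resolves z P p (pre ++ N :: R :: post)) :
    Resolves z P p (pre ++ R :: N :: post) := by
  have hperm : (pre ++ R :: N :: post).Perm (R :: N :: (pre ++ post)) :=
    List.perm_middle.trans (List.Perm.cons _ List.perm_middle)
  have hdisj : Disjoint R N := (hpart.perm hperm).disjoint
  have hRne : R.Nonempty := hpart.1 R (by simp)
  have hNne : N.Nonempty := hpart.1 N (by simp)
  obtain ⟨C, L', hC⟩ := List.exists_cons_of_ne_nil hlen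
  have hCne : C.Nonempty := hpart.1 C (hperm.mem_iff.2 (by rw [hC]; simp))
  have hRC : Disjoint R C := by
    refine IsPart.disjoint (U := Finset.univ) (L := N :: L') ((hpart.perm hperm).perm ?_)
    rw [hC]
    exact List.Perm.cons _ (List.Perm.swap _ _ _)
  have hNC : Disjoint N C := by
    refine IsPart.disjoint (U := Finset.univ) (L := R :: L') ((hpart.perm hperm).perm ?_)
    rw [hC]
    exact (List.Perm.swap _ _ _).trans (List.Perm.cons _ (List.Perm.swap _ _ _))
  have hUC : Disjoint (R ∪ N) C := Finset.disjoint_union_left.2 ⟨hRC, hNC⟩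
  have hne : ∀ {B : Finset ι}, Disjoint B C → B ≠ Finset.univ := by
    rintro B hB rfl
    obtain ⟨x, hx⟩ := hCne
    exact Finset.disjoint_left.1 hB (Finset.mem_univ x) hx
  obtain ⟨Q₁, A₁, hQ₁, hA₁, h₁⟩ := hswap
  -- The merged term in a form covering both cases: for two bosonic blocks all data are zero,
  -- otherwise they come from the merged list.
  obtain ⟨κ, Q₂, A₂, hκ, hQ₂, hA₂, h₂⟩ : ∃ (κ Q : (ι → ℚ) → MvPowerSeries σ ℚ)
      (A : Finset ι → (ι → ℚ) → MvPowerSeries σ ℚ), IsPolyFam κ ∧ IsPolyFam Q ∧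
      (∀ T, IsPolyFam (A T)) ∧ ∀ e : ι → ℤ, Compatible p e →
      blockComm z (castE e) R N * vev _ (blockProd z e (pre ++ (R ∪ N) :: post)) =
        listWeight P (castE e) (pre ++ R :: N :: post) • (κ (castE e) *
        (Q (castE e) + ∑ T ∈ zeroSets p, A T (castE e) * pairVev z e T)) ∧
      ∀ T ∈ zeroSets p, 0 < ∑ x ∈ T, e x →
        listWeight P (castE e) (pre ++ R :: N :: post) • (κ (castE e) *
          ((A T (castE e) + A Tᶜ (castE e)) * cutFactor z ((∑ x ∈ T, e x : ℤ) : ℚ) T)) =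
          blockComm z (castE e) R N * cutVev z e T (pre ++ (R ∪ N) :: post) := by
    by_cases hpure : R ⊆ P ∧ N ⊆ P
    · refine ⟨fun _ => 0, fun _ => 0, fun _ _ => 0, IsPolyFam.const 0, IsPolyFam.const 0,
        fun _ => IsPolyFam.const 0, fun e _ => ?_⟩
      rw [blockComm_eq_zero hP _ hpure.1 hpure.2]
      simp
    · obtain ⟨Q, A, hQ, hA, h⟩ := hmerge hpure
      obtain ⟨κ, hκ, hκ'⟩ := exists_blockComm_eq hz hP hpure
      refine ⟨κ, Q, A, hκ, hQ, hA, fun e he => ?_⟩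
      obtain ⟨h1, h2⟩ := h e he
      -- A merged block is not bosonic and has weight one, so the weights of `R` and `N` lost in
      -- merging are exactly those split off from the commutator.
      have hw : listWeight P (castE e) (pre ++ R :: N :: post) =
          (weight P (castE e) R * weight P (castE e) N) *
            listWeight P (castE e) (pre ++ (R ∪ N) :: post) := by
        simp only [listWeight, List.map_append, List.map_cons, List.prod_append, List.prod_cons,
          weight_union_of_not hpure]
        ring
      refine ⟨?_, fun T hT hpos => ?_⟩
      · rw [h1, hw, hκ', smul_mul_smul_comm]
      · rw [← h2 T hT hpos, hw, hκ', smul_mul_smul_comm]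
  refine ⟨fun v => Q₁ v + κ v * Q₂ v, fun T v => A₁ T v + κ v * A₂ T v, hQ₁.add (hκ.mul hQ₂),
    fun T => (hA₁ T).add (hκ.mul (hA₂ T)), fun e he => ?_⟩
  obtain ⟨h11, h12⟩ := h₁ e he
  obtain ⟨h21, h22⟩ := h₂ e he
  have hR := he.ne_zero R hRne (hne hRC)
  have hN := he.ne_zero N hNne (hne hNC)
  have hU := he.ne_zero (R ∪ N) (hRne.mono Finset.subset_union_left) (hne hUC)
  have hw : listWeight P (castE e) (pre ++ N :: R :: post) =
      listWeight P (castE e) (pre ++ R :: N :: post) := by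
    unfold listWeight
    exact ((List.Perm.append_left pre (List.Perm.swap R N post)).map _).prod_eq
  rw [hw] at h11 h12
  refine ⟨?_, fun T hT hpos => ?_⟩
  · rw [blockProd_swap hz hdisj hR hN hU, vev_add, vev_smul, h11, h21, ← smul_add]
    congr 1
    simp only [add_mul, Finset.sum_add_distrib, mul_add, Finset.mul_sum, mul_assoc]
    abel
  · rw [cutVev_swap hz hdisj hR hN hU hRne hNne, ← h12 T hT hpos, ← h22 T hT hpos, ← smul_add]
    congr 1
    ring

end Algorithm

/-! ### Final pairs and termination of the algorithm -/

section AlgorithmInduction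

variable {ι σ : Type*} [Fintype ι] [DecidableEq ι]
variable {z : ι → MvPowerSeries σ ℚ} {P : Finset ι} {p : ι → ℝ}

theorem blockProd_pair_vac (hz : ∀ x, MvPowerSeries.constantCoeff (z x) = 0) {e : ι → ℤ}
    (he : ∑ x, e x = 0) (B : Finset ι) (hB : 0 < ∑ x ∈ B, e x) :
    vev _ (blockProd z e [B, Bᶜ]) =
      (sigmaRatio ((∑ x ∈ B, e x : ℤ) : ℚ) 1).subst (∑ x, z x) := by
  apply vev_eq_of_vac
  rw [blockProd_cons, blockProd_cons, blockProd_nil, mul_one]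
  unfold blockOp
  rw [sum_compl_eq_neg he, calE_calE_vac hB (constantCoeff_blockSum hz B)
    (constantCoeff_blockSum hz Bᶜ), Finset.sum_add_sum_compl]

theorem vev_calE_calE {a b : ℤ} (ha : 0 < a) (hab : b = -a) {u w : MvPowerSeries σ ℚ}
    (hu : MvPowerSeries.constantCoeff u = 0) (hw : MvPowerSeries.constantCoeff w = 0) :
    vev _ (calE a u * calE b w) = (sigmaRatio (a : ℚ) 1).subst (u + w) := by
  subst hab
  exact vev_eq_of_vac (calE_calE_vac ha hu hw)

theorem subset_or_compl_pair {B T : Finset ι} (hT : T.Nonempty) (hTu : T ≠ Finset.univ)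
    (h : ∀ C ∈ [B, Bᶜ], C ⊆ T ∨ C ⊆ Tᶜ) : B = T ∨ B = Tᶜ := by
  have h1 := h B (by simp)
  have h2 := h Bᶜ (by simp)
  rcases h1 with h1 | h1 <;> rcases h2 with h2 | h2
  · exfalso
    apply hTu
    rw [Finset.eq_univ_iff_forall]
    intro x
    by_cases hx : x ∈ B
    · exact h1 hx
    · exact h2 (Finset.mem_compl.2 hx)
  · exact Or.inl (subset_antisymm h1 (by rwa [Finset.compl_subset_compl] at h2))
  · refine Or.inr (subset_antisymm h1 ?_)
    have := Finset.compl_subset_compl.2 h2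
    rwa [compl_compl] at this
  · exfalso
    obtain ⟨x, hx⟩ := hT
    by_cases hxB : x ∈ B
    · exact Finset.mem_compl.1 (h1 hxB) hx
    · exact Finset.mem_compl.1 (h2 (Finset.mem_compl.2 hxB)) hx

theorem compl_mem_zeroSets (hp : ∑ x, p x = 0) {T : Finset ι} (hT : T ∈ zeroSets p) :
    Tᶜ ∈ zeroSets p := by
  obtain ⟨h1, h2, h3⟩ := mem_zeroSets.1 hT
  refine mem_zeroSets.2 ⟨?_, ?_, ?_⟩
  · rw [Finset.nonempty_iff_ne_empty]
    rwa [Ne, Finset.compl_eq_empty_iff]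
  · rw [Ne, Finset.compl_eq_univ_iff]
    exact h1.ne_empty
  · rw [sum_compl_eq_neg hp, h3, neg_zero]

theorem cutVev_pair_of_ne (e : ι → ℤ) {B T : Finset ι} (hT : T ∈ zeroSets p) (h1 : B ≠ T)
    (h2 : B ≠ Tᶜ) : cutVev z e T [B, Bᶜ] = 0 := by
  obtain ⟨hne, huniv, -⟩ := mem_zeroSets.1 hT
  unfold cutVev
  rw [if_neg]
  intro h
  exact (subset_or_compl_pair hne huniv h).elim h1 h2

/-- Pairs of complementary blocks with nonzero energies. -/
theorem resolves_pair_of_ne (hz : ∀ x, MvPowerSeries.constantCoeff (z x) = 0)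
    (hp : ∑ x, p x = 0) (hPu : P ≠ Finset.univ) {B : Finset ι} (hB : ∑ x ∈ B, p x ≠ 0) :
    Resolves z P p [B, Bᶜ] := by
  have hcut : ∀ e : ι → ℤ, ∀ T ∈ zeroSets p, cutVev z e T [B, Bᶜ] = 0 := fun e T hT =>
    cutVev_pair_of_ne e hT
      (by rintro rfl; exact hB (mem_zeroSets.1 hT).2.2)
      (by rintro rfl; exact hB (mem_zeroSets.1 (compl_mem_zeroSets hp hT)).2.2)
  -- The sign of `e_B` is the same for all compatible `e`, and no cut is compatible with the pair,
  -- so all `A_T` can be taken to be zero.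
  suffices h : ∃ Q : (ι → ℚ) → MvPowerSeries σ ℚ, IsPolyFam Q ∧ ∀ e : ι → ℤ, Compatible p e →
      vev _ (blockProd z e [B, Bᶜ]) = listWeight P (castE e) [B, Bᶜ] • Q (castE e) by
    obtain ⟨Q, hQ, h⟩ := h
    refine ⟨Q, fun _ _ => 0, hQ, fun _ => IsPolyFam.const 0, fun e he => ⟨?_, fun T hT _ => ?_⟩⟩
    · rw [h e he]
      simp
    · rw [hcut e T hT]
      simp
  rcases lt_or_gt_of_ne hB with hB | hB
  · refine ⟨fun _ => 0, IsPolyFam.const 0, fun e he => ?_⟩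
    have hpos : 0 < ∑ x ∈ Bᶜ, e x := he.pos Bᶜ (by rw [sum_compl_eq_neg hp]; linarith)
    rw [blockProd_cons, blockProd_cons, blockProd_nil, mul_one,
      vev_mul_eq_zero (B := blockOp z e Bᶜ) (calE_vac hpos _), smul_zero]
  · obtain ⟨κ, hκ, hκ'⟩ := IsPolyFam.exists_sigmaRatio (IsPolyFun.blockSum B)
      (constantCoeff_blockSum hz Finset.univ)
    have hvev : ∀ e : ι → ℤ, Compatible p e → vev _ (blockProd z e [B, Bᶜ]) =
        (∑ x ∈ B, castE e x) • κ (castE e) := fun e he => by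
      rw [blockProd_pair_vac hz he.sum_eq B (he.pos B hB), ← hκ', sum_castE]
    have hw : ∀ v, listWeight P v [B, Bᶜ] = weight P v B * weight P v Bᶜ := fun v => by
      simp [listWeight]
    by_cases hBP : B ⊆ P
    · have hBP' : ¬Bᶜ ⊆ P := by
        intro h
        apply hPu
        rw [Finset.eq_univ_iff_forall]
        intro x
        by_cases hx : x ∈ B
        · exact hBP hx
        · exact h (Finset.mem_compl.2 hx)
      refine ⟨κ, hκ, fun e he => ?_⟩
      rw [hvev e he, hw, weight, weight, if_pos hBP, if_neg hBP', mul_one]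
    · by_cases hBP' : Bᶜ ⊆ P
      -- Here the weight is `e_{Bᶜ} = -e_B`, which accounts for the sign.
      · refine ⟨fun v => -κ v, hκ.neg, fun e he => ?_⟩
        rw [hvev e he, hw, weight, weight, if_neg hBP, if_pos hBP', one_mul]
        have : ∑ x ∈ Bᶜ, castE e x = -∑ x ∈ B, castE e x := by
          apply sum_compl_eq_neg
          rw [sum_castE, he.sum_eq, Int.cast_zero]
        rw [this, neg_smul, smul_neg, neg_neg]
      · refine ⟨_, IsPolyFam.smul (IsPolyFun.blockSum B) hκ, fun e he => ?_⟩
        rw [hvev e he, hw, weight, weight, if_neg hBP, if_neg hBP', one_mul, one_smul]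

theorem cutVev_self (hz : ∀ x, MvPowerSeries.constantCoeff (z x) = 0) {e : ι → ℤ}
    (he : ∑ x, e x = 0) {T : Finset ι} (hT : T ∈ zeroSets p) (hp : ∑ x, p x = 0)
    (hpos : 0 < ∑ x ∈ T, e x) {L : List (Finset ι)} (hL : L = [T, Tᶜ] ∨ L = [Tᶜ, T]) :
    cutVev z e T L = cutFactor z ((∑ x ∈ T, e x : ℤ) : ℚ) T := by
  have hne := (mem_zeroSets.1 hT).1
  have hne' := (mem_zeroSets.1 (compl_mem_zeroSets hp hT)).1
  have h1 : ¬Tᶜ ⊆ T := not_subset_of_subset_compl hne' subset_rfl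
  have h2 : ¬T ⊆ Tᶜ := not_subset_compl_of_subset hne subset_rfl
  have h3 : L.filter (· ⊆ T) = [T] := by
    rcases hL with rfl | rfl <;> simp [h1]
  have h4 : L.filter (· ⊆ Tᶜ) = [Tᶜ] := by
    rcases hL with rfl | rfl <;> simp [h2]
  have h5 : ∀ B ∈ L, B ⊆ T ∨ B ⊆ Tᶜ := by
    rcases hL with rfl | rfl <;> simp
  unfold cutVev leftVev rightVev cutFactor
  rw [if_pos h5, h3, h4, blockProd_cons, blockProd_cons, blockProd_nil, mul_one, mul_one]
  unfold blockOp
  rw [alpha_eq, alpha_eq, vev_calE_calE hpos rfl (constantCoeff_blockSum hz T) (map_zero _),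
    vev_calE_calE hpos (sum_compl_eq_neg he T) (map_zero _) (constantCoeff_blockSum hz Tᶜ),
    add_zero, zero_add]

/-- Pairs of complementary blocks whose energies change sign at the wall. -/
theorem resolves_pair_of_eq (hz : ∀ x, MvPowerSeries.constantCoeff (z x) = 0)
    (hp : ∑ x, p x = 0) {B : Finset ι} (hB : B ∈ zeroSets p) (hBP : ¬B ⊆ P) (hBP' : ¬Bᶜ ⊆ P) :
    Resolves z P p [B, Bᶜ] := by
  have hB' := compl_mem_zeroSets hp hB
  obtain ⟨hne, huniv, -⟩ := mem_zeroSets.1 hB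
  have hcompl : B ≠ Bᶜ := fun h => not_subset_of_subset_compl hne h.subset subset_rfl
  -- The pair is its own resolution, `A_B = 1`. The cut correlator ignores the order of `B` and
  -- `Bᶜ`, and accordingly only `A_T + A_{Tᶜ}` is constrained, which is one both for `T = B` and for
  -- `T = Bᶜ`.
  refine ⟨fun _ => 0, fun T _ => if T = B then 1 else 0, IsPolyFam.const 0,
    fun T => IsPolyFam.const _, fun e he => ?_⟩
  have hw : listWeight P (castE e) [B, Bᶜ] = 1 := by
    simp [listWeight, weight, hBP, hBP']
  rw [hw, one_smul]
  refine ⟨?_, fun T hT hpos => ?_⟩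
  · simp only [zero_add, ite_mul, one_mul, zero_mul, Finset.sum_ite_eq', if_pos hB]
    unfold pairVev
    split_ifs with hpos
    · exact blockProd_pair_vac hz he.sum_eq B hpos
    · have h0 := he.ne_zero B hne huniv
      have h1 : 0 < ∑ x ∈ Bᶜ, e x := by
        rw [sum_compl_eq_neg he.sum_eq]
        omega
      rw [blockProd_cons, blockProd_cons, blockProd_nil, mul_one,
        vev_mul_eq_zero (B := blockOp z e Bᶜ) (calE_vac h1 _)]
  · rw [one_smul]
    beta_reduce
    by_cases h1 : B = T
    · subst h1
      rw [cutVev_self hz he.sum_eq hT hp hpos (Or.inl rfl), if_pos rfl, if_neg hcompl.symm,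
        add_zero, one_mul]
    · by_cases h2 : B = Tᶜ
      · subst h2
        rw [compl_compl, cutVev_self hz he.sum_eq hT hp hpos (Or.inr rfl), if_neg (Ne.symm h1),
          if_pos rfl, zero_add, one_mul]
      · have h2' : Tᶜ ≠ B := Ne.symm h2
        rw [cutVev_pair_of_ne e hT h1 h2, if_neg (Ne.symm h1), if_neg h2', add_zero, zero_mul]

/-- A list of at least three blocks contains one of positive energy. -/
theorem exists_pos_block (hp : ∑ x, p x = 0)
    (hzero : ∀ B C : Finset ι, B.Nonempty → C.Nonempty → Disjoint B C → ∑ x ∈ B, p x = 0 →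
      ∑ x ∈ C, p x = 0 → B ∪ C = Finset.univ)
    {L : List (Finset ι)} (hL : IsPart Finset.univ L) (hlen : 3 ≤ L.length) :
    ∃ R ∈ L, 0 < ∑ x ∈ R, p x := by
  by_contra hcon
  push Not at hcon
  have hsum : (L.map fun B => ∑ x ∈ B, p x).sum = 0 := by rw [hL.sum_eq p, hp]
  -- Nonpositive energies with total zero all vanish. Then the first two blocks already cover
  -- everything, leaving no room for a third one.
  have hall : ∀ B ∈ L, ∑ x ∈ B, p x = 0 := by
    intro B hB
    obtain ⟨l₁, l₂, rfl⟩ := List.append_of_mem hB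
    have h1 : ∀ l : List (Finset ι), (∀ C ∈ l, ∑ x ∈ C, p x ≤ 0) →
        (l.map fun B => ∑ x ∈ B, p x).sum ≤ 0 := by
      intro l hl
      induction l with
      | nil => simp
      | cons C l ih =>
        rw [List.map_cons, List.sum_cons]
        exact add_nonpos (hl C (by simp)) (ih fun D hD => hl D (by simp [hD]))
    have h2 := h1 l₁ fun C hC => hcon C (by simp [hC])
    have h3 := h1 l₂ fun C hC => hcon C (by simp [hC])
    have h4 := hcon B hB
    rw [List.map_append, List.map_cons, List.sum_append, List.sum_cons] at hsum
    linarith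
  match L, hlen with
  | B₁ :: B₂ :: B₃ :: L, _ =>
    have h12 := hL.disjoint
    have h13 : Disjoint B₁ B₃ := (hL.perm (List.Perm.cons _ (List.Perm.swap _ _ _))).disjoint
    have h23 : Disjoint B₂ B₃ :=
      (hL.perm ((List.Perm.swap _ _ _).trans (List.Perm.cons _ (List.Perm.swap _ _ _)))).disjoint
    have := hzero B₁ B₂ (hL.1 _ (by simp)) (hL.1 _ (by simp)) h12 (hall _ (by simp))
      (hall _ (by simp))
    obtain ⟨x, hx⟩ := hL.1 B₃ (by simp)
    have hx' : x ∈ B₁ ∪ B₂ := this ▸ Finset.mem_univ x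
    rcases Finset.mem_union.1 hx' with h | h
    · exact Finset.disjoint_left.1 h13 h hx
    · exact Finset.disjoint_left.1 h23 h hx

/-- Induction on the number of blocks, and inside it on the number of blocks to the right of one
with positive energy. The condition for `n = 2` is needed because a pair of two bosons has a value
linear in the energy but a quadratic weight. -/
theorem resolves_of_isPart (hz : ∀ x, MvPowerSeries.constantCoeff (z x) = 0)
    (hP : ∀ x ∈ P, z x = 0) (hp : ∑ x, p x = 0)
    (hzero : ∀ B C : Finset ι, B.Nonempty → C.Nonempty → Disjoint B C → ∑ x ∈ B, p x = 0 →
      ∑ x ∈ C, p x = 0 → B ∪ C = Finset.univ) (n : ℕ) :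
    ∀ L : List (Finset ι), L.length = n → IsPart Finset.univ L →
      (∀ B ∈ L, B ⊆ P → ∑ x ∈ B, p x ≠ 0) → 2 ≤ n → (n = 2 → P ≠ Finset.univ) →
      Resolves z P p L := by
  induction n using Nat.strong_induction_on with
  | _ n ih =>
  intro L hlen hpart hpure h2 hPu
  rcases h2.eq_or_lt with rfl | h3
  · match L, hlen with
    | [B, C], _ =>
      have hC := hpart.eq_sdiff
      rw [← Finset.compl_eq_univ_sdiff] at hC
      subst hC
      by_cases hB : ∑ x ∈ B, p x = 0
      · have hB' : ∑ x ∈ Bᶜ, p x = 0 := by rw [sum_compl_eq_neg hp, hB, neg_zero]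
        refine resolves_pair_of_eq hz hp (mem_zeroSets.2 ⟨hpart.1 B (by simp), ?_, hB⟩)
          (fun h => hpure B (by simp) h hB) (fun h => hpure Bᶜ (by simp) h hB')
        rintro rfl
        exact (hpart.1 Finset.univᶜ (by simp)).ne_empty Finset.compl_univ
      · exact resolves_pair_of_ne hz hp (hPu rfl) hB
  · obtain ⟨R, hRL, hR⟩ := exists_pos_block hp hzero hpart (by omega)
    obtain ⟨pre, post, rfl⟩ := List.append_of_mem hRL
    clear hRL
    -- Moving `R` one place to the right either shortens `post` or merges two blocks; when `post` is
    -- empty, `R` meets the vacuum.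
    induction post generalizing pre with
    | nil => exact resolves_append_pos hz hp hR pre
    | cons N post ih' =>
      have hperm : (pre ++ R :: N :: post).Perm (pre ++ N :: R :: post) :=
        List.Perm.append_left pre (List.Perm.swap N R post)
      have hdisj : Disjoint R N :=
        (hpart.perm (List.perm_middle.trans (List.Perm.cons _ List.perm_middle))).disjoint
      simp only [List.length_append, List.length_cons] at hlen
      refine resolves_swap hz hP hpart ?_ ?_ ?_
      · rw [← List.length_pos_iff, List.length_append]
        omega
      · intro hRN
        refine ih (n - 1) (by omega) _ ?_ (hpart.merge hdisj) ?_ (by omega) ?_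
        · simp only [List.length_append, List.length_cons]
          omega
        · intro B hB hBP
          rw [List.mem_append, List.mem_cons] at hB
          rcases hB with hB | rfl | hB
          · exact hpure B (by simp [hB]) hBP
          · exact absurd (Finset.union_subset_iff.1 hBP) hRN
          · exact hpure B (by simp [hB]) hBP
        -- A merged block is not contained in `P`, so after a merge `P` cannot be everything.
        · rintro - rfl
          exact hRN ⟨Finset.subset_univ _, Finset.subset_univ _⟩
      · have := ih' (pre ++ [N]) (by simp; omega) (by simpa using hpart.perm hperm)
          (fun B hB => hpure B (hperm.mem_iff.2 (by simpa using hB)))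
        simpa using this

end AlgorithmInduction

/-! ### Leaky Hurwitz numbers in terms of blocks -/

section HurwitzBlocks

variable {m n s : ℕ}

/-- The index set of the operators in a leaky Hurwitz number. -/
abbrev OpIndex (m n s : ℕ) : Type := Fin m ⊕ Fin s ⊕ Fin n

def opEnergy (μ : Fin m → ℤ) (ν : Fin n → ℤ) (k : ℤ) : OpIndex m n s → ℤ :=
  Sum.elim μ (Sum.elim (fun _ => -k) fun j => -ν j)

def opVar {σ : Type*} (m n : ℕ) (x : Fin s → σ) : OpIndex m n s → MvPowerSeries σ ℚ :=
  Sum.elim (fun _ => 0) (Sum.elim (fun p => MvPowerSeries.X (x p)) fun _ => 0)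

/-- The set of indices with components `I`, `K`, `J`. -/
def opSet (I : Finset (Fin m)) (K : Finset (Fin s)) (J : Finset (Fin n)) :
    Finset (OpIndex m n s) := I.disjSum (K.disjSum J)

theorem mem_opSet_inl {I : Finset (Fin m)} {K : Finset (Fin s)} {J : Finset (Fin n)} {i : Fin m} :
    Sum.inl i ∈ opSet I K J ↔ i ∈ I := by simp [opSet]

theorem mem_opSet_inr_inl {I : Finset (Fin m)} {K : Finset (Fin s)} {J : Finset (Fin n)}
    {p : Fin s} : Sum.inr (Sum.inl p) ∈ opSet I K J ↔ p ∈ K := by simp [opSet]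

theorem mem_opSet_inr_inr {I : Finset (Fin m)} {K : Finset (Fin s)} {J : Finset (Fin n)}
    {j : Fin n} : Sum.inr (Sum.inr j) ∈ opSet I K J ↔ j ∈ J := by simp [opSet]

theorem exists_eq_opSet (T : Finset (OpIndex m n s)) : ∃ I K J, T = opSet I K J :=
  ⟨T.toLeft, T.toRight.toLeft, T.toRight.toRight, by
    rw [opSet, Finset.toLeft_disjSum_toRight, Finset.toLeft_disjSum_toRight]⟩

theorem opSet_inj {I I' : Finset (Fin m)} {K K' : Finset (Fin s)} {J J' : Finset (Fin n)} :
    opSet I K J = opSet I' K' J' ↔ I = I' ∧ K = K' ∧ J = J' := by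
  constructor
  · intro h
    refine ⟨?_, ?_, ?_⟩ <;> ext x
    · rw [← mem_opSet_inl (K := K) (J := J), h, mem_opSet_inl]
    · rw [← mem_opSet_inr_inl (I := I) (J := J), h, mem_opSet_inr_inl]
    · rw [← mem_opSet_inr_inr (I := I) (K := K), h, mem_opSet_inr_inr]
  · rintro ⟨rfl, rfl, rfl⟩
    rfl

theorem opSet_compl (I : Finset (Fin m)) (K : Finset (Fin s)) (J : Finset (Fin n)) :
    (opSet I K J)ᶜ = opSet Iᶜ Kᶜ Jᶜ := by
  ext x
  rcases x with i | p | j <;> rw [Finset.mem_compl]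
  · rw [mem_opSet_inl, mem_opSet_inl, Finset.mem_compl]
  · rw [mem_opSet_inr_inl, mem_opSet_inr_inl, Finset.mem_compl]
  · rw [mem_opSet_inr_inr, mem_opSet_inr_inr, Finset.mem_compl]

theorem opSet_univ : opSet (Finset.univ : Finset (Fin m)) (Finset.univ : Finset (Fin s))
    (Finset.univ : Finset (Fin n)) = Finset.univ := by
  ext x
  rcases x with i | p | j <;> simp [opSet]

theorem opSet_empty : opSet (∅ : Finset (Fin m)) (∅ : Finset (Fin s)) (∅ : Finset (Fin n)) = ∅ := by
  ext x
  rcases x with i | p | j <;> simp [opSet]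

theorem sum_opSet {M : Type*} [AddCommMonoid M] (f : OpIndex m n s → M) (I : Finset (Fin m))
    (K : Finset (Fin s)) (J : Finset (Fin n)) : ∑ x ∈ opSet I K J, f x =
      ∑ i ∈ I, f (Sum.inl i) + (∑ p ∈ K, f (Sum.inr (Sum.inl p)) +
        ∑ j ∈ J, f (Sum.inr (Sum.inr j))) := by
  rw [opSet, Finset.sum_disjSum, Finset.sum_disjSum]

theorem sum_opEnergy (μ : Fin m → ℤ) (ν : Fin n → ℤ) (k : ℤ) (I : Finset (Fin m))
    (K : Finset (Fin s)) (J : Finset (Fin n)) :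
    ∑ x ∈ opSet I K J, opEnergy μ ν k x = delta I J K.card μ ν k := by
  rw [sum_opSet]
  simp only [opEnergy, Sum.elim_inl, Sum.elim_inr, Finset.sum_const, Finset.sum_neg_distrib, delta,
    nsmul_eq_mul]
  ring

theorem sum_opVar {σ : Type*} (x : Fin s → σ) (I : Finset (Fin m)) (K : Finset (Fin s))
    (J : Finset (Fin n)) :
    ∑ a ∈ opSet I K J, opVar m n x a = ∑ p ∈ K, MvPowerSeries.X (x p) := by
  rw [sum_opSet]
  simp [opVar]

theorem constantCoeff_opVar {σ : Type*} (x : Fin s → σ) (a : OpIndex m n s) :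
    MvPowerSeries.constantCoeff (opVar m n x a) = 0 := by
  rcases a with i | p | j <;> simp [opVar]

/-- The list of singletons with indices in the three given lists. -/
def opBlocks (a : List (Fin m)) (b : List (Fin s)) (c : List (Fin n)) :
    List (Finset (OpIndex m n s)) :=
  a.map (fun i => {Sum.inl i}) ++ (b.map (fun p => {Sum.inr (Sum.inl p)}) ++
    c.map fun j => {Sum.inr (Sum.inr j)})

theorem blockProd_opBlocks {σ : Type*} (x : Fin s → σ) (μ : Fin m → ℤ) (ν : Fin n → ℤ) (k : ℤ)
    (a : List (Fin m)) (b : List (Fin s)) (c : List (Fin n)) :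
    blockProd (opVar m n x) (opEnergy μ ν k) (opBlocks a b c) =
      ((a.map μ).map fun i => alpha i).prod *
        ((b.map x).map fun p => calE (-k) (MvPowerSeries.X p)).prod *
        ((c.map ν).map fun j => alpha (-j)).prod := by
  have h1 : (a.map fun i => ({Sum.inl i} : Finset (OpIndex m n s))).map
      (blockOp (opVar m n x) (opEnergy μ ν k)) = (a.map μ).map fun i => alpha i := by
    rw [List.map_map, List.map_map]
    refine List.map_congr_left fun i _ => ?_
    simp [blockOp, opEnergy, opVar, alpha_eq]
  have h2 : (b.map fun p => ({Sum.inr (Sum.inl p)} : Finset (OpIndex m n s))).map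
      (blockOp (opVar m n x) (opEnergy μ ν k)) =
      (b.map x).map fun p => calE (-k) (MvPowerSeries.X p) := by
    rw [List.map_map, List.map_map]
    refine List.map_congr_left fun i _ => ?_
    simp [blockOp, opEnergy, opVar]
  have h3 : (c.map fun j => ({Sum.inr (Sum.inr j)} : Finset (OpIndex m n s))).map
      (blockOp (opVar m n x) (opEnergy μ ν k)) = (c.map ν).map fun j => alpha (-j) := by
    rw [List.map_map, List.map_map]
    refine List.map_congr_left fun i _ => ?_
    simp [blockOp, opEnergy, opVar, alpha_eq]
  rw [opBlocks, blockProd_append, blockProd_append, mul_assoc, blockProd, blockProd, blockProd,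
    h1, h2, h3]

/-- All indices, in the order of the operators in a leaky Hurwitz number. -/
def allBlocks (m n s : ℕ) : List (Finset (OpIndex m n s)) :=
  opBlocks (List.finRange m) (List.finRange s) (List.finRange n)

theorem hurwitzSeries_eq (μ : Fin m → ℤ) (ν : Fin n → ℤ) (k : ℤ) :
    hurwitzSeries (List.ofFn μ) (List.ofFn ν) k (List.finRange s) =
      (((∏ i, μ i : ℤ) : ℚ) * ((∏ j, ν j : ℤ) : ℚ))⁻¹ •
        vev _ (blockProd (opVar m n id) (opEnergy μ ν k) (allBlocks m n s)) := by
  unfold hurwitzSeries allBlocks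
  rw [blockProd_opBlocks, List.ofFn_eq_map, List.ofFn_eq_map, List.map_id, ← List.ofFn_eq_map,
    ← List.ofFn_eq_map, List.prod_ofFn, List.prod_ofFn]

/-- Relates the subsequences in the statement to the sublists that a cut selects from the list of
blocks. -/
theorem sort_eq_filter {l : ℕ} (I : Finset (Fin l)) :
    I.sort (· ≤ ·) = (List.finRange l).filter (· ∈ I) := by
  refine List.Perm.eq_of_pairwise (le := (· ≤ ·)) (fun a b _ _ => le_antisymm)
    (Finset.pairwise_sort I _) ((List.pairwise_le_finRange l).filter _) ?_
  refine List.perm_of_nodup_nodup_toFinset_eq (Finset.sort_nodup I _)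
    ((List.nodup_finRange l).filter _) ?_
  rw [Finset.sort_toFinset]
  ext
  simp

theorem filter_allBlocks (I : Finset (Fin m)) (K : Finset (Fin s)) (J : Finset (Fin n)) :
    (allBlocks m n s).filter (· ⊆ opSet I K J) =
      opBlocks (I.sort (· ≤ ·)) (K.sort (· ≤ ·)) (J.sort (· ≤ ·)) := by
  unfold allBlocks opBlocks
  rw [sort_eq_filter, sort_eq_filter, sort_eq_filter]
  simp only [List.filter_append, List.filter_map]
  congr 3
  · funext i
    simp [mem_opSet_inl]
  · congr 1
    funext i
    simp [mem_opSet_inr_inl]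
  · refine List.filter_congr fun i _ => ?_
    simp [mem_opSet_inr_inr]

theorem allBlocks_subset_or (I : Finset (Fin m)) (K : Finset (Fin s)) (J : Finset (Fin n)) :
    ∀ B ∈ allBlocks m n s, B ⊆ opSet I K J ∨ B ⊆ (opSet I K J)ᶜ := by
  intro B hB
  have : ∃ x, B = {x} := by
    simp only [allBlocks, opBlocks, List.mem_append, List.mem_map] at hB
    rcases hB with ⟨i, _, rfl⟩ | ⟨i, _, rfl⟩ | ⟨i, _, rfl⟩ <;> exact ⟨_, rfl⟩
  obtain ⟨x, rfl⟩ := this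
  simp only [Finset.singleton_subset_iff, Finset.mem_compl]
  exact em _

theorem parts_prod {l : ℕ} (μ : Fin l → ℤ) (I : Finset (Fin l)) :
    (parts μ I).prod = ∏ i ∈ I, μ i := by
  unfold parts
  have h := List.prod_toFinset μ (Finset.sort_nodup I (· ≤ ·))
  rw [Finset.sort_toFinset] at h
  rw [h]

/-- The leaky Hurwitz series of the first side of a cut. -/
theorem hurwitzSeries_left (μ : Fin m → ℤ) (ν : Fin n → ℤ) (k : ℤ) (I : Finset (Fin m))
    (K : Finset (Fin s)) (J : Finset (Fin n)) :
    hurwitzSeries (parts μ I) (parts ν J ++ [delta I J K.card μ ν k]) k (K.sort (· ≤ ·)) =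
      (((∏ i ∈ I, μ i : ℤ) : ℚ) * ((∏ j ∈ J, ν j : ℤ) : ℚ) *
        (delta I J K.card μ ν k : ℚ))⁻¹ •
        leftVev (opVar m n id) (opEnergy μ ν k) (opSet I K J) (allBlocks m n s) := by
  unfold hurwitzSeries leftVev
  rw [filter_allBlocks, blockProd_opBlocks, sum_opEnergy, List.prod_append, parts_prod, parts_prod,
    List.map_append, List.prod_append, List.prod_singleton, List.map_singleton,
    List.prod_singleton, List.map_id, ← mul_assoc, Int.cast_mul, mul_assoc (∏ i ∈ I, μ i : ℤ).cast]
  rfl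

/-- The leaky Hurwitz series of the second side of a cut. -/
theorem hurwitzSeries_right (μ : Fin m → ℤ) (ν : Fin n → ℤ) (k : ℤ) (I : Finset (Fin m))
    (K : Finset (Fin s)) (J : Finset (Fin n)) :
    hurwitzSeries (delta I J K.card μ ν k :: parts μ Iᶜ) (parts ν Jᶜ) k (Kᶜ.sort (· ≤ ·)) =
      ((delta I J K.card μ ν k : ℚ) * ((∏ i ∈ Iᶜ, μ i : ℤ) : ℚ) *
        ((∏ j ∈ Jᶜ, ν j : ℤ) : ℚ))⁻¹ •
        rightVev (opVar m n id) (opEnergy μ ν k) (opSet I K J) (allBlocks m n s) := by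
  unfold hurwitzSeries rightVev
  rw [opSet_compl, filter_allBlocks, blockProd_opBlocks, sum_opEnergy, List.prod_cons, parts_prod,
    parts_prod, List.map_cons, List.prod_cons, List.map_id, Int.cast_mul]
  simp only [mul_assoc]
  rfl

/-- The indices of the bosonic operators. -/
def bosons (m n s : ℕ) : Finset (OpIndex m n s) := opSet Finset.univ ∅ Finset.univ

theorem opVar_eq_zero {σ : Type*} (x : Fin s → σ) {a : OpIndex m n s} (ha : a ∈ bosons m n s) :
    opVar m n x a = 0 := by
  rcases a with i | p | j
  · rfl
  · simp [bosons, mem_opSet_inr_inl] at ha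
  · rfl

/-- The creation operators have energies `-ν_j`; this is the origin of the signs `(-1) ^ n` below.
-/
theorem listWeight_allBlocks (μ : Fin m → ℤ) (ν : Fin n → ℤ) (k : ℤ) :
    listWeight (bosons m n s) (castE (opEnergy μ ν k)) (allBlocks m n s) =
      ((∏ i, μ i : ℤ) : ℚ) * ((-1) ^ n * ((∏ j, ν j : ℤ) : ℚ)) := by
  unfold listWeight allBlocks opBlocks
  simp only [List.map_append, List.map_map, List.prod_append]
  have h1 : ((List.finRange m).map (weight (bosons m n s) (castE (opEnergy μ ν k)) ∘
      fun i => {Sum.inl i})).prod = ((∏ i, μ i : ℤ) : ℚ) := by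
    rw [← List.ofFn_eq_map, List.prod_ofFn, Int.cast_prod]
    refine Finset.prod_congr rfl fun i _ => ?_
    simp [weight, bosons, mem_opSet_inl, castE, opEnergy]
  have h2 : ((List.finRange s).map (weight (bosons m n s) (castE (opEnergy μ ν k)) ∘
      fun i => {Sum.inr (Sum.inl i)})).prod = 1 := by
    rw [← List.ofFn_eq_map, List.prod_ofFn]
    refine Finset.prod_eq_one fun i _ => ?_
    simp [weight, bosons, mem_opSet_inr_inl]
  have h3 : ((List.finRange n).map (weight (bosons m n s) (castE (opEnergy μ ν k)) ∘
      fun i => {Sum.inr (Sum.inr i)})).prod = (-1) ^ n * ((∏ j, ν j : ℤ) : ℚ) := by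
    rw [← List.ofFn_eq_map, List.prod_ofFn, Int.cast_prod]
    have : ∀ j : Fin n, (weight (bosons m n s) (castE (opEnergy μ ν k)) ∘
        fun i => {Sum.inr (Sum.inr i)}) j = -1 * (ν j : ℚ) := fun j => by
      simp [weight, bosons, mem_opSet_inr_inr, castE, opEnergy]
    rw [Finset.prod_congr rfl fun j _ => this j, Finset.prod_mul_distrib]
    simp
  rw [h1, h2, h3, one_mul]

theorem isPart_opBlocks {a : List (Fin m)} {b : List (Fin s)} {c : List (Fin n)} (ha : a.Nodup)
    (hb : b.Nodup) (hc : c.Nodup) :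
    IsPart (opSet a.toFinset b.toFinset c.toFinset) (opBlocks a b c) := by
  constructor
  · intro B hB
    simp only [opBlocks, List.mem_append, List.mem_map] at hB
    rcases hB with ⟨i, _, rfl⟩ | ⟨i, _, rfl⟩ | ⟨i, _, rfl⟩ <;> exact Finset.singleton_nonempty _
  · have hsum : ∀ l : List (OpIndex m n s),
        ((l.map fun x => ({x} : Finset (OpIndex m n s))).map Finset.val).sum = (l : Multiset _) := by
      intro l
      induction l with
      | nil => rfl
      | cons x l ih =>
        rw [List.map_cons, List.map_cons, List.sum_cons, ih, Finset.singleton_val,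
          Multiset.singleton_add, Multiset.cons_coe]
    have h : opBlocks a b c = (a.map Sum.inl ++ (b.map (fun p => Sum.inr (Sum.inl p)) ++
        c.map fun j => Sum.inr (Sum.inr j))).map
        fun x : OpIndex m n s => ({x} : Finset (OpIndex m n s)) := by
      simp [opBlocks, Function.comp_def]
    rw [h, hsum]
    refine (Multiset.Nodup.ext (Multiset.coe_nodup.2 ?_) (Finset.nodup _)).2 fun x => ?_
    · refine List.Nodup.append (ha.map Sum.inl_injective)
        (List.Nodup.append (hb.map fun _ _ h => by simpa using h)
          (hc.map fun _ _ h => by simpa using h) ?_) ?_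
      · simp [List.Disjoint]
      · simp [List.Disjoint]
    · rcases x with i | p | j <;> simp [opSet]

theorem isPart_allBlocks : IsPart Finset.univ (allBlocks m n s) := by
  have h := isPart_opBlocks (List.nodup_finRange m) (List.nodup_finRange s) (List.nodup_finRange n)
  rwa [List.toFinset_finRange, List.toFinset_finRange, List.toFinset_finRange, opSet_univ] at h

theorem isPart_filter_allBlocks (I : Finset (Fin m)) (K : Finset (Fin s)) (J : Finset (Fin n)) :
    IsPart (opSet I K J) ((allBlocks m n s).filter (· ⊆ opSet I K J)) := by
  have h := isPart_opBlocks (Finset.sort_nodup I (· ≤ ·)) (Finset.sort_nodup K (· ≤ ·))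
    (Finset.sort_nodup J (· ≤ ·))
  rwa [Finset.sort_toFinset, Finset.sort_toFinset, Finset.sort_toFinset, ← filter_allBlocks] at h

theorem length_filter_allBlocks (I : Finset (Fin m)) (K : Finset (Fin s)) (J : Finset (Fin n)) :
    ((allBlocks m n s).filter (· ⊆ opSet I K J)).length = I.card + K.card + J.card := by
  rw [filter_allBlocks]
  simp [opBlocks, add_assoc]

theorem length_allBlocks : (allBlocks m n s).length = m + s + n := by
  simp [allBlocks, opBlocks, add_assoc]

/-- A polynomial function of the energies is a polynomial function of the parameters. -/
theorem IsPolyFun.exists_paramPoly {f : (OpIndex m n s → ℚ) → ℚ} (hf : IsPolyFun f) :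
    ∃ P : ParamPoly m n, ∀ (μ : Fin m → ℤ) (ν : Fin n → ℤ) (k : ℤ),
      P.value μ ν k = f (castE (opEnergy μ ν k)) := by
  obtain ⟨Q, hQ⟩ := hf
  refine ⟨MvPolynomial.aeval (Sum.elim (fun i => MvPolynomial.X (Sum.inl i))
    (Sum.elim (fun _ => -MvPolynomial.X (Sum.inr (Sum.inr ())))
      fun j => -MvPolynomial.X (Sum.inr (Sum.inl j)))) Q, fun μ ν k => ?_⟩
  rw [hQ, ParamPoly.value, MvPolynomial.aeval_def, MvPolynomial.algebraMap_eq,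
    ← MvPolynomial.coe_eval₂Hom, ← RingHom.comp_apply, MvPolynomial.comp_eval₂Hom]
  have : (MvPolynomial.eval (Sum.elim (fun i => (μ i : ℚ))
      (Sum.elim (fun j => (ν j : ℚ)) fun _ : Unit => (k : ℚ)))).comp MvPolynomial.C = RingHom.id ℚ := by
    ext
    simp
  rw [this]
  change _ = MvPolynomial.eval₂Hom (RingHom.id ℚ) _ Q
  congr 2
  funext x
  rcases x with i | p | j <;> simp [castE, opEnergy]

end HurwitzBlocks

/-! ### Walls and chambers -/

section Chambers

open Filter Topology

variable {m n s : ℕ}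

theorem wallForm_add_smul (I : Finset (Fin m)) (J : Finset (Fin n)) (t : ℕ) (a b : ℝ)
    (p q : Ambient m n) :
    wallForm I J t (a • p + b • q) = a * wallForm I J t p + b * wallForm I J t q := by
  simp only [wallForm, Prod.fst_add, Prod.snd_add, Prod.smul_fst, Prod.smul_snd, Pi.add_apply,
    Pi.smul_apply, smul_eq_mul, Finset.sum_add_distrib, ← Finset.mul_sum]
  ring

theorem continuous_wallForm (I : Finset (Fin m)) (J : Finset (Fin n)) (t : ℕ) :
    Continuous (wallForm I J t) := by
  unfold wallForm
  fun_prop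

theorem IsChamber.subset {c : Set (Ambient m n)} (hc : IsChamber s c) :
    c ⊆ wallComplement m n s := by
  obtain ⟨p, -, rfl⟩ := hc
  exact connectedComponentIn_subset _ _

theorem IsChamber.form_ne_zero {c : Set (Ambient m n)} (hc : IsChamber s c) {q : Ambient m n}
    (hq : q ∈ c) {I : Finset (Fin m)} {J : Finset (Fin n)} {t : ℕ} (hw : IsWallIndex s I J t) :
    wallForm I J t q ≠ 0 := fun h =>
  (hc.subset hq).2 I J t hw ⟨(hc.subset hq).1, h⟩

/-- The chamber is connected and the form is continuous without zeros on it. -/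
theorem IsChamber.form_pos {c : Set (Ambient m n)} (hc : IsChamber s c) {q q' : Ambient m n}
    (hq : q ∈ c) (hq' : q' ∈ c) {I : Finset (Fin m)} {J : Finset (Fin n)} {t : ℕ}
    (hw : IsWallIndex s I J t) (h : 0 < wallForm I J t q) : 0 < wallForm I J t q' := by
  by_contra hcon
  have hpre : IsPreconnected c := by
    obtain ⟨p, -, rfl⟩ := hc
    exact isPreconnected_connectedComponentIn
  obtain ⟨x, hx, h0⟩ := hpre.intermediate_value hq' hq (continuous_wallForm I J t).continuousOn
    ⟨not_lt.1 hcon, h.le⟩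
  exact hc.form_ne_zero hx hw h0

theorem IsChamber.form_pos_of_closure {c : Set (Ambient m n)} (hc : IsChamber s c)
    {p q : Ambient m n} (hp : p ∈ closure c) (hq : q ∈ c) {I : Finset (Fin m)}
    {J : Finset (Fin n)} {t : ℕ} (hw : IsWallIndex s I J t) (h : 0 < wallForm I J t p) :
    0 < wallForm I J t q := by
  obtain ⟨x, hx, hxc⟩ := mem_closure_iff.1 hp _
    (isOpen_lt continuous_const (continuous_wallForm I J t)) h
  exact hc.form_pos hxc hq hw hx

/-- A chamber contains all points at which the wall forms have the same signs. -/
theorem IsChamber.mem_of_signs {c : Set (Ambient m n)} (hc : IsChamber s c) {q q' : Ambient m n}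
    (hq : q ∈ c) (hq' : q' ∈ paramSpace m n s)
    (h : ∀ (I : Finset (Fin m)) (J : Finset (Fin n)) (t : ℕ), IsWallIndex s I J t →
      0 < wallForm I J t q * wallForm I J t q') : q' ∈ c := by
  obtain ⟨p, hp, rfl⟩ := hc
  rw [connectedComponentIn_eq hq]
  have hqc := connectedComponentIn_subset _ _ hq
  -- All conditions are linear equations or strict sign conditions that agree at both ends, so the
  -- segment from `q` to `q'` avoids the walls.
  refine (convex_segment q q').isPreconnected.subset_connectedComponentIn (left_mem_segment ℝ q q')
    ?_ (right_mem_segment ℝ q q')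
  rintro x ⟨a, b, ha, hb, hab, rfl⟩
  have hab' : 0 < a ∨ 0 < b := by
    by_contra hcon
    push Not at hcon
    linarith [hcon.1, hcon.2]
  have hcomb : ∀ {u v : ℝ}, 0 < u → 0 < v → 0 < a * u + b * v := by
    intro u v hu hv
    rcases hab' with h | h
    · exact add_pos_of_pos_of_nonneg (mul_pos h hu) (mul_nonneg hb hv.le)
    · exact add_pos_of_nonneg_of_pos (mul_nonneg ha hu.le) (mul_pos h hv)
  refine ⟨⟨fun i => hcomb (hqc.1.1 i) (hq'.1 i), fun j => hcomb (hqc.1.2.1 j) (hq'.2.1 j), ?_⟩, ?_⟩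
  · have h1 := hqc.1.2.2
    have h2 := hq'.2.2
    simp only [Prod.fst_add, Prod.snd_add, Prod.smul_fst, Prod.smul_snd, Pi.add_apply,
      Pi.smul_apply, smul_eq_mul, Finset.sum_add_distrib, ← Finset.mul_sum, h1, h2]
    ring
  · rintro I J t hw ⟨-, h0⟩
    have h1 := h I J t hw
    rw [wallForm_add_smul] at h0
    rcases pos_and_pos_or_neg_and_neg_of_mul_pos h1 with ⟨h2, h3⟩ | ⟨h2, h3⟩
    · exact (hcomb h2 h3).ne' h0
    · have := hcomb (neg_pos.2 h2) (neg_pos.2 h3)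
      linarith

/-- The point with signed coordinates `d`. -/
def signedPoint (d : Fin m ⊕ Fin n → ℝ) (κ : ℝ) : Ambient m n :=
  (fun i => d (Sum.inl i), fun j => -d (Sum.inr j), κ)

theorem wallForm_signedPoint (I : Finset (Fin m)) (J : Finset (Fin n)) (t : ℕ)
    (d : Fin m ⊕ Fin n → ℝ) (κ : ℝ) :
    wallForm I J t (signedPoint d κ) = ∑ a ∈ I.disjSum J, d a - t * κ := by
  simp [wallForm, signedPoint, Finset.sum_disjSum]

theorem signedPoint_mem_paramSpace {d : Fin m ⊕ Fin n → ℝ} {κ : ℝ}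
    (h1 : ∀ i, 0 < d (Sum.inl i)) (h2 : ∀ j, d (Sum.inr j) < 0) (h3 : ∑ a, d a = s * κ) :
    signedPoint d κ ∈ paramSpace m n s := by
  refine ⟨h1, fun j => by simpa [signedPoint] using h2 j, ?_⟩
  rw [Fintype.sum_sum_type] at h3
  simp only [signedPoint, Finset.sum_neg_distrib]
  linarith

theorem exists_signedPoint (q : Ambient m n) : ∃ d κ, q = signedPoint d κ :=
  ⟨Sum.elim q.1 fun j => -q.2.1 j, q.2.2, by simp [signedPoint]⟩

/-- Positivity is an open condition, so `p` can be moved a little in any direction tangent to the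
wall without leaving it. As the walls coincide, the second form must vanish on the same directions.
-/
theorem wall_direction {I I' : Finset (Fin m)} {J J' : Finset (Fin n)} {t t' : ℕ}
    {p : Ambient m n} (hp : p ∈ wall s I J t) (hwall : wall s I' J' t' = wall s I J t)
    {d : Fin m ⊕ Fin n → ℝ} {κ : ℝ} (h1 : ∑ a ∈ I.disjSum J, d a = t * κ)
    (h2 : ∑ a, d a = s * κ) : ∑ a ∈ I'.disjSum J', d a = t' * κ := by
  obtain ⟨u, κ₀, rfl⟩ := exists_signedPoint p
  have hp' : signedPoint u κ₀ ∈ wall s I' J' t' := hwall ▸ hp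
  obtain ⟨⟨hx, hy, hsum⟩, hform⟩ := hp
  have hev : ∀ᶠ ε in 𝓝[>] (0 : ℝ), (∀ i, 0 < u (Sum.inl i) + ε * d (Sum.inl i)) ∧
      ∀ j, u (Sum.inr j) + ε * d (Sum.inr j) < 0 := by
    apply Filter.Eventually.filter_mono nhdsWithin_le_nhds
    refine (eventually_all.2 fun i => ?_).and (eventually_all.2 fun j => ?_)
    · have hcont : ContinuousAt (fun ε : ℝ => u (Sum.inl i) + ε * d (Sum.inl i)) 0 := by fun_prop
      exact hcont.eventually_const_lt (by simpa [signedPoint] using hx i)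
    · have hcont : ContinuousAt (fun ε : ℝ => u (Sum.inr j) + ε * d (Sum.inr j)) 0 := by fun_prop
      exact hcont.eventually_lt_const (by simpa [signedPoint] using hy j)
  obtain ⟨ε, ⟨hε1, hε2⟩, hε⟩ := (hev.and self_mem_nhdsWithin).exists
  have hu : ∑ a, u a = s * κ₀ := by
    rw [Fintype.sum_sum_type]
    simp only [signedPoint, Finset.sum_neg_distrib] at hsum
    linarith
  have hmem : signedPoint (fun a => u a + ε * d a) (κ₀ + ε * κ) ∈ wall s I J t := by
    refine ⟨signedPoint_mem_paramSpace hε1 hε2 ?_, ?_⟩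
    · rw [Finset.sum_add_distrib, ← Finset.mul_sum, hu, h2]
      ring
    · rw [wallForm_signedPoint] at hform ⊢
      rw [Finset.sum_add_distrib, ← Finset.mul_sum, h1]
      linear_combination hform
  rw [← hwall] at hmem
  have hf := hmem.2
  have hf' := hp'.2
  rw [wallForm_signedPoint] at hf hf'
  rw [Finset.sum_add_distrib, ← Finset.mul_sum] at hf
  have : ε * (∑ a ∈ I'.disjSum J', d a - t' * κ) = 0 := by linear_combination hf - hf'
  rcases mul_eq_zero.1 this with h | h
  · exact absurd h (ne_of_gt hε)
  · linarith

theorem sum_single_disjSum {I : Finset (Fin m)} {J : Finset (Fin n)} (a : Fin m ⊕ Fin n) (c : ℝ) :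
    ∑ x ∈ I.disjSum J, (Pi.single a c : Fin m ⊕ Fin n → ℝ) x =
      if a ∈ I.disjSum J then c else 0 := Finset.sum_pi_single' a c _

/-- Walls that coincide have the same or complementary indices. -/
theorem wall_index_eq {I I' : Finset (Fin m)} {J J' : Finset (Fin n)} {t t' : ℕ}
    (hempty : ¬(I = ∅ ∧ J = ∅)) (hfull : ¬(I = Finset.univ ∧ J = Finset.univ))
    {p : Ambient m n} (hp : p ∈ wall s I J t) (hw : IsWallIndex s I' J' t')
    (hwall : wall s I' J' t' = wall s I J t) :
    (I' = I ∧ J' = J ∧ t' = t) ∨ (I' = Iᶜ ∧ J' = Jᶜ ∧ t' + t = s) := by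
  have hne : ∃ a, a ∈ I.disjSum J := by
    by_contra hcon
    push Not at hcon
    refine hempty ⟨Finset.eq_empty_of_forall_notMem fun i hi => ?_,
      Finset.eq_empty_of_forall_notMem fun j hj => ?_⟩
    · exact hcon (Sum.inl i) (by simpa using hi)
    · exact hcon (Sum.inr j) (by simpa using hj)
  have hne' : ∃ a, a ∉ I.disjSum J := by
    by_contra hcon
    push Not at hcon
    refine hfull ⟨Finset.eq_univ_of_forall fun i => ?_, Finset.eq_univ_of_forall fun j => ?_⟩
    · simpa using hcon (Sum.inl i)
    · simpa using hcon (Sum.inr j)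
  -- Transferring one unit from `b` to `a` is tangent to the wall if both lie on the same side of
  -- the cut. Hence the second index set contains each side entirely or not at all.
  have hiff : ∀ a b, (a ∈ I.disjSum J ↔ b ∈ I.disjSum J) →
      (a ∈ I'.disjSum J' ↔ b ∈ I'.disjSum J') := by
    intro a b hab
    have := wall_direction hp hwall (d := Pi.single a 1 - Pi.single b 1) (κ := 0)
      (by
        simp only [Pi.sub_apply, Finset.sum_sub_distrib, sum_single_disjSum, hab]
        ring)
      (by simp [Finset.sum_sub_distrib])
    simp only [Pi.sub_apply, Finset.sum_sub_distrib, sum_single_disjSum] at this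
    by_cases h1 : a ∈ I'.disjSum J' <;> by_cases h2 : b ∈ I'.disjSum J' <;>
      simp [h1, h2] at this ⊢
  obtain ⟨a, ha⟩ := hne
  obtain ⟨b, hb⟩ := hne'
  -- A tangent direction with `κ = 1`, having `t` on one coordinate inside the cut and `s - t` on
  -- one outside. It determines `t'` in each of the four cases.
  have hcount := wall_direction hp hwall
    (d := Pi.single a (t : ℝ) + Pi.single b ((s : ℝ) - t)) (κ := 1)
    (by
      simp only [Pi.add_apply, Finset.sum_add_distrib, sum_single_disjSum, ha, hb, if_true,
        if_false]
      ring)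
    (by simp [Finset.sum_add_distrib])
  simp only [Pi.add_apply, Finset.sum_add_distrib, sum_single_disjSum] at hcount
  have hmemL : ∀ {A : Finset (Fin m)} {B : Finset (Fin n)} {i}, Sum.inl i ∈ A.disjSum B ↔ i ∈ A :=
    by simp
  have hmemR : ∀ {A : Finset (Fin m)} {B : Finset (Fin n)} {j}, Sum.inr j ∈ A.disjSum B ↔ j ∈ B :=
    by simp
  have hallin : ∀ x, x ∈ I.disjSum J → (x ∈ I'.disjSum J' ↔ a ∈ I'.disjSum J') := fun x hx =>
    hiff x a (by simp only [hx, ha])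
  have hallout : ∀ x, x ∉ I.disjSum J → (x ∈ I'.disjSum J' ↔ b ∈ I'.disjSum J') := fun x hx =>
    hiff x b (by simp only [hx, hb])
  obtain ⟨ht', hw1, hw2⟩ := hw
  by_cases h1 : a ∈ I'.disjSum J' <;> by_cases h2 : b ∈ I'.disjSum J'
  · exfalso
    have hall : ∀ x, x ∈ I'.disjSum J' := fun x => by
      by_cases hx : x ∈ I.disjSum J
      · exact (hallin x hx).2 h1
      · exact (hallout x hx).2 h2
    refine hw2 ⟨Finset.eq_univ_of_forall fun i => hmemL.1 (hall (Sum.inl i)),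
      Finset.eq_univ_of_forall fun j => hmemR.1 (hall (Sum.inr j)), ?_⟩
    simp only [h1, h2, if_true] at hcount
    have : (t' : ℝ) = s := by linarith
    exact_mod_cast this
  · left
    have hall : ∀ x, x ∈ I'.disjSum J' ↔ x ∈ I.disjSum J := fun x => by
      by_cases hx : x ∈ I.disjSum J
      · simp only [hx, hallin x hx, h1]
      · simp only [hx, hallout x hx, h2]
    refine ⟨?_, ?_, ?_⟩
    · ext i
      rw [← hmemL (B := J'), hall, hmemL]
    · ext j
      rw [← hmemR (A := I'), hall, hmemR]
    · simp only [h1, h2, if_true, if_false] at hcount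
      have : (t' : ℝ) = t := by linarith
      exact_mod_cast this
  · right
    have hall : ∀ x, x ∈ I'.disjSum J' ↔ x ∉ I.disjSum J := fun x => by
      by_cases hx : x ∈ I.disjSum J
      · simp only [hx, hallin x hx, h1, not_true]
      · simp only [hx, hallout x hx, h2, not_false_eq_true]
    refine ⟨?_, ?_, ?_⟩
    · ext i
      rw [← hmemL (B := J'), hall, hmemL, Finset.mem_compl]
    · ext j
      rw [← hmemR (A := I'), hall, hmemR, Finset.mem_compl]
    · simp only [h1, h2, if_true, if_false] at hcount
      have : (t' : ℝ) + t = s := by linarith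
      exact_mod_cast this
  · exfalso
    have hall : ∀ x, x ∉ I'.disjSum J' := fun x => by
      by_cases hx : x ∈ I.disjSum J
      · rwa [hallin x hx]
      · rwa [hallout x hx]
    refine hw1 ⟨Finset.eq_empty_of_forall_notMem fun i hi => hall (Sum.inl i) (hmemL.2 hi),
      Finset.eq_empty_of_forall_notMem fun j hj => hall (Sum.inr j) (hmemR.2 hj), ?_⟩
    simp only [h1, h2, if_false] at hcount
    have : (t' : ℝ) = 0 := by linarith
    exact_mod_cast this

end Chambers

/-! ### Lattice points of chambers -/

section LatticePoints

open Filter Topology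

variable {m n s : ℕ}

theorem wallForm_latticePoint (I : Finset (Fin m)) (J : Finset (Fin n)) (t : ℕ) (μ : Fin m → ℤ)
    (ν : Fin n → ℤ) (k : ℤ) :
    wallForm I J t (latticePoint μ ν k) = ((delta I J t μ ν k : ℤ) : ℝ) := by
  simp [wallForm, latticePoint, delta]

theorem tendsto_floor_div (x : ℝ) :
    Tendsto (fun N : ℕ => ((⌊(N : ℝ) * x⌋ : ℤ) : ℝ) / N) atTop (𝓝 x) := by
  have h1 : Tendsto (fun N : ℕ => x - 1 / (N : ℝ)) atTop (𝓝 x) := by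
    simpa using tendsto_const_nhds.sub (tendsto_one_div_atTop_nhds_zero_nat (𝕜 := ℝ)) (a := x)
  refine tendsto_of_tendsto_of_tendsto_of_le_of_le' h1 tendsto_const_nhds ?_ ?_
  · filter_upwards [eventually_gt_atTop 0] with N hN
    have hN' : (0 : ℝ) < N := by exact_mod_cast hN
    rw [le_div_iff₀ hN', sub_mul, one_div, inv_mul_cancel₀ hN'.ne']
    linarith [Int.sub_one_lt_floor ((N : ℝ) * x)]
  · filter_upwards [eventually_gt_atTop 0] with N hN
    have hN' : (0 : ℝ) < N := by exact_mod_cast hN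
    rw [div_le_iff₀ hN']
    linarith [Int.floor_le ((N : ℝ) * x)]

/-- The real point with integral signed coordinates. -/
theorem signedPoint_intCast (d : Fin m ⊕ Fin n → ℤ) (κ : ℤ) :
    signedPoint (fun a => (d a : ℝ)) κ =
      latticePoint (fun i => d (Sum.inl i)) (fun j => -d (Sum.inr j)) κ := by
  simp [signedPoint, latticePoint]

theorem eventually_isWallIndex {α : Type*} {l : Filter α}
    {p : Finset (Fin m) → Finset (Fin n) → ℕ → α → Prop}
    (h : ∀ I J t, IsWallIndex s I J t → ∀ᶠ x in l, p I J t x) :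
    ∀ᶠ x in l, ∀ I J t, IsWallIndex s I J t → p I J t x := by
  have : ∀ᶠ x in l, ∀ I J, ∀ t : Fin (s + 1), IsWallIndex s I J t → p I J t x := by
    refine eventually_all.2 fun I => eventually_all.2 fun J => eventually_all.2 fun t => ?_
    by_cases hw : IsWallIndex s I J t
    · filter_upwards [h I J t hw] with x hx _ using hx
    · exact Eventually.of_forall fun x hx => absurd hx hw
  filter_upwards [this] with x hx I J t hw
  exact hx I J ⟨t, Nat.lt_succ_of_le hw.1⟩ hw

/-- Every chamber contains a lattice point. -/
theorem IsChamber.exists_latticePoint {c : Set (Ambient m n)} (hc : IsChamber s c)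
    (a₀ : Fin m ⊕ Fin n) : ∃ μ ν k, latticePoint μ ν k ∈ c := by
  classical
  obtain ⟨q, hq⟩ : c.Nonempty := by
    obtain ⟨p, hp, rfl⟩ := hc
    exact ⟨p, mem_connectedComponentIn hp⟩
  obtain ⟨u, κ, rfl⟩ := exists_signedPoint q
  obtain ⟨hx, hy, hsum⟩ := (hc.subset hq).1
  have hu : ∑ a, u a = s * κ := by
    rw [Fintype.sum_sum_type]
    simp only [signedPoint, Finset.sum_neg_distrib] at hsum
    linarith
  -- Chambers are cones, so a large multiple of a point is rounded down to integers. The coordinate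
  -- `a₀` is corrected to keep the linear equation exact; after division by `N` the error tends to
  -- zero.
  set K : ℕ → ℤ := fun N => ⌊(N : ℝ) * κ⌋ with hK
  set F : ℕ → Fin m ⊕ Fin n → ℤ := fun N a => ⌊(N : ℝ) * u a⌋ with hF
  set E : ℕ → Fin m ⊕ Fin n → ℤ := fun N =>
    Function.update (F N) a₀ (s * K N - ∑ a ∈ Finset.univ.erase a₀, F N a) with hE
  have hEsum : ∀ N, ∑ a, E N a = s * K N := by
    intro N
    rw [← Finset.add_sum_erase Finset.univ _ (Finset.mem_univ a₀)]
    have : ∑ a ∈ Finset.univ.erase a₀, E N a = ∑ a ∈ Finset.univ.erase a₀, F N a :=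
      Finset.sum_congr rfl fun a ha => Function.update_of_ne (Finset.ne_of_mem_erase ha) _ _
    rw [this, hE]
    simp
  have hKlim : Tendsto (fun N => (K N : ℝ) / N) atTop (𝓝 κ) := tendsto_floor_div κ
  have hElim : ∀ a, Tendsto (fun N => (E N a : ℝ) / N) atTop (𝓝 (u a)) := by
    intro a
    by_cases ha : a = a₀
    · subst ha
      have h1 : u a = s * κ - ∑ b ∈ Finset.univ.erase a, u b := by
        rw [← hu, ← Finset.add_sum_erase Finset.univ _ (Finset.mem_univ a)]
        ring
      rw [h1]
      have h2 := (hKlim.const_mul (s : ℝ)).sub (tendsto_finsetSum (Finset.univ.erase a)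
        fun b _ => tendsto_floor_div (u b))
      refine h2.congr fun N => ?_
      simp only [hE, Function.update_self, hF]
      push_cast
      rw [sub_div, Finset.sum_div, mul_div_assoc]
    · have : ∀ N, E N a = F N a := fun N => Function.update_of_ne ha _ _
      simp only [this]
      exact tendsto_floor_div (u a)
  have hforms : ∀ᶠ N : ℕ in atTop, ∀ I J t, IsWallIndex s I J t →
      0 < wallForm I J t (signedPoint u κ) *
        wallForm I J t (signedPoint (fun a => (E N a : ℝ)) (K N)) := by
    refine eventually_isWallIndex fun I J t hw => ?_
    have hne := hc.form_ne_zero hq hw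
    have hlim : Tendsto (fun N : ℕ => wallForm I J t (signedPoint u κ) *
        (wallForm I J t (signedPoint (fun a => (E N a : ℝ)) (K N)) / N)) atTop
        (𝓝 (wallForm I J t (signedPoint u κ) * wallForm I J t (signedPoint u κ))) := by
      refine Tendsto.const_mul _ ?_
      simp only [wallForm_signedPoint]
      refine ((tendsto_finsetSum (I.disjSum J) fun a _ => hElim a).sub
        (hKlim.const_mul (t : ℝ))).congr fun N => ?_
      rw [sub_div, Finset.sum_div, mul_div_assoc]
    filter_upwards [hlim.eventually_const_lt (mul_self_pos.2 hne), eventually_gt_atTop 0]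
      with N hN hN0
    have hN' : (0 : ℝ) < N := by exact_mod_cast hN0
    rw [← mul_div_assoc] at hN
    exact (div_pos_iff_of_pos_right hN').1 hN
  have hxs : ∀ᶠ N : ℕ in atTop, ∀ i, 0 < (E N (Sum.inl i) : ℝ) := by
    refine eventually_all.2 fun i => ?_
    filter_upwards [(hElim (Sum.inl i)).eventually_const_lt
      (by simpa [signedPoint] using hx i), eventually_gt_atTop 0] with N hN hN0
    exact (div_pos_iff_of_pos_right (by exact_mod_cast hN0)).1 hN
  have hys : ∀ᶠ N : ℕ in atTop, ∀ j, (E N (Sum.inr j) : ℝ) < 0 := by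
    refine eventually_all.2 fun j => ?_
    filter_upwards [(hElim (Sum.inr j)).eventually_lt_const
      (by simpa [signedPoint] using hy j), eventually_gt_atTop 0] with N hN hN0
    by_contra hcon
    have := div_nonneg (not_lt.1 hcon) (Nat.cast_nonneg (α := ℝ) N)
    linarith
  obtain ⟨N, h1, h2, h3⟩ := (hforms.and (hxs.and hys)).exists
  refine ⟨fun i => E N (Sum.inl i), fun j => -E N (Sum.inr j), K N, ?_⟩
  rw [← signedPoint_intCast (E N) (K N)]
  refine hc.mem_of_signs hq (signedPoint_mem_paramSpace h2 h3 ?_) h1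
  exact_mod_cast hEsum N

/-- A polynomial that vanishes at the lattice points of a chamber vanishes at all lattice points
of the hyperplane spanned by the chamber. -/
theorem IsChamber.value_eq_zero {c : Set (Ambient m n)} (hc : IsChamber s c)
    (a₀ : Fin m ⊕ Fin n) {D : ParamPoly m n}
    (hD : ∀ μ ν k, latticePoint μ ν k ∈ c → D.value μ ν k = 0) (μ : Fin m → ℤ) (ν : Fin n → ℤ)
    (k : ℤ) (hsum : ∑ i, μ i = ∑ j, ν j + s * k) : D.value μ ν k = 0 := by
  obtain ⟨μ₀, ν₀, k₀, hq⟩ := hc.exists_latticePoint a₀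
  have hq' := (hc.subset hq).1
  -- The ray from the given point in the direction of a lattice point of the chamber eventually
  -- enters the chamber.
  have hpoint : ∀ N : ℕ, latticePoint (fun i => N * μ₀ i + μ i) (fun j => N * ν₀ j + ν j)
      (N * k₀ + k) = (N : ℝ) • latticePoint μ₀ ν₀ k₀ + (1 : ℝ) • latticePoint μ ν k := by
    intro N
    refine Prod.ext ?_ (Prod.ext ?_ ?_)
    · funext i
      simp [latticePoint]
    · funext j
      simp [latticePoint]
    · simp [latticePoint]
  have hlarge : ∀ {x : ℝ} (y : ℝ), 0 < x → ∀ᶠ N : ℕ in atTop, 0 < N * x + y := by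
    intro x y hx
    have h : Tendsto (fun N : ℕ => (N : ℝ) * x + y) atTop atTop :=
      tendsto_atTop_add_const_right _ _ (tendsto_natCast_atTop_atTop.atTop_mul_const hx)
    exact h.eventually_gt_atTop 0
  have hmem : ∀ᶠ N : ℕ in atTop, latticePoint (fun i => N * μ₀ i + μ i)
      (fun j => N * ν₀ j + ν j) (N * k₀ + k) ∈ c := by
    have h1 : ∀ᶠ N : ℕ in atTop, ∀ i, 0 < (N : ℝ) * (latticePoint μ₀ ν₀ k₀).1 i + μ i :=
      eventually_all.2 fun i => hlarge _ (hq'.1 i)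
    have h2 : ∀ᶠ N : ℕ in atTop, ∀ j, 0 < (N : ℝ) * (latticePoint μ₀ ν₀ k₀).2.1 j + ν j :=
      eventually_all.2 fun j => hlarge _ (hq'.2.1 j)
    have h3 : ∀ᶠ N : ℕ in atTop, ∀ I J t, IsWallIndex s I J t →
        0 < wallForm I J t (latticePoint μ₀ ν₀ k₀) * wallForm I J t (latticePoint
          (fun i => N * μ₀ i + μ i) (fun j => N * ν₀ j + ν j) (N * k₀ + k)) := by
      refine eventually_isWallIndex fun I J t hw => ?_
      have hne := hc.form_ne_zero hq hw
      filter_upwards [hlarge (wallForm I J t (latticePoint μ₀ ν₀ k₀) *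
        wallForm I J t (latticePoint μ ν k)) (mul_self_pos.2 hne)] with N hN
      rw [hpoint, wallForm_add_smul]
      linarith
    filter_upwards [h1, h2, h3] with N h1 h2 h3
    refine hc.mem_of_signs hq ⟨fun i => ?_, fun j => ?_, ?_⟩ h3
    · simpa [latticePoint] using h1 i
    · simpa [latticePoint] using h2 j
    · have hs : (∑ i, (μ i : ℝ)) = ∑ j, (ν j : ℝ) + s * k := by exact_mod_cast hsum
      have hs₀ := hq'.2.2
      simp only [latticePoint] at hs₀ ⊢
      push_cast
      rw [Finset.sum_add_distrib, Finset.sum_add_distrib, ← Finset.mul_sum, ← Finset.mul_sum, hs₀,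
        hs]
      ring
  -- The restriction of `D` to this ray vanishes for all large `N`, hence identically; `N = 0` gives
  -- the assertion.
  set f : Polynomial ℚ := MvPolynomial.aeval (Sum.elim
    (fun i => Polynomial.C (μ₀ i : ℚ) * Polynomial.X + Polynomial.C (μ i : ℚ))
    (Sum.elim (fun j => Polynomial.C (ν₀ j : ℚ) * Polynomial.X + Polynomial.C (ν j : ℚ))
      fun _ => Polynomial.C (k₀ : ℚ) * Polynomial.X + Polynomial.C (k : ℚ))) D with hf
  have heval : ∀ N : ℕ, f.eval (N : ℚ) =
      D.value (fun i => N * μ₀ i + μ i) (fun j => N * ν₀ j + ν j) (N * k₀ + k) := by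
    intro N
    rw [hf, ParamPoly.value, MvPolynomial.aeval_def, Polynomial.algebraMap_eq,
      ← Polynomial.coe_evalRingHom, ← MvPolynomial.coe_eval₂Hom, ← RingHom.comp_apply,
      MvPolynomial.comp_eval₂Hom]
    have : (Polynomial.evalRingHom (N : ℚ)).comp Polynomial.C = RingHom.id ℚ := by
      ext
      simp
    rw [this]
    change _ = MvPolynomial.eval₂Hom (RingHom.id ℚ) _ D
    congr 2
    funext x
    rcases x with i | j | _ <;> simp [mul_comm]
  have hzero : f = 0 := by
    obtain ⟨N₀, hN₀⟩ := eventually_atTop.1 hmem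
    apply Polynomial.eq_zero_of_infinite_isRoot
    refine Set.infinite_of_injective_forall_mem (f := fun N : ℕ => ((N + N₀ : ℕ) : ℚ)) ?_ ?_
    · intro a b hab
      simpa using hab
    · intro N
      change f.eval _ = 0
      rw [heval]
      exact hD _ _ _ (hN₀ _ (by omega))
  have h0 := heval 0
  rw [hzero] at h0
  simpa using h0.symm

end LatticePoints

/-! ### The wall crossing formula -/

section WallCrossing

variable {m n s : ℕ}

/-- The real energies at a point of the parameter space. -/
def pointEnergy (q : Ambient m n) : OpIndex m n s → ℝ :=
  Sum.elim q.1 (Sum.elim (fun _ => -q.2.2) fun j => -q.2.1 j)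

theorem sum_pointEnergy (q : Ambient m n) (I : Finset (Fin m)) (K : Finset (Fin s))
    (J : Finset (Fin n)) : ∑ x ∈ opSet I K J, pointEnergy q x = wallForm I J K.card q := by
  rw [sum_opSet]
  simp only [pointEnergy, Sum.elim_inl, Sum.elim_inr, Finset.sum_const, Finset.sum_neg_distrib,
    wallForm, nsmul_eq_mul]
  ring

theorem sum_pointEnergy_univ {q : Ambient m n} (hq : q ∈ paramSpace m n s) :
    ∑ x : OpIndex m n s, pointEnergy q x = 0 := by
  rw [← opSet_univ, sum_pointEnergy, wallForm, hq.2.2, Finset.card_univ, Fintype.card_fin]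
  ring

theorem sum_eq_of_mem_paramSpace {μ : Fin m → ℤ} {ν : Fin n → ℤ} {k : ℤ}
    (h : latticePoint μ ν k ∈ paramSpace m n s) : ∑ i, μ i = ∑ j, ν j + s * k := by
  have := h.2.2
  simp only [latticePoint] at this
  exact_mod_cast this

theorem sum_opEnergy_univ {μ : Fin m → ℤ} {ν : Fin n → ℤ} {k : ℤ}
    (h : latticePoint μ ν k ∈ paramSpace m n s) :
    ∑ x : OpIndex m n s, opEnergy μ ν k x = 0 := by
  rw [← opSet_univ, sum_opEnergy, delta, sum_eq_of_mem_paramSpace h, Finset.card_univ,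
    Fintype.card_fin]
  ring

theorem isWallIndex_of_opSet {I : Finset (Fin m)} {K : Finset (Fin s)} {J : Finset (Fin n)}
    (h1 : (opSet I K J).Nonempty) (h2 : opSet I K J ≠ Finset.univ) :
    IsWallIndex s I J K.card := by
  refine ⟨by simpa using K.card_le_univ, ?_, ?_⟩
  · rintro ⟨rfl, rfl, hK⟩
    rw [Finset.card_eq_zero.1 hK, opSet_empty] at h1
    exact Finset.not_nonempty_empty h1
  · rintro ⟨rfl, rfl, hK⟩
    apply h2
    rw [(Finset.card_eq_iff_eq_univ K).1 (by simpa using hK), opSet_univ]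

theorem opSet_nonempty {I : Finset (Fin m)} {J : Finset (Fin n)} (h : ¬(I = ∅ ∧ J = ∅))
    (K : Finset (Fin s)) : (opSet I K J).Nonempty := by
  rw [Finset.nonempty_iff_ne_empty, ← opSet_empty, Ne, opSet_inj]
  exact fun h' => h ⟨h'.1, h'.2.2⟩

theorem opSet_ne_univ {I : Finset (Fin m)} {J : Finset (Fin n)}
    (h : ¬(I = Finset.univ ∧ J = Finset.univ)) (K : Finset (Fin s)) :
    opSet I K J ≠ Finset.univ := by
  rw [← opSet_univ, Ne, opSet_inj]
  exact fun h' => h ⟨h'.1, h'.2.2⟩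

/-- Forms that are positive at `p` are positive nearby, hence throughout a chamber with `p` in its
closure. Forms vanishing at `p` are left free. Nonvanishing on proper singletons excludes `k = 0` as
well, so the diagonal operator `𝓔̃_0` does not interfere. -/
theorem IsChamber.compatible {c : Set (Ambient m n)} (hc : IsChamber s c) {p : Ambient m n}
    (hp : p ∈ paramSpace m n s) (hpc : p ∈ closure c) {μ : Fin m → ℤ} {ν : Fin n → ℤ} {k : ℤ}
    (hq : latticePoint μ ν k ∈ c) :
    Compatible (pointEnergy p) (opEnergy μ ν k : OpIndex m n s → ℤ) where
  sum_eq := sum_opEnergy_univ (hc.subset hq).1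
  ne_zero B h1 h2 := by
    obtain ⟨I, K, J, rfl⟩ := exists_eq_opSet B
    have := hc.form_ne_zero hq (isWallIndex_of_opSet h1 h2)
    rw [wallForm_latticePoint] at this
    rw [sum_opEnergy]
    exact_mod_cast this
  pos B hB := by
    obtain ⟨I, K, J, rfl⟩ := exists_eq_opSet B
    have h1 : (opSet I K J).Nonempty := by
      rw [Finset.nonempty_iff_ne_empty]
      intro h
      rw [h, Finset.sum_empty] at hB
      exact lt_irrefl _ hB
    have h2 : opSet I K J ≠ Finset.univ := by
      intro h
      rw [h, sum_pointEnergy_univ hp] at hB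
      exact lt_irrefl _ hB
    rw [sum_pointEnergy] at hB
    have := hc.form_pos_of_closure hpc hq (isWallIndex_of_opSet h1 h2) hB
    rw [wallForm_latticePoint] at this
    rw [sum_opEnergy]
    exact_mod_cast this

/-- A point of the wall `W_{I,J,t}` that lies on no other wall. -/
structure IsFacePoint (s : ℕ) (I : Finset (Fin m)) (J : Finset (Fin n)) (t : ℕ)
    (p : Ambient m n) : Prop where
  le : t ≤ s
  not_empty : ¬(I = ∅ ∧ J = ∅)
  not_univ : ¬(I = Finset.univ ∧ J = Finset.univ)
  mem : p ∈ wall s I J t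
  unique : ∀ (I' : Finset (Fin m)) (J' : Finset (Fin n)) (t' : ℕ),
    IsWallIndex s I' J' t' → p ∈ wall s I' J' t' → wall s I' J' t' = wall s I J t

variable {I : Finset (Fin m)} {J : Finset (Fin n)} {t : ℕ} {p : Ambient m n}

theorem IsFacePoint.opSet_mem_zeroSets (hp : IsFacePoint s I J t p) {K : Finset (Fin s)}
    (hK : K.card = t) : opSet I K J ∈ zeroSets (pointEnergy p) :=
  mem_zeroSets.2 ⟨opSet_nonempty hp.not_empty K, opSet_ne_univ hp.not_univ K, by
    rw [sum_pointEnergy, hK, hp.mem.2]⟩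

/-- All operators `𝓔_{-k}` have the same energy, so a wall determines only the number of them in
`T`. This is why the formula sums over all `K` of size `t`. -/
theorem IsFacePoint.eq_opSet_or (hp : IsFacePoint s I J t p) {T : Finset (OpIndex m n s)}
    (hT : T ∈ zeroSets (pointEnergy p)) :
    (∃ K : Finset (Fin s), K.card = t ∧ T = opSet I K J) ∨
      ∃ K : Finset (Fin s), K.card = t ∧ T = (opSet I K J)ᶜ := by
  obtain ⟨I', K, J', rfl⟩ := exists_eq_opSet T
  obtain ⟨h1, h2, h3⟩ := mem_zeroSets.1 hT
  rw [sum_pointEnergy] at h3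
  have hw := isWallIndex_of_opSet h1 h2
  rcases wall_index_eq hp.not_empty hp.not_univ hp.mem hw
    (hp.unique I' J' K.card hw ⟨hp.mem.1, h3⟩) with ⟨rfl, rfl, h⟩ | ⟨rfl, rfl, h⟩
  · exact Or.inl ⟨K, h, rfl⟩
  · refine Or.inr ⟨Kᶜ, ?_, ?_⟩
    · rw [Finset.card_compl, Fintype.card_fin]
      omega
    · rw [opSet_compl, compl_compl]

/-- Two sets of the same type share the elements of `I` and `J`, or of their complements, and are
not disjoint. Sets of opposite type that are disjoint come from `K ⊆ K'` of equal size, hence are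
complementary. -/
theorem IsFacePoint.union_eq_univ (hp : IsFacePoint s I J t p) (B C : Finset (OpIndex m n s))
    (hB : B.Nonempty) (hC : C.Nonempty) (hBC : Disjoint B C)
    (hB0 : ∑ x ∈ B, pointEnergy p x = 0) (hC0 : ∑ x ∈ C, pointEnergy p x = 0) :
    B ∪ C = Finset.univ := by
  by_cases hBu : B = Finset.univ
  · exact Finset.eq_univ_of_forall fun x => by simp [hBu]
  by_cases hCu : C = Finset.univ
  · exact Finset.eq_univ_of_forall fun x => by simp [hCu]
  have h1 := hp.eq_opSet_or (mem_zeroSets.2 ⟨hB, hBu, hB0⟩)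
  have h2 := hp.eq_opSet_or (mem_zeroSets.2 ⟨hC, hCu, hC0⟩)
  have hsame : ∀ {A : Finset (Fin m)} {E : Finset (Fin n)} {K K' : Finset (Fin s)},
      ¬(A = ∅ ∧ E = ∅) → ¬Disjoint (opSet A K E) (opSet A K' E) := by
    intro A E K K' h hd
    apply h
    rw [Finset.disjoint_left] at hd
    constructor
    · refine Finset.eq_empty_of_forall_notMem fun i hi => ?_
      exact hd (mem_opSet_inl.2 hi) (mem_opSet_inl.2 hi)
    · refine Finset.eq_empty_of_forall_notMem fun j hj => ?_
      exact hd (mem_opSet_inr_inr.2 hj) (mem_opSet_inr_inr.2 hj)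
  have hcases : ∀ {K K' : Finset (Fin s)}, K.card = t → K'.card = t →
      Disjoint (opSet I K J) (opSet I K' J)ᶜ → opSet I K J ∪ (opSet I K' J)ᶜ = Finset.univ := by
    intro K K' hK hK' hd
    have hsub : K ⊆ K' := by
      intro x hx
      by_contra hx'
      rw [opSet_compl, Finset.disjoint_left] at hd
      exact hd (mem_opSet_inr_inl.2 hx) (mem_opSet_inr_inl.2 (Finset.mem_compl.2 hx'))
    rw [Finset.eq_of_subset_of_card_le hsub (by omega), Finset.union_compl]
  rcases h1 with ⟨K, hK, rfl⟩ | ⟨K, hK, rfl⟩ <;> rcases h2 with ⟨K', hK', rfl⟩ | ⟨K', hK', rfl⟩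
  · exact absurd hBC (hsame hp.not_empty)
  · exact hcases hK hK' hBC
  · rw [Finset.union_comm]
    exact hcases hK' hK hBC.symm
  · rw [opSet_compl, opSet_compl] at hBC
    refine absurd hBC (hsame ?_)
    rw [Finset.compl_eq_empty_iff, Finset.compl_eq_empty_iff]
    exact hp.not_univ

theorem IsFacePoint.resolves (hp : IsFacePoint s I J t p) :
    Resolves (opVar m n (id : Fin s → Fin s)) (bosons m n s) (pointEnergy p)
      (allBlocks m n s) := by
  have hboson : ∀ x ∈ bosons m n s, pointEnergy p x ≠ 0 := by
    intro x hx
    rcases x with i | q | j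
    · exact (hp.mem.1.1 i).ne'
    · simp [bosons, mem_opSet_inr_inl] at hx
    · exact neg_ne_zero.2 (hp.mem.1.2.1 j).ne'
  obtain ⟨K, -, hK⟩ := Finset.exists_subset_card_eq (s := (Finset.univ : Finset (Fin s))) (n := t)
    (by simpa using hp.le)
  obtain ⟨h1, h2, h3⟩ := mem_zeroSets.1 (hp.opSet_mem_zeroSets hK)
  have hcard : Fintype.card (OpIndex m n s) = m + s + n := by
    simp [add_assoc]
  have hlt : (opSet I K J).card < m + s + n := by
    rw [← hcard]
    exact (Finset.card_lt_iff_ne_univ _).2 h2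
  have hpos := h1.card_pos
  refine resolves_of_isPart (fun x => constantCoeff_opVar id x) (fun x hx => opVar_eq_zero id hx)
    (sum_pointEnergy_univ hp.mem.1) hp.union_eq_univ _ _ length_allBlocks isPart_allBlocks ?_
    (by omega) ?_
  · intro B hB hBP
    simp only [allBlocks, opBlocks, List.mem_append, List.mem_map] at hB
    rcases hB with ⟨i, _, rfl⟩ | ⟨i, _, rfl⟩ | ⟨i, _, rfl⟩ <;>
    · rw [Finset.sum_singleton]
      exact hboson _ (hBP (Finset.mem_singleton_self _))
  -- With exactly two operators, both bosonic, the cut would be a single boson of energy zero at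
  -- `p`, contrary to the positivity of the parts.
  · intro hN huniv
    have : (opSet I K J).card = 1 := by omega
    obtain ⟨x, hx⟩ := Finset.card_eq_one.1 this
    rw [hx, Finset.sum_singleton] at h3
    exact hboson x (huniv ▸ Finset.mem_univ x) h3

/-- The terms of the resolved vacuum expectation value that survive in a chamber. -/
theorem sum_zeroSets_eq {ι σ : Type*} [Fintype ι] [DecidableEq ι] {p : ι → ℝ}
    (z : ι → MvPowerSeries σ ℚ) (e : ι → ℤ) (A : Finset ι → MvPowerSeries σ ℚ) {κ : Type*}
    (S : Finset κ) (f : κ → Finset ι) (hinj : Function.Injective f)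
    (hf : ∀ a ∈ S, f a ∈ zeroSets p) (hpos : ∀ a ∈ S, 0 < ∑ x ∈ f a, e x)
    (hneg : ∀ T ∈ zeroSets p, (∀ a ∈ S, T ≠ f a) → ∑ x ∈ T, e x < 0) :
    ∑ T ∈ zeroSets p, A T * pairVev z e T =
      ∑ a ∈ S, A (f a) * (sigmaRatio (∑ x ∈ f a, castE e x) 1).subst (∑ x, z x) := by
  classical
  rw [← Finset.sum_subset (s₁ := S.image f)]
  · rw [Finset.sum_image fun a _ b _ h => hinj h]
    refine Finset.sum_congr rfl fun a ha => ?_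
    rw [pairVev, if_pos (hpos a ha), sum_castE]
  · intro T hT
    obtain ⟨a, ha, rfl⟩ := Finset.mem_image.1 hT
    exact hf a ha
  · intro T hT hT'
    have := hneg T hT fun a ha h => hT' (Finset.mem_image.2 ⟨a, ha, h.symm⟩)
    rw [pairVev, if_neg (by omega), mul_zero]

theorem prod_ne_zero_of_mem {μ : Fin m → ℤ} {ν : Fin n → ℤ} {k : ℤ}
    (h : latticePoint μ ν k ∈ paramSpace m n s) :
    (∀ i, (μ i : ℚ) ≠ 0) ∧ ∀ j, (ν j : ℚ) ≠ 0 := by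
  constructor
  · intro i
    have : (0 : ℝ) < μ i := h.1 i
    have : 0 < μ i := by exact_mod_cast this
    exact_mod_cast this.ne'
  · intro j
    have : (0 : ℝ) < ν j := h.2.1 j
    have : 0 < ν j := by exact_mod_cast this
    exact_mod_cast this.ne'

/-- The weight of the list cancels the prefactor of the Hurwitz number except for the sign of the
energies `-ν_j`. -/
theorem hurwitzNumber_eq_of_vev {μ : Fin m → ℤ} {ν : Fin n → ℤ} {k : ℤ} (r : ℕ)
    (h : latticePoint μ ν k ∈ paramSpace m n s) {F : MvPowerSeries (Fin s) ℚ}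
    (hF : vev _ (blockProd (opVar m n id) (opEnergy μ ν k) (allBlocks m n s)) =
      listWeight (bosons m n s) (castE (opEnergy μ ν k)) (allBlocks m n s) • F) :
    hurwitzNumber (List.ofFn μ) (List.ofFn ν) k r s =
      (-1) ^ n * MvPowerSeries.coeff (fullExponent s r) F := by
  obtain ⟨h1, h2⟩ := prod_ne_zero_of_mem h
  have h1' : ((∏ i, μ i : ℤ) : ℚ) ≠ 0 := by
    rw [Int.cast_prod]
    exact Finset.prod_ne_zero_iff.2 fun i _ => h1 i
  have h2' : ((∏ j, ν j : ℤ) : ℚ) ≠ 0 := by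
    rw [Int.cast_prod]
    exact Finset.prod_ne_zero_iff.2 fun i _ => h2 i
  rw [hurwitzNumber, hurwitzSeries_eq, hF, listWeight_allBlocks, smul_smul, map_smul, smul_eq_mul]
  congr 1
  field_simp

/-- The polynomial on one side of a wall: `f K` runs over the sets of positive energy. -/
theorem isChamberPolynomial_of_resolves (r : ℕ) {c : Set (Ambient m n)} (hc : IsChamber s c)
    {Q : (OpIndex m n s → ℚ) → MvPowerSeries (Fin s) ℚ}
    {A : Finset (OpIndex m n s) → (OpIndex m n s → ℚ) → MvPowerSeries (Fin s) ℚ}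
    (hQ : IsPolyFam Q) (hA : ∀ T, IsPolyFam (A T)) {S : Finset (Finset (Fin s))}
    {f : Finset (Fin s) → Finset (OpIndex m n s)}
    (hvev : ∀ (μ : Fin m → ℤ) (ν : Fin n → ℤ) (k : ℤ), latticePoint μ ν k ∈ c →
      vev _ (blockProd (opVar m n id) (opEnergy μ ν k) (allBlocks m n s)) =
        listWeight (bosons m n s) (castE (opEnergy μ ν k)) (allBlocks m n s) •
          (Q (castE (opEnergy μ ν k)) + ∑ K ∈ S, A (f K) (castE (opEnergy μ ν k)) *
            (sigmaRatio (∑ x ∈ f K, castE (opEnergy μ ν k) x) 1).subst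
              (∑ x, opVar m n (id : Fin s → Fin s) x))) :
    ∃ P : ParamPoly m n, IsChamberPolynomial s r c P ∧
      ∀ (μ : Fin m → ℤ) (ν : Fin n → ℤ) (k : ℤ), P.value μ ν k = (-1) ^ n *
        MvPowerSeries.coeff (fullExponent s r) (Q (castE (opEnergy μ ν k)) +
          ∑ K ∈ S, A (f K) (castE (opEnergy μ ν k)) *
            (sigmaRatio (∑ x ∈ f K, castE (opEnergy μ ν k) x) 1).subst
              (∑ x, opVar m n (id : Fin s → Fin s) x)) := by
  have hfam := hQ.add (IsPolyFam.sum S (F := fun K v => A (f K) v *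
    (sigmaRatio (∑ x ∈ f K, v x) 1).subst (∑ x, opVar m n (id : Fin s → Fin s) x)) fun K _ =>
      (hA (f K)).mul (IsPolyFam.sigmaRatio (IsPolyFun.blockSum (f K))
        (constantCoeff_blockSum (fun x => constantCoeff_opVar id x) Finset.univ)))
  obtain ⟨P, hP⟩ := ((IsPolyFun.const ((-1) ^ n)).mul (hfam (fullExponent s r))).exists_paramPoly
  refine ⟨P, fun μ ν k hq => ?_, hP⟩
  rw [hurwitzNumber_eq_of_vev r (hc.subset hq).1 (hvev μ ν k hq), hP]

theorem sum_opVar_eq_zSum (I : Finset (Fin m)) (K : Finset (Fin s)) (J : Finset (Fin n)) :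
    ∑ x ∈ opSet I K J, opVar m n (id : Fin s → Fin s) x = zSum K := by
  rw [sum_opVar]
  rfl

theorem constantCoeff_zSum (K : Finset (Fin s)) :
    MvPowerSeries.constantCoeff (zSum K : MvPowerSeries (Fin s) ℚ) = 0 := by
  simp [zSum]

/-- The first two quotients in the `ς`-factor invert the terminal value of the cut correlator; the
third is the value of the uncut pair. -/
theorem sigmaFactor_mul_cutFactor {δ : ℚ} (hδ : δ ≠ 0) (I : Finset (Fin m)) (K : Finset (Fin s))
    (J : Finset (Fin n)) : sigmaFactor δ K * cutFactor (opVar m n id) δ (opSet I K J) =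
      (sigmaRatio δ 1).subst (∑ x, opVar m n (id : Fin s → Fin s) x) := by
  have h : ∀ K : Finset (Fin s), (sigmaRatio 1 δ).subst (zSum K) * (sigmaRatio δ 1).subst (zSum K) =
      (1 : MvPowerSeries (Fin s) ℚ) := fun K => by
    rw [← PowerSeries.subst_mul (hasSubst_of (constantCoeff_zSum K)),
      sigmaRatio_mul_inv one_ne_zero hδ, ← PowerSeries.coe_substAlgHom
      (hasSubst_of (constantCoeff_zSum K)), map_one]
  unfold sigmaFactor cutFactor
  rw [opSet_compl, sum_opVar_eq_zSum, sum_opVar_eq_zSum, ← opSet_univ, sum_opVar_eq_zSum]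
  linear_combination (sigmaRatio δ 1).subst (zSum (Finset.univ : Finset (Fin s))) *
    ((sigmaRatio 1 δ).subst (zSum Kᶜ) * (sigmaRatio δ 1).subst (zSum Kᶜ) * h K + h Kᶜ)

/-- The contribution of a single set `K` to the wall crossing. -/
theorem wallCrossing_term {μ : Fin m → ℤ} {ν : Fin n → ℤ} {k : ℤ}
    (h : latticePoint μ ν k ∈ paramSpace m n s) (K : Finset (Fin s))
    (hδ : 0 < delta I J K.card μ ν k) {B : MvPowerSeries (Fin s) ℚ}
    (hB : listWeight (bosons m n s) (castE (opEnergy μ ν k)) (allBlocks m n s) •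
      (B * cutFactor (opVar m n id) (delta I J K.card μ ν k : ℚ) (opSet I K J)) =
      cutVev (opVar m n id) (opEnergy μ ν k) (opSet I K J) (allBlocks m n s)) :
    ((delta I J K.card μ ν k : ℚ) ^ 2) • (sigmaFactor (delta I J K.card μ ν k : ℚ) K *
      hurwitzSeries (parts μ I) (parts ν J ++ [delta I J K.card μ ν k]) k (K.sort (· ≤ ·)) *
      hurwitzSeries (delta I J K.card μ ν k :: parts μ Iᶜ) (parts ν Jᶜ) k (Kᶜ.sort (· ≤ ·))) =
    ((-1 : ℚ) ^ n) • (B * (sigmaRatio (delta I J K.card μ ν k : ℚ) 1).subst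
      (∑ x, opVar m n (id : Fin s → Fin s) x)) := by
  have hδ' : ((delta I J K.card μ ν k : ℤ) : ℚ) ≠ 0 := by exact_mod_cast hδ.ne'
  obtain ⟨h1, h2⟩ := prod_ne_zero_of_mem h
  have hprodμ : ∀ A : Finset (Fin m), ((∏ i ∈ A, μ i : ℤ) : ℚ) ≠ 0 := fun A => by
    rw [Int.cast_prod]
    exact Finset.prod_ne_zero_iff.2 fun i _ => h1 i
  have hprodν : ∀ A : Finset (Fin n), ((∏ j ∈ A, ν j : ℤ) : ℚ) ≠ 0 := fun A => by
    rw [Int.cast_prod]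
    exact Finset.prod_ne_zero_iff.2 fun i _ => h2 i
  have hcut : cutVev (opVar m n id) (opEnergy μ ν k) (opSet I K J) (allBlocks m n s) =
      leftVev (opVar m n id) (opEnergy μ ν k) (opSet I K J) (allBlocks m n s) *
      rightVev (opVar m n id) (opEnergy μ ν k) (opSet I K J) (allBlocks m n s) :=
    if_pos (allBlocks_subset_or I K J)
  have hkey : sigmaFactor (delta I J K.card μ ν k : ℚ) K *
      leftVev (opVar m n id) (opEnergy μ ν k) (opSet I K J) (allBlocks m n s) *
      rightVev (opVar m n id) (opEnergy μ ν k) (opSet I K J) (allBlocks m n s) =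
      listWeight (bosons m n s) (castE (opEnergy μ ν k)) (allBlocks m n s) •
        (B * (sigmaRatio (delta I J K.card μ ν k : ℚ) 1).subst
          (∑ x, opVar m n (id : Fin s → Fin s) x)) := by
    rw [mul_assoc, ← hcut, ← hB, mul_smul_comm, mul_left_comm, sigmaFactor_mul_cutFactor hδ']
  rw [hurwitzSeries_left, hurwitzSeries_right]
  simp only [mul_smul_comm, smul_mul_assoc, hkey]
  rw [listWeight_allBlocks]
  simp only [smul_smul]
  rw [← Finset.prod_mul_prod_compl I μ, ← Finset.prod_mul_prod_compl J ν, Int.cast_mul,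
    Int.cast_mul]
  -- The factor `δ ^ 2` cancels the part `δ` in the prefactors of both series, and the remaining
  -- parts recombine to the products over all `μ_i` and `ν_j`.
  congr 1
  have e1 := hprodμ I
  have e2 := hprodμ Iᶜ
  have e3 := hprodν J
  have e4 := hprodν Jᶜ
  field_simp

theorem sum_opEnergy_castE {μ : Fin m → ℤ} {ν : Fin n → ℤ} {k : ℤ} (K : Finset (Fin s)) :
    ∑ x ∈ opSet I K J, castE (opEnergy μ ν k) x = (delta I J K.card μ ν k : ℚ) := by
  rw [sum_castE, sum_opEnergy]

/-- Wall crossing in terms of the wall crossing series. -/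
theorem wallCrossing {c₁ c₂ : Set (Ambient m n)} (r : ℕ) (ht : t ≤ s)
    (hempty : ¬(I = ∅ ∧ J = ∅)) (hfull : ¬(I = Finset.univ ∧ J = Finset.univ))
    (hc : BorderWall s I J t c₁ c₂) :
    (∃ P₁ : ParamPoly m n, IsChamberPolynomial s r c₁ P₁) ∧
    (∃ P₂ : ParamPoly m n, IsChamberPolynomial s r c₂ P₂) ∧
    ∀ P₁ P₂ : ParamPoly m n, IsChamberPolynomial s r c₁ P₁ → IsChamberPolynomial s r c₂ P₂ →
      ∀ (μ : Fin m → ℤ) (ν : Fin n → ℤ) (k : ℤ), latticePoint μ ν k ∈ c₁ →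
        P₁.value μ ν k - P₂.value μ ν k = MvPowerSeries.coeff (fullExponent s r)
            (wallCrossingSeries s I J t μ ν k) := by
  classical
  obtain ⟨hc₁, hc₂, hpos, hneg, p, hpw, hp1, hp2, huniq⟩ := hc
  have hp : IsFacePoint s I J t p := ⟨ht, hempty, hfull, hpw, huniq⟩
  -- These data depend on `p` only and serve both chambers.
  obtain ⟨Q, A, hQ, hA, hres⟩ := hp.resolves
  set S : Finset (Finset (Fin s)) := Finset.univ.filter fun K => K.card = t with hS
  have hcard : ∀ K ∈ S, K.card = t := fun K hK => (Finset.mem_filter.1 hK).2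
  have hmemS : ∀ K : Finset (Fin s), K.card = t → K ∈ S := fun K hK =>
    Finset.mem_filter.2 ⟨Finset.mem_univ _, hK⟩
  have hcomp₁ := fun {μ : Fin m → ℤ} {ν : Fin n → ℤ} {k : ℤ} (h : latticePoint μ ν k ∈ c₁) =>
    hc₁.compatible hpw.1 hp1 h
  have hcomp₂ := fun {μ : Fin m → ℤ} {ν : Fin n → ℤ} {k : ℤ} (h : latticePoint μ ν k ∈ c₂) =>
    hc₂.compatible hpw.1 hp2 h
  have hδ₁ : ∀ {μ : Fin m → ℤ} {ν : Fin n → ℤ} {k : ℤ}, latticePoint μ ν k ∈ c₁ →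
      0 < delta I J t μ ν k := by
    intro μ ν k h
    have := hpos _ h
    rw [wallForm_latticePoint] at this
    exact_mod_cast this
  have hδ₂ : ∀ {μ : Fin m → ℤ} {ν : Fin n → ℤ} {k : ℤ}, latticePoint μ ν k ∈ c₂ →
      delta I J t μ ν k < 0 := by
    intro μ ν k h
    have := hneg _ h
    rw [wallForm_latticePoint] at this
    exact_mod_cast this
  have hinj : Function.Injective fun K : Finset (Fin s) => opSet I K J := fun K K' h =>
    (opSet_inj.1 h).2.1
  have hinj' : Function.Injective fun K : Finset (Fin s) => (opSet I K J)ᶜ := fun K K' h =>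
    hinj (compl_injective h)
  obtain ⟨R₁, hR₁, hR₁v⟩ := isChamberPolynomial_of_resolves r hc₁ hQ hA (S := S)
    (f := fun K => opSet I K J) (fun μ ν k h => by
      rw [(hres _ (hcomp₁ h)).1, sum_zeroSets_eq (p := pointEnergy p) _ _
        (fun T => A T (castE (opEnergy μ ν k))) S (fun K => opSet I K J) hinj
        (fun K hK => hp.opSet_mem_zeroSets (hcard K hK))
        (fun K hK => by rw [sum_opEnergy, hcard K hK]; exact hδ₁ h)]
      intro T hT hne
      rcases hp.eq_opSet_or hT with ⟨K, hK, rfl⟩ | ⟨K, hK, rfl⟩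
      · exact absurd rfl (hne K (hmemS K hK))
      · rw [sum_compl_eq_neg (hcomp₁ h).sum_eq, sum_opEnergy, hK]
        have := hδ₁ h
        omega)
  obtain ⟨R₂, hR₂, hR₂v⟩ := isChamberPolynomial_of_resolves r hc₂ hQ hA (S := S)
    (f := fun K => (opSet I K J)ᶜ) (fun μ ν k h => by
      rw [(hres _ (hcomp₂ h)).1, sum_zeroSets_eq (p := pointEnergy p) _ _
        (fun T => A T (castE (opEnergy μ ν k))) S (fun K => (opSet I K J)ᶜ) hinj'
        (fun K hK => compl_mem_zeroSets (sum_pointEnergy_univ hpw.1)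
          (hp.opSet_mem_zeroSets (hcard K hK)))
        (fun K hK => by
          rw [sum_compl_eq_neg (hcomp₂ h).sum_eq, sum_opEnergy, hcard K hK]
          have := hδ₂ h
          omega)]
      intro T hT hne
      rcases hp.eq_opSet_or hT with ⟨K, hK, rfl⟩ | ⟨K, hK, rfl⟩
      · rw [sum_opEnergy, hK]
        exact hδ₂ h
      · exact absurd rfl (hne K (hmemS K hK)))
  refine ⟨⟨R₁, hR₁⟩, ⟨R₂, hR₂⟩, fun P₁ P₂ hP₁ hP₂ μ ν k hq => ?_⟩
  have hlat := (hc₁.subset hq).1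
  have e1 : P₁.value μ ν k = R₁.value μ ν k := (hP₁ μ ν k hq).symm.trans (hR₁ μ ν k hq)
  -- The point lies in `c₁`, whereas `P₂` and `R₂` are known to agree only on `c₂`. Agreement
  -- extends to all lattice points with the required total, although the polynomials may differ off
  -- this hyperplane.
  have e2 : P₂.value μ ν k = R₂.value μ ν k := by
    obtain ⟨a₀⟩ : Nonempty (Fin m ⊕ Fin n) := by
      by_contra hcon
      rw [not_nonempty_iff, isEmpty_sum] at hcon
      obtain ⟨h1, h2⟩ := hcon
      exact hempty ⟨Finset.eq_empty_of_isEmpty I, Finset.eq_empty_of_isEmpty J⟩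
    have hval : ∀ μ ν k, (P₂ - R₂ : ParamPoly m n).value μ ν k = P₂.value μ ν k - R₂.value μ ν k :=
      fun μ ν k => map_sub _ _ _
    have := hc₂.value_eq_zero a₀ (D := P₂ - R₂) (fun μ ν k h => by
      rw [hval, sub_eq_zero]
      exact (hP₂ μ ν k h).symm.trans (hR₂ μ ν k h)) μ ν k (sum_eq_of_mem_paramSpace hlat)
    rwa [hval, sub_eq_zero] at this
  rw [e1, e2, hR₁v, hR₂v, ← mul_sub, ← map_sub, add_sub_add_left_eq_sub, ← Finset.sum_sub_distrib,
    wallCrossingSeries, ← smul_eq_mul, ← map_smul, Finset.smul_sum]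
  congr 1
  refine Finset.sum_congr rfl fun K hK => ?_
  obtain rfl := hcard K hK
  rw [wallCrossing_term hlat K (hδ₁ hq) (B := A (opSet I K J) (castE (opEnergy μ ν k)) +
    A (opSet I K J)ᶜ (castE (opEnergy μ ν k)))]
  -- The complement has energy `-δ`, and oddness of the ratio turns the difference of the two sides
  -- into a sum.
  · have hsum : ∑ x ∈ (opSet I K J)ᶜ, castE (opEnergy μ ν k) x = -(delta I J K.card μ ν k : ℚ) := by
      rw [sum_castE, sum_compl_eq_neg (hcomp₁ hq).sum_eq, sum_opEnergy, Int.cast_neg]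
    rw [hsum, sum_opEnergy_castE, sigmaRatio_neg, ← neg_one_smul ℚ (sigmaRatio _ _),
      PowerSeries.subst_smul (hasSubst_of
        (constantCoeff_blockSum (fun x => constantCoeff_opVar id x) Finset.univ)), neg_one_smul,
      mul_neg, sub_neg_eq_add, add_mul]
  · have := (hres _ (hcomp₁ hq)).2 _ (hp.opSet_mem_zeroSets rfl)
    rw [sum_opEnergy] at this
    exact this (hδ₁ hq)

end WallCrossing

/-! ### Orders of vacuum expectation values -/

section Order

variable {ι σ : Type*}

theorem one_le_order_blockComm {z : ι → MvPowerSeries σ ℚ}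
    (hz : ∀ x, MvPowerSeries.constantCoeff (z x) = 0) (v : ι → ℚ) (R N : Finset ι) :
    1 ≤ (blockComm z v R N).order := by
  have h := constantCoeff_blockComm_arg hz (∑ x ∈ R, v x) (∑ x ∈ N, v x) R N
  rw [MvPowerSeries.one_le_order_iff_constCoeff_eq_zero]
  unfold blockComm
  rw [sigma_subst_eq_mul h, map_mul, h, zero_mul]

theorem blockProd_congr {z z' : ι → MvPowerSeries σ ℚ} {e : ι → ℤ} {L : List (Finset ι)}
    (h : ∀ B ∈ L, ∀ x ∈ B, z x = z' x) : blockProd z e L = blockProd z' e L := by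
  unfold blockProd
  congr 1
  refine List.map_congr_left fun B hB => ?_
  unfold blockOp
  rw [Finset.sum_congr rfl (h B hB)]

/-- The variables `z`, restricted to `T`. -/
def restrictVar [DecidableEq ι] (z : ι → MvPowerSeries σ ℚ) (T : Finset ι) (x : ι) : MvPowerSeries σ ℚ :=
  if x ∈ T then z x else 0

theorem constantCoeff_restrictVar [DecidableEq ι] {z : ι → MvPowerSeries σ ℚ}
    (hz : ∀ x, MvPowerSeries.constantCoeff (z x) = 0) (T : Finset ι) (x : ι) :
    MvPowerSeries.constantCoeff (restrictVar z T x) = 0 := by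
  unfold restrictVar
  split_ifs
  exacts [hz x, map_zero _]

theorem blockProd_restrictVar [DecidableEq ι] (z : ι → MvPowerSeries σ ℚ) (e : ι → ℤ) {T : Finset ι}
    {L : List (Finset ι)} (hL : ∀ B ∈ L, B ⊆ T) :
    blockProd (restrictVar z T) e L = blockProd z e L :=
  blockProd_congr fun B hB _ hx => if_pos (hL B hB hx)

variable [Fintype ι] [DecidableEq ι]

theorem IsPart.union_ne_univ {R N : Finset ι} {pre post : List (Finset ι)}
    (h : IsPart Finset.univ (pre ++ R :: N :: post)) (hlen : pre ++ post ≠ []) :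
    R ∪ N ≠ Finset.univ := by
  have hperm : (pre ++ R :: N :: post).Perm (R :: N :: (pre ++ post)) :=
    List.perm_middle.trans (List.Perm.cons _ List.perm_middle)
  obtain ⟨C, L', hC⟩ := List.exists_cons_of_ne_nil hlen
  obtain ⟨x, hx⟩ := h.1 C (hperm.mem_iff.2 (by rw [hC]; simp))
  rw [hC] at hperm
  have hRC : Disjoint R C := ((h.perm hperm).perm (List.Perm.cons _ (List.Perm.swap _ _ _))).disjoint
  have hNC : Disjoint N C := ((h.perm hperm).perm
    ((List.Perm.swap _ _ _).trans (List.Perm.cons _ (List.Perm.swap _ _ _)))).disjoint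
  intro hu
  exact Finset.disjoint_left.1 (Finset.disjoint_union_left.2 ⟨hRC, hNC⟩)
    (hu ▸ Finset.mem_univ x) hx

/-- For energies without vanishing partial sums, each operator beyond the second one contributes
at least one to the order of the vacuum expectation value. -/
theorem le_order_vev_blockProd {z : ι → MvPowerSeries σ ℚ}
    (hz : ∀ x, MvPowerSeries.constantCoeff (z x) = 0) {e : ι → ℤ} (he : ∑ x, e x = 0)
    (hne : ∀ B : Finset ι, B.Nonempty → B ≠ Finset.univ → ∑ x ∈ B, e x ≠ 0) (n : ℕ) :
    ∀ L : List (Finset ι), L.length = n + 2 → IsPart Finset.univ L →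
      (n : ℕ∞) ≤ (vev _ (blockProd z e L)).order := by
  induction n with
  | zero => exact fun _ _ _ => zero_le
  | succ n ih =>
    intro L hlen hpart
    -- Here the energies themselves play the role of the point on the wall; no proper partial sum
    -- vanishes, so the condition on zero sets is vacuous apart from the full set.
    obtain ⟨R, hRL, hR⟩ := exists_pos_block (p := fun x => (e x : ℝ)) (by exact_mod_cast he)
      (fun B C hB _ _ hB0 _ => by
        by_contra hcon
        refine hne B hB ?_ (by exact_mod_cast hB0)
        rintro rfl
        exact hcon (Finset.eq_univ_of_forall fun x => by simp)) hpart (by omega)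
    replace hR : 0 < ∑ x ∈ R, e x := by exact_mod_cast hR
    obtain ⟨pre, post, rfl⟩ := List.append_of_mem hRL
    clear hRL
    induction post generalizing pre with
    | nil =>
      have : vev _ (blockProd z e (pre ++ [R])) = 0 := by
        rw [blockProd_append, blockProd_cons, blockProd_nil, mul_one]
        exact vev_mul_eq_zero (calE_vac hR _)
      rw [this, MvPowerSeries.order_zero]
      exact le_top
    | cons N post ih' =>
      have hperm : (pre ++ R :: N :: post).Perm (pre ++ N :: R :: post) :=
        List.Perm.append_left pre (List.Perm.swap N R post)
      have hdisj : Disjoint R N :=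
        (hpart.perm (List.perm_middle.trans (List.Perm.cons _ List.perm_middle))).disjoint
      have hRne : R.Nonempty := hpart.1 R (by simp)
      have hNne : N.Nonempty := hpart.1 N (by simp)
      simp only [List.length_append, List.length_cons] at hlen
      have hU := hpart.union_ne_univ (by
        rw [← List.length_pos_iff, List.length_append]
        omega)
      have hsub : ∀ B : Finset ι, B ⊆ R ∪ N → B ≠ Finset.univ := by
        rintro B hB rfl
        exact hU (Finset.univ_subset_iff.1 hB)
      rw [blockProd_swap hz hdisj (hne R hRne (hsub R Finset.subset_union_left))
        (hne N hNne (hsub N Finset.subset_union_right))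
        (hne _ (hRne.mono Finset.subset_union_left) hU), vev_add, vev_smul]
      refine le_trans (le_min ?_ ?_) MvPowerSeries.min_order_le_add
      · have := ih' (pre ++ [N]) (by simp; omega) (by simpa using hpart.perm hperm)
        simpa using this
      -- A merge loses one operator, and the commutator, having no constant term, makes up for it.
      · refine le_trans ?_ MvPowerSeries.le_order_mul
        rw [Nat.cast_add, add_comm, Nat.cast_one]
        refine add_le_add (one_le_order_blockComm hz _ _ _) (ih _ ?_ (hpart.merge hdisj))
        simp only [List.length_append, List.length_cons]
        omega

theorem IsPart.concat_compl {T : Finset ι} {L : List (Finset ι)} (hL : IsPart T L)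
    (hT : T ≠ Finset.univ) : IsPart Finset.univ (L ++ [Tᶜ]) := by
  refine ⟨fun B hB => ?_, ?_⟩
  · rw [List.mem_append, List.mem_singleton] at hB
    rcases hB with hB | rfl
    · exact hL.1 B hB
    · rwa [Finset.nonempty_iff_ne_empty, Ne, Finset.compl_eq_empty_iff]
  · rw [List.map_append, List.sum_append, hL.2, List.map_singleton, List.sum_singleton,
      ← Finset.union_compl T, ← Finset.disjUnion_eq_union T Tᶜ disjoint_compl_right]
    rfl

/-- The boson added at a cut is itself a block, for variables restricted to one side. Each side of
the cut is therefore a correlator over the full index set, and the order bound applies to it. -/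
theorem blockOp_restrictVar_compl (z : ι → MvPowerSeries σ ℚ) (e : ι → ℤ) (T : Finset ι) :
    blockOp (restrictVar z T) e Tᶜ = alpha (∑ x ∈ Tᶜ, e x) := by
  unfold blockOp
  rw [alpha_eq, Finset.sum_eq_zero (f := restrictVar z T) fun x hx =>
    if_neg (Finset.mem_compl.1 hx)]

/-- The order of the vacuum expectation value on the first side of a cut. -/
theorem le_order_leftVev {z : ι → MvPowerSeries σ ℚ}
    (hz : ∀ x, MvPowerSeries.constantCoeff (z x) = 0) {e : ι → ℤ} (he : ∑ x, e x = 0)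
    (hne : ∀ B : Finset ι, B.Nonempty → B ≠ Finset.univ → ∑ x ∈ B, e x ≠ 0) {T : Finset ι}
    (hT : T ≠ Finset.univ) {L : List (Finset ι)} (hL : IsPart T (L.filter (· ⊆ T))) {n : ℕ}
    (hn : (L.filter (· ⊆ T)).length = n + 1) : (n : ℕ∞) ≤ (leftVev z e T L).order := by
  have h := le_order_vev_blockProd (constantCoeff_restrictVar hz T) he hne n _
    (by simp [hn]) (hL.concat_compl hT)
  rw [blockProd_append, blockProd_restrictVar z e (fun B => hL.subset), blockProd_cons,
    blockProd_nil, mul_one, blockOp_restrictVar_compl, sum_compl_eq_neg he] at h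
  exact h

/-- The order of the vacuum expectation value on the second side of a cut. -/
theorem le_order_rightVev {z : ι → MvPowerSeries σ ℚ}
    (hz : ∀ x, MvPowerSeries.constantCoeff (z x) = 0) {e : ι → ℤ} (he : ∑ x, e x = 0)
    (hne : ∀ B : Finset ι, B.Nonempty → B ≠ Finset.univ → ∑ x ∈ B, e x ≠ 0) {T : Finset ι}
    (hT : T.Nonempty) {L : List (Finset ι)} (hL : IsPart Tᶜ (L.filter (· ⊆ Tᶜ))) {n : ℕ}
    (hn : (L.filter (· ⊆ Tᶜ)).length = n + 1) : (n : ℕ∞) ≤ (rightVev z e T L).order := by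
  have h := le_order_vev_blockProd (constantCoeff_restrictVar hz Tᶜ) he hne n
    (T :: L.filter (· ⊆ Tᶜ)) (by simp [hn]) (by
      have := hL.concat_compl (by rw [Ne, Finset.compl_eq_univ_iff]; exact hT.ne_empty)
      rw [compl_compl] at this
      exact this.perm (List.perm_append_singleton _ _))
  have h2 := blockOp_restrictVar_compl z e Tᶜ
  rw [compl_compl] at h2
  rw [blockProd_cons, blockProd_restrictVar z e (fun B => hL.subset), h2] at h
  exact h

end Order

/-! ### Renaming variables -/

section Naturality

variable {R R' : Type*} [CommRing R] [CommRing R']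

/-- The map on Fock spaces induced by a ring homomorphism. -/
def mapFock (φ : R →+* R') : Fock R →+ Fock R' := Finsupp.mapRange.addMonoidHom φ.toAddMonoidHom

theorem mapFock_single (φ : R →+* R') (S : Maya) (r : R) :
    mapFock φ (Finsupp.single S r) = Finsupp.single S (φ r) := by
  simp [mapFock]

theorem mapFock_smul (φ : R →+* R') (r : R) (v : Fock R) :
    mapFock φ (r • v) = φ r • mapFock φ v := by
  ext S
  simp [mapFock]

theorem mapFock_injective {φ : R →+* R'} (hφ : Function.Injective φ) :
    Function.Injective (mapFock φ) := by
  intro v w h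
  ext S
  have := DFunLike.congr_fun h S
  simpa [mapFock, hφ.eq_iff] using this

/-- `B` is the image of `A` under a change of the ring of coefficients. -/
def Intertwines (φ : R →+* R') (A : Module.End R (Fock R)) (B : Module.End R' (Fock R')) : Prop :=
  ∀ v, mapFock φ (A v) = B (mapFock φ v)

theorem intertwines_of_single {φ : R →+* R'} {A : Module.End R (Fock R)}
    {B : Module.End R' (Fock R')}
    (h : ∀ S : Maya, mapFock φ (A (Finsupp.single S 1)) = B (Finsupp.single S 1)) :
    Intertwines φ A B := by
  intro v
  induction v using Finsupp.induction_linear with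
  | zero => simp
  | add v w hv hw => rw [map_add, map_add, map_add, map_add, hv, hw]
  | single S r =>
    rw [single_eq_smul, map_smul, mapFock_smul, mapFock_smul, map_smul, h, mapFock_single, map_one]

theorem Intertwines.mul {φ : R →+* R'} {A C : Module.End R (Fock R)}
    {B D : Module.End R' (Fock R')} (h : Intertwines φ A B) (h' : Intertwines φ C D) :
    Intertwines φ (A * C) (B * D) := fun v => by
  rw [Module.End.mul_apply, Module.End.mul_apply, h, h']

theorem Intertwines.list_prod {α : Type*} {φ : R →+* R'} {f : α → Module.End R (Fock R)}
    {g : α → Module.End R' (Fock R')} (h : ∀ a, Intertwines φ (f a) (g a)) (l : List α) :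
    Intertwines φ (l.map f).prod (l.map g).prod := by
  induction l with
  | nil => exact fun _ => rfl
  | cons a l ih =>
    rw [List.map_cons, List.map_cons, List.prod_cons, List.prod_cons]
    exact (h a).mul ih

theorem Intertwines.vev {φ : R →+* R'} {A : Module.End R (Fock R)}
    {B : Module.End R' (Fock R')} (h : Intertwines φ A B) :
    φ (LeakyHurwitz.vev R A) = LeakyHurwitz.vev R' B := by
  have := DFunLike.congr_fun (h (Finsupp.single Maya.vacuum 1)) Maya.vacuum
  rw [mapFock_single, map_one] at this
  exact this

theorem intertwines_psi (φ : R →+* R') (a : ℤ) : Intertwines φ (psi R a) (psi R' a) := by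
  classical
  refine intertwines_of_single fun S => ?_
  rw [psi_single, psi_single]
  split_ifs
  · exact map_zero _
  · rw [mapFock_single, map_intCast]

theorem intertwines_psiDag (φ : R →+* R') (a : ℤ) : Intertwines φ (psiDag R a) (psiDag R' a) := by
  classical
  refine intertwines_of_single fun S => ?_
  rw [psiDag_single, psiDag_single]
  split_ifs
  · rw [mapFock_single, map_intCast]
  · exact map_zero _

theorem intertwines_normalE (φ : R →+* R') (i j : ℤ) :
    Intertwines φ (normalE R i j) (normalE R' i j) := by
  unfold normalE
  split_ifs
  · exact (intertwines_psi φ i).mul (intertwines_psiDag φ j)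
  · intro v
    rw [LinearMap.neg_apply, LinearMap.neg_apply, map_neg,
      ((intertwines_psiDag φ j).mul (intertwines_psi φ i)) v]

end Naturality

/-! ### Renaming variables, and coefficients of products -/

section Rename

variable {σ τ : Type*}

theorem rename_expS (e : σ ↪ τ) {z : MvPowerSeries σ ℚ}
    (hz : MvPowerSeries.constantCoeff z = 0) :
    MvPowerSeries.rename e (expS z) = expS (MvPowerSeries.rename e z) := by
  rw [MvPowerSeries.rename_eq_subst, MvPowerSeries.rename_eq_subst]
  exact mv_subst_comp_powerSeries (hasSubst_of hz) (MvPowerSeries.HasSubst.X_comp e) _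

theorem intertwines_calE (e : σ ↪ τ) (n : ℤ) {z : MvPowerSeries σ ℚ}
    (hz : MvPowerSeries.constantCoeff z = 0) :
    Intertwines (MvPowerSeries.rename (R := ℚ) e).toRingHom (calE n z)
      (calE n (MvPowerSeries.rename e z)) := by
  have hinj : Function.Injective (MvPowerSeries.rename (R := ℚ) e).toRingHom :=
    MvPowerSeries.rename_injective e
  refine intertwines_of_single fun S => ?_
  unfold calE
  rw [Finsupp.linearCombination_single, Finsupp.linearCombination_single, one_smul, one_smul,
    -- Injectivity of the renaming spares a proof that the sum is finite.
    AddMonoidHom.map_finsum_of_injective _ (mapFock_injective hinj)]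
  refine finsum_congr fun a => ?_
  rw [mapFock_smul, intertwines_normalE, mapFock_single, map_one]
  congr 1
  change MvPowerSeries.rename e _ = _
  rw [rename_expS e (constantCoeff_smul_eq_zero hz _), map_smul]

/-- Allows a series in the variables `z_K` to be read as one in `|K|` variables, so that its
coefficient is a Hurwitz number. -/
theorem hurwitzSeries_map (e : σ ↪ τ) (μ ν : List ℤ) (k : ℤ) (K : List σ) :
    hurwitzSeries μ ν k (K.map e) = MvPowerSeries.rename e (hurwitzSeries μ ν k K) := by
  have h0 : ∀ n : ℤ, Intertwines (MvPowerSeries.rename (R := ℚ) e).toRingHom (alpha n) (alpha n) :=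
    fun n => by
      have := intertwines_calE e n (map_zero (MvPowerSeries.constantCoeff (σ := σ) (R := ℚ)))
      rwa [map_zero] at this
  have h1 : ∀ p : σ, Intertwines (MvPowerSeries.rename (R := ℚ) e).toRingHom
      (calE (-k) (MvPowerSeries.X p)) (calE (-k) (MvPowerSeries.X (e p))) := fun p => by
    have := intertwines_calE e (-k) (z := MvPowerSeries.X p) (by simp)
    rwa [MvPowerSeries.rename_X] at this
  have h := (((Intertwines.list_prod h0 μ).mul (Intertwines.list_prod h1 K)).mul
    (Intertwines.list_prod (fun b => h0 (-b)) ν)).vev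
  unfold hurwitzSeries
  rw [map_smul, List.map_map]
  congr 1
  exact h.symm

/-- The two factors have no variable in common, so the exponent splits in only one way. -/
theorem coeff_rename_mul_rename {υ : Type*} (e : σ ↪ υ) (f : τ ↪ υ)
    (h : Disjoint (Set.range e) (Set.range f)) (p : MvPowerSeries σ ℚ) (q : MvPowerSeries τ ℚ)
    (c : σ →₀ ℕ) (d : τ →₀ ℕ) :
    MvPowerSeries.coeff (c.embDomain e + d.embDomain f)
      (MvPowerSeries.rename e p * MvPowerSeries.rename f q) =
      MvPowerSeries.coeff c p * MvPowerSeries.coeff d q := by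
  classical
  rw [MvPowerSeries.coeff_mul, Finset.sum_eq_single (c.embDomain e, d.embDomain f),
    MvPowerSeries.coeff_embDomain_rename, MvPowerSeries.coeff_embDomain_rename]
  · rintro ⟨x, y⟩ hxy hne
    by_contra hcon
    obtain ⟨h1, h2⟩ := mul_ne_zero_iff.1 hcon
    obtain ⟨x', rfl⟩ : x ∈ Set.range (Finsupp.mapDomain e) := by
      by_contra hx
      exact h1 (MvPowerSeries.coeff_rename_eq_zero _ _ hx)
    obtain ⟨y', rfl⟩ : y ∈ Set.range (Finsupp.mapDomain f) := by
      by_contra hx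
      exact h2 (MvPowerSeries.coeff_rename_eq_zero _ _ hx)
    rw [← Finsupp.embDomain_eq_mapDomain, ← Finsupp.embDomain_eq_mapDomain,
      Finset.HasAntidiagonal.mem_antidiagonal] at hxy
    have hx : x' = c := by
      ext a
      have := DFunLike.congr_fun hxy (e a)
      have ha : e a ∉ Set.range f := Set.disjoint_left.1 h ⟨a, rfl⟩
      simpa [Finsupp.embDomain_of_notMem_range _ _ _ ha] using this
    have hy : y' = d := by
      ext a
      have := DFunLike.congr_fun hxy (f a)
      have ha : f a ∉ Set.range e := Set.disjoint_right.1 h ⟨a, rfl⟩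
      simpa [Finsupp.embDomain_of_notMem_range _ _ _ ha] using this
    rw [hx, hy, Finsupp.embDomain_eq_mapDomain, Finsupp.embDomain_eq_mapDomain] at hne
    exact hne rfl
  · intro hcon
    exact absurd (Finset.HasAntidiagonal.mem_antidiagonal.2
      (rfl : (c.embDomain e, d.embDomain f).1 + (c.embDomain e, d.embDomain f).2 = _)) hcon

/-- Every other splitting of `d` leaves for `g` an exponent of degree below its order. -/
theorem coeff_mul_eq_of_le_order {f g : MvPowerSeries σ ℚ} {d : σ →₀ ℕ}
    (h : (d.degree : ℕ∞) ≤ g.order) :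
    MvPowerSeries.coeff d (f * g) = MvPowerSeries.constantCoeff f * MvPowerSeries.coeff d g := by
  classical
  rw [MvPowerSeries.coeff_mul, Finset.sum_eq_single (0, d), MvPowerSeries.coeff_zero_eq_constantCoeff]
  · rintro ⟨x, y⟩ hxy hne
    rw [Finset.HasAntidiagonal.mem_antidiagonal] at hxy
    have hx : x ≠ 0 := by
      rintro rfl
      simp_all
    have hdeg : y.degree < d.degree := by
      rw [← hxy]
      change y.degree < (x + y).degree
      rw [map_add]
      have : x.degree ≠ 0 := by rwa [Ne, Finsupp.degree_eq_zero_iff]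
      omega
    rw [MvPowerSeries.coeff_of_lt_order (f := g) (d := y)
      (lt_of_lt_of_le (by exact_mod_cast hdeg) h), mul_zero]
  · intro hcon
    exact absurd (Finset.HasAntidiagonal.mem_antidiagonal.2 (zero_add d)) hcon

end Rename

/-! ### Genus zero -/

section GenusZero

variable {m n s t : ℕ} {I : Finset (Fin m)} {J : Finset (Fin n)}

theorem constantCoeff_subst {σ : Type*} {u : MvPowerSeries σ ℚ}
    (hu : MvPowerSeries.constantCoeff u = 0) (f : PowerSeries ℚ) :
    MvPowerSeries.constantCoeff (f.subst u) = PowerSeries.constantCoeff f := by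
  rw [← MvPowerSeries.coeff_zero_eq_constantCoeff_apply, coeff_powerSeries_subst hu]
  simp

theorem constantCoeff_sigmaRatio (a b : ℚ) : PowerSeries.constantCoeff (sigmaRatio a b) = a / b := by
  unfold sigmaRatio
  rw [← PowerSeries.coeff_zero_eq_constantCoeff_apply, PowerSeries.coeff_smul,
    PowerSeries.coeff_zero_eq_constantCoeff_apply, map_mul, PowerSeries.constantCoeff_inv,
    constantCoeff_rescale_sinhc, constantCoeff_rescale_sinhc]
  simp

theorem constantCoeff_sigmaFactor {δ : ℚ} (hδ : δ ≠ 0) (K : Finset (Fin s)) :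
    MvPowerSeries.constantCoeff (sigmaFactor δ K) = δ⁻¹ := by
  unfold sigmaFactor
  rw [map_mul, map_mul, constantCoeff_subst (constantCoeff_zSum _),
    constantCoeff_subst (constantCoeff_zSum _), constantCoeff_subst (constantCoeff_zSum _),
    constantCoeff_sigmaRatio, constantCoeff_sigmaRatio]
  field_simp

theorem degree_fullExponent (s r : ℕ) : (fullExponent s r).degree = s * (r + 1) := by
  rw [Finsupp.degree_eq_sum]
  simp [fullExponent]

theorem fullExponent_apply (s r : ℕ) (i : Fin s) : fullExponent s r i = r + 1 := rfl

theorem embDomain_fullExponent_add {K : Finset (Fin s)} (hK : K.card = t)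
    (hK' : Kᶜ.card = s - t) (r : ℕ) :
    (fullExponent t r).embDomain (K.orderEmbOfFin hK).toEmbedding +
      (fullExponent (s - t) r).embDomain (Kᶜ.orderEmbOfFin hK').toEmbedding =
      fullExponent s r := by
  have hin : ∀ {u : ℕ} {A : Finset (Fin s)} (hA : A.card = u) {i : Fin s}, i ∈ A →
      (fullExponent u r).embDomain (A.orderEmbOfFin hA).toEmbedding i = r + 1 := by
    intro u A hA i hi
    rw [← Finset.mem_coe, ← Finset.range_orderEmbOfFin A hA] at hi
    obtain ⟨a, rfl⟩ := hi
    exact Finsupp.embDomain_apply_self _ _ _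
  have hout : ∀ {u : ℕ} {A : Finset (Fin s)} (hA : A.card = u) {i : Fin s}, i ∉ A →
      (fullExponent u r).embDomain (A.orderEmbOfFin hA).toEmbedding i = 0 := by
    intro u A hA i hi
    rw [← Finset.mem_coe, ← Finset.range_orderEmbOfFin A hA] at hi
    exact Finsupp.embDomain_of_notMem_range _ _ _ hi
  ext i
  rw [Finsupp.add_apply, fullExponent_apply]
  by_cases hi : i ∈ K
  · rw [hin hK hi, hout hK' (by simpa using hi), add_zero]
  · rw [hout hK hi, hin hK' (by simpa using hi), zero_add]

theorem hurwitzSeries_sort (μ ν : List ℤ) (k : ℤ) {K : Finset (Fin s)} (hK : K.card = t) :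
    hurwitzSeries μ ν k (K.sort (· ≤ ·)) =
      MvPowerSeries.rename (K.orderEmbOfFin hK).toEmbedding
        (hurwitzSeries μ ν k (List.finRange t)) := by
  rw [← hurwitzSeries_map, ← Finset.listMap_orderEmbOfFin_finRange K hK]
  rfl

theorem le_order_hurwitzSeries_left {μ : Fin m → ℤ} {ν : Fin n → ℤ} {k : ℤ}
    (he : ∑ x : OpIndex m n s, opEnergy μ ν k x = 0)
    (hne : ∀ B : Finset (OpIndex m n s), B.Nonempty → B ≠ Finset.univ →
      ∑ x ∈ B, opEnergy μ ν k x ≠ 0)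
    (hfull : ¬(I = Finset.univ ∧ J = Finset.univ)) {K : Finset (Fin s)} {l : ℕ}
    (hl : I.card + K.card + J.card = l + 1) :
    (l : ℕ∞) ≤ (hurwitzSeries (parts μ I) (parts ν J ++ [delta I J K.card μ ν k]) k
      (K.sort (· ≤ ·))).order := by
  rw [hurwitzSeries_left]
  refine le_trans ?_ MvPowerSeries.le_order_smul
  exact le_order_leftVev (fun x => constantCoeff_opVar id x) he hne (opSet_ne_univ hfull K)
    (isPart_filter_allBlocks I K J) (by rw [length_filter_allBlocks, hl])

theorem le_order_hurwitzSeries_right {μ : Fin m → ℤ} {ν : Fin n → ℤ} {k : ℤ}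
    (he : ∑ x : OpIndex m n s, opEnergy μ ν k x = 0)
    (hne : ∀ B : Finset (OpIndex m n s), B.Nonempty → B ≠ Finset.univ →
      ∑ x ∈ B, opEnergy μ ν k x ≠ 0)
    (hempty : ¬(I = ∅ ∧ J = ∅)) {K : Finset (Fin s)} {l : ℕ}
    (hl : Iᶜ.card + Kᶜ.card + Jᶜ.card = l + 1) :
    (l : ℕ∞) ≤ (hurwitzSeries (delta I J K.card μ ν k :: parts μ Iᶜ) (parts ν Jᶜ) k
      (Kᶜ.sort (· ≤ ·))).order := by
  rw [hurwitzSeries_right]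
  refine le_trans ?_ MvPowerSeries.le_order_smul
  refine le_order_rightVev (fun x => constantCoeff_opVar id x) he hne (opSet_nonempty hempty K) ?_ ?_
  · rw [opSet_compl]
    exact isPart_filter_allBlocks Iᶜ Kᶜ Jᶜ
  · rw [opSet_compl, length_filter_allBlocks, hl]

/-- A leaky Hurwitz number vanishes if its exponent is below the order of the series. -/
theorem hurwitzNumber_eq_zero_of_order {μ ν : List ℤ} {k : ℤ} {r : ℕ} {K : Finset (Fin s)}
    (hK : K.card = t) {l : ℕ} (h : (l : ℕ∞) ≤ (hurwitzSeries μ ν k (K.sort (· ≤ ·))).order)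
    (hl : t * (r + 1) < l) : hurwitzNumber μ ν k r t = 0 := by
  rw [hurwitzSeries_sort μ ν k hK] at h
  rw [hurwitzNumber, ← MvPowerSeries.coeff_embDomain_rename (K.orderEmbOfFin hK).toEmbedding]
  refine MvPowerSeries.coeff_of_lt_order (lt_of_lt_of_le ?_ h)
  have hdeg : ((fullExponent t r).embDomain (K.orderEmbOfFin hK).toEmbedding).degree =
      (fullExponent t r).degree := by
    rw [Finsupp.degree_apply, Finsupp.degree_apply, Finsupp.support_embDomain, Finset.sum_map]
    simp only [Finsupp.embDomain_apply_self]
  rw [hdeg, degree_fullExponent]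
  exact_mod_cast hl

theorem card_add_card_pos (hempty : ¬(I = ∅ ∧ J = ∅)) : 0 < I.card + J.card := by
  by_contra h
  exact hempty ⟨Finset.card_eq_zero.1 (by omega), Finset.card_eq_zero.1 (by omega)⟩

theorem card_compl_add_card_compl_pos (hfull : ¬(I = Finset.univ ∧ J = Finset.univ)) :
    0 < Iᶜ.card + Jᶜ.card := by
  refine card_add_card_pos fun h => hfull ?_
  rwa [Finset.compl_eq_empty_iff, Finset.compl_eq_empty_iff] at h

/-- The contribution of a single set `K` to the wall crossing in genus zero. -/
theorem coeff_wallCrossing_term {μ : Fin m → ℤ} {ν : Fin n → ℤ} {k : ℤ}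
    (he : ∑ x : OpIndex m n s, opEnergy μ ν k x = 0)
    (hne : ∀ B : Finset (OpIndex m n s), B.Nonempty → B ≠ Finset.univ →
      ∑ x ∈ B, opEnergy μ ν k x ≠ 0)
    (hempty : ¬(I = ∅ ∧ J = ∅)) (hfull : ¬(I = Finset.univ ∧ J = Finset.univ))
    (hs : s + 2 = m + n) {K : Finset (Fin s)} (hK : K.card = t)
    (hδ : delta I J t μ ν k ≠ 0) :
    MvPowerSeries.coeff (fullExponent s 1) (((delta I J t μ ν k : ℚ) ^ 2) •
      (sigmaFactor (delta I J t μ ν k : ℚ) K *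
        hurwitzSeries (parts μ I) (parts ν J ++ [delta I J t μ ν k]) k (K.sort (· ≤ ·)) *
        hurwitzSeries (delta I J t μ ν k :: parts μ Iᶜ) (parts ν Jᶜ) k (Kᶜ.sort (· ≤ ·)))) =
    (delta I J t μ ν k : ℚ) *
      hurwitzNumber (parts μ I) (parts ν J ++ [delta I J t μ ν k]) k 1 t *
      hurwitzNumber (delta I J t μ ν k :: parts μ Iᶜ) (parts ν Jᶜ) k 1 (s - t) ∧
    (t + 1 ≠ I.card + J.card →
      hurwitzNumber (parts μ I) (parts ν J ++ [delta I J t μ ν k]) k 1 t *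
      hurwitzNumber (delta I J t μ ν k :: parts μ Iᶜ) (parts ν Jᶜ) k 1 (s - t) = 0) := by
  subst hK
  have hK' : Kᶜ.card = s - K.card := by rw [Finset.card_compl, Fintype.card_fin]
  have h1 := card_add_card_pos hempty
  have h2 := card_compl_add_card_compl_pos hfull
  have hI : I.card + Iᶜ.card = m := by rw [Finset.card_add_card_compl, Fintype.card_fin]
  have hJ : J.card + Jᶜ.card = n := by rw [Finset.card_add_card_compl, Fintype.card_fin]
  have hKs : K.card + Kᶜ.card = s := by rw [Finset.card_add_card_compl, Fintype.card_fin]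
  have hδ' : ((delta I J K.card μ ν k : ℤ) : ℚ) ≠ 0 := by exact_mod_cast hδ
  -- Each side of the cut has one operator more, namely the added boson, so `l` and `l'` are the
  -- numbers of operators beyond the second one. They add up to `m + n + s - 2 = 2 s`.
  obtain ⟨l, hl⟩ : ∃ l, I.card + K.card + J.card = l + 1 :=
    ⟨I.card + K.card + J.card - 1, by omega⟩
  obtain ⟨l', hl'⟩ : ∃ l, Iᶜ.card + Kᶜ.card + Jᶜ.card = l + 1 :=
    ⟨Iᶜ.card + Kᶜ.card + Jᶜ.card - 1, by omega⟩
  have ho := le_order_hurwitzSeries_left he hne hfull hl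
  have ho' := le_order_hurwitzSeries_right he hne hempty hl'
  refine ⟨?_, fun ht => ?_⟩
  -- The degree `2 s` is at most the order of the product of the two series, so only the constant
  -- term `1/δ` of the `ς`-factor counts.
  · rw [MvPowerSeries.coeff_smul, mul_assoc, coeff_mul_eq_of_le_order, constantCoeff_sigmaFactor hδ',
      hurwitzSeries_sort _ _ k rfl, hurwitzSeries_sort _ _ k hK',
      ← embDomain_fullExponent_add rfl hK', coeff_rename_mul_rename]
    · unfold hurwitzNumber
      field_simp
    · rw [Set.disjoint_left]
      rintro _ ⟨a, rfl⟩ ⟨b, hb⟩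
      have h3 : K.orderEmbOfFin rfl a ∈ K := Finset.orderEmbOfFin_mem K rfl a
      have h4 : Kᶜ.orderEmbOfFin hK' b ∈ Kᶜ := Finset.orderEmbOfFin_mem Kᶜ hK' b
      exact Finset.mem_compl.1 h4 (hb ▸ h3)
    · refine le_trans ?_ ((add_le_add ho ho').trans MvPowerSeries.le_order_mul)
      rw [degree_fullExponent]
      have : s * (1 + 1) = l + l' := by omega
      rw [this, Nat.cast_add]
  -- The first number has exponent of degree `2 t` and order at least `|I| + |J| + t - 1`, so it
  -- vanishes for `t < |I| + |J| - 1`. For larger `t` the second one vanishes likewise.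
  · rcases lt_or_gt_of_ne ht with h | h
    · rw [hurwitzNumber_eq_zero_of_order rfl ho (by omega), zero_mul]
    · rw [hurwitzNumber_eq_zero_of_order hK' ho' (by omega), mul_zero]

theorem coeff_wallCrossingSeries {μ : Fin m → ℤ} {ν : Fin n → ℤ} {k : ℤ}
    (he : ∑ x : OpIndex m n s, opEnergy μ ν k x = 0)
    (hne : ∀ B : Finset (OpIndex m n s), B.Nonempty → B ≠ Finset.univ →
      ∑ x ∈ B, opEnergy μ ν k x ≠ 0)
    (hempty : ¬(I = ∅ ∧ J = ∅)) (hfull : ¬(I = Finset.univ ∧ J = Finset.univ))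
    (hs : s + 2 = m + n) (hδ : delta I J t μ ν k ≠ 0) :
    (t + 1 = I.card + J.card →
      MvPowerSeries.coeff (fullExponent s 1) (wallCrossingSeries s I J t μ ν k) =
        ((m + n - 2).choose (I.card + J.card - 1) : ℚ) * (delta I J t μ ν k : ℚ) *
          hurwitzNumber (parts μ I) (parts ν J ++ [delta I J t μ ν k]) k 1
            (I.card + J.card - 1) *
          hurwitzNumber (delta I J t μ ν k :: parts μ Iᶜ) (parts ν Jᶜ) k 1
            (Iᶜ.card + Jᶜ.card - 1)) ∧
    (t + 1 ≠ I.card + J.card →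
      MvPowerSeries.coeff (fullExponent s 1) (wallCrossingSeries s I J t μ ν k) = 0) := by
  have hterm := fun (K : Finset (Fin s)) (hK : K.card = t) =>
    coeff_wallCrossing_term he hne hempty hfull hs hK hδ
  have h2 := card_compl_add_card_compl_pos hfull
  have hI : I.card + Iᶜ.card = m := by rw [Finset.card_add_card_compl, Fintype.card_fin]
  have hJ : J.card + Jᶜ.card = n := by rw [Finset.card_add_card_compl, Fintype.card_fin]
  unfold wallCrossingSeries
  rw [map_sum]
  refine ⟨fun ht => ?_, fun ht => Finset.sum_eq_zero fun K hK => ?_⟩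
  -- The contribution of `K` depends only on its size, so the sum is the number of `t`-subsets times
  -- one term.
  · rw [Finset.sum_congr rfl fun K hK => (hterm K (Finset.mem_filter.1 hK).2).1, Finset.sum_const,
      Finset.univ_filter_card_eq, Finset.card_powersetCard, Finset.card_univ, Fintype.card_fin,
      nsmul_eq_mul, show m + n - 2 = s by omega, show I.card + J.card - 1 = t by omega,
      show Iᶜ.card + Jᶜ.card - 1 = s - t by omega]
    ring
  · obtain ⟨h3, h4⟩ := hterm K (Finset.mem_filter.1 hK).2
    rw [h3, mul_assoc, h4 ht, mul_zero]

end GenusZero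

end

end LeakyHurwitz

/-! ### The theorem -/

theorem mainTheorem5 (m n s r : ℕ) (I : Finset (Fin m)) (J : Finset (Fin n)) (t : ℕ)
    (ht : t ≤ s)
    (hempty : ¬(I = ∅ ∧ J = ∅)) (hfull : ¬(I = Finset.univ ∧ J = Finset.univ))
    (c₁ c₂ : Set (LeakyHurwitz.Ambient m n))
    (hc : LeakyHurwitz.BorderWall s I J t c₁ c₂) :
    (∃ P₁ : LeakyHurwitz.ParamPoly m n, LeakyHurwitz.IsChamberPolynomial s r c₁ P₁) ∧
    (∃ P₂ : LeakyHurwitz.ParamPoly m n, LeakyHurwitz.IsChamberPolynomial s r c₂ P₂) ∧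
    ∀ P₁ P₂ : LeakyHurwitz.ParamPoly m n,
      LeakyHurwitz.IsChamberPolynomial s r c₁ P₁ →
      LeakyHurwitz.IsChamberPolynomial s r c₂ P₂ →
      ∀ (μ : Fin m → ℤ) (ν : Fin n → ℤ) (k : ℤ), LeakyHurwitz.latticePoint μ ν k ∈ c₁ →
        (P₁.value μ ν k - P₂.value μ ν k =
          MvPowerSeries.coeff (LeakyHurwitz.fullExponent s r)
            (LeakyHurwitz.wallCrossingSeries s I J t μ ν k)) ∧
        (r = 1 → s + 2 = m + n →
          (t + 1 = I.card + J.card →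
            P₁.value μ ν k - P₂.value μ ν k =
              ((m + n - 2).choose (I.card + J.card - 1) : ℚ) *
                (LeakyHurwitz.delta I J t μ ν k : ℚ) *
                LeakyHurwitz.hurwitzNumber (LeakyHurwitz.parts μ I)
                  (LeakyHurwitz.parts ν J ++ [LeakyHurwitz.delta I J t μ ν k]) k 1
                  (I.card + J.card - 1) *
                LeakyHurwitz.hurwitzNumber (LeakyHurwitz.delta I J t μ ν k :: LeakyHurwitz.parts μ Iᶜ)
                  (LeakyHurwitz.parts ν Jᶜ) k 1 (Iᶜ.card + Jᶜ.card - 1)) ∧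
          (t + 1 ≠ I.card + J.card → P₁.value μ ν k - P₂.value μ ν k = 0))
  := by
  obtain ⟨h₁, h₂, h⟩ := LeakyHurwitz.wallCrossing r ht hempty hfull hc
  refine ⟨h₁, h₂, fun P₁ P₂ hP₁ hP₂ μ ν k hq => ⟨h P₁ P₂ hP₁ hP₂ μ ν k hq, ?_⟩⟩
  rintro rfl hs
  obtain ⟨p, hpw, hp, -⟩ := hc.common_face
  have hcomp := hc.chamber₁.compatible hpw.1 hp hq
  have hδ : LeakyHurwitz.delta I J t μ ν k ≠ 0 := by
    have hpos := hc.pos _ hq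
    rw [LeakyHurwitz.wallForm_latticePoint] at hpos
    exact_mod_cast hpos.ne'
  rw [h P₁ P₂ hP₁ hP₂ μ ν k hq]
  exact LeakyHurwitz.coeff_wallCrossingSeries hcomp.sum_eq hcomp.ne_zero hempty hfull hs hδ
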